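/- Let $\alpha_1,\dots,\alpha_n$ be the simple roots, spanning the Euclidean space $\mathbb R^n$ with scalar product $\langle\cdot,\cdot\rangle$, of an irreducible reduced root system of type $A_n$ $(n\ge1)$, $B_n$ $(n\ge3)$, $C_n$ $(n\ge2)$, $D_n$ $(n\ge4)$, $E_6,E_7,E_8,F_4$ or $G_2$. The simple roots are numbered along the Dynkin diagram; the last two roots of $D_n$ are the two fork ends attached to $\alpha_{n-2}$, and for $E_6$ the roots $1,\dots,5$ form a chain and root $6$ is attached to root $3$. Let $\alpha_i^\vee=2\alpha_i/\langle\alpha_i,\alpha_i\rangle$, and let $\omega_i,\omega_i^\vee$ be given by $\langle\omega_i,\alpha_j^\vee\rangle=\delta_{ij}=\langle\omega_i^\vee,\alpha_j\rangle$. Let $W$ be the Weyl group, $\rho=\omega_1+\dots+\omega_n$, and let $P^+=\{\lambda_1\omega_1+\dots+\lambda_n\omega_n:\lambda_i\in\mathbb Z_{\ge0}\}$. For $\lambda\in P^+$ let $h_\lambda=|\{w\in W: w\lambda=\lambda\}|$. Let $m_i$ be the coefficients of the highest root in the simple roots, and $m_i^\vee$ the coefficients of the highest root of the dual root system in the $\alpha_i^\vee$.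 The $m$-degree of $\lambda\in P^+$ is $|\lambda|_m=\sum_i\lambda_im_i^\vee$; $P^+_M=\{\lambda\in P^+:|\lambda|_m\le M\}$; and $\Pi_M\subset\mathbb C[y_1,\dots,y_n]$ is the space of polynomials all of whose monomials $y_1^{\lambda_1}\cdots y_n^{\lambda_n}$ satisfy $|\lambda|_m\le M$ (including $0$). For $\lambda\in P^+$ and $x\in\mathbb R^n$ put $$C_\lambda(x)=\sum_{\nu\in W\lambda}e^{2\pi i\langle\nu,x\rangle},\qquad S_\rho(x)=\sum_{w\in W}\det(w)\,e^{2\pi i\langle w\rho,x\rangle},\qquad Z_j=C_{\omega_j}.$$ Let $j\mapsto j'$ be the following involution of $\{1,\dots,n\}$: $j'=n+1-j$ for $A_n$; exchange of $n-1$ and $n$ for $D_n$ with $n$ odd; $1\leftrightarrow5$, $2\leftrightarrow4$ for $E_6$; the identity in all other cases. Put $X_j=Z_j$ if $j'=j$, and $X_j=\frac{Z_j+Z_{j'}}2$, $X_{j'}=\frac{Z_j-Z_{j'}}{2i}$ if $j<j'$. Let $\kappa=2^{-\lfloor n/2\rfloor}$ for $A_n$, $\kappa=\frac12$ for $D_n$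 with $n$ odd, $\kappa=\frac14$ for $E_6$, and $\kappa=1$ otherwise. Then the functions $X_j$ are real-valued, so that $X=(X_1,\dots,X_n)$ maps $\mathbb R^n$ to $\mathbb R^n$, and there are unique polynomials $K$ and $p_\lambda$ $(\lambda\in P^+)$ in $\mathbb C[y_1,\dots,y_n]$ with $|S_\rho|^2=K(X_1,\dots,X_n)$ and $C_\lambda=p_\lambda(X_1,\dots,X_n)$. Let $$F=\Big\{\sum_i y_i\omega_i^\vee:\ y_0,\dots,y_n\ge0,\ y_0+\sum_i m_iy_i=1\Big\},\qquad\Omega=X(F),$$ and let $L^2_K(\Omega)$ be the Hilbert space of (classes of) measurable $f:\Omega\to\mathbb C$ with $\int_\Omega|f|^2K^{-1/2}\,dy<\infty$, with the inner product $$(f,g)_K=\frac1{\kappa(2\pi)^n}\int_\Omega f(y)\overline{g(y)}\,K(y)^{-1/2}\,dy .$$ All polynomials belong to $L^2_K(\Omega)$, and the following hold. 1. $(p_\lambda,p_{\lambda'})_K=h_\lambda^{-1}\delta_{\lambda,\lambda'}$ for all $\lambda,\lambda'\in P^+$. 2. The $p_\lambda$ form an (orthogonal) Hilbert basis of $L^2_K(\Omega)$,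 that is, $(\sqrt{h_\lambda}\,p_\lambda)_{\lambda\in P^+}$ is an orthonormal Hilbert basis; every $f\in L^2_K(\Omega)$ has the norm-convergent expansion $f=\sum_{\lambda\in P^+}h_\lambda(f,p_\lambda)_K\,p_\lambda$. 3. For every $f\in L^2_K(\Omega)$ and every integer $M\ge0$, the set $P^+_M$ is finite, the polynomial $u_M[f]=\sum_{\lambda\in P^+_M}h_\lambda(f,p_\lambda)_K\,p_\lambda$ belongs to $\Pi_M$, and it is the best approximation of $f$ by elements of $\Pi_M$: $\|f-u_M[f]\|\le\|f-q\|$ in the norm of $L^2_K(\Omega)$ for all $q\in\Pi_M$, with equality only for $q=u_M[f]$. -/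

import Mathlib

noncomputable section

namespace WeylOrbit

open MeasureTheory Module

open scoped ComplexConjugate

/-- Types of simple Lie algebras (equivalently, of irreducible reduced root systems), by rank. -/
inductive SimpleType : ℕ → Type
  | A (n : ℕ) (hn : 1 ≤ n) : SimpleType n
  | B (n : ℕ) (hn : 3 ≤ n) : SimpleType n
  | C (n : ℕ) (hn : 2 ≤ n) : SimpleType n
  | D (n : ℕ) (hn : 4 ≤ n) : SimpleType n
  | E6 : SimpleType 6
  | E7 : SimpleType 7
  | E8 : SimpleType 8
  | F4 : SimpleType 4
  | G2 : SimpleType 2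

/-- The Cartan matrix of type `E₆`, with nodes `1 - 2 - 3 - 4 - 5` in a chain and node `6`
attached to node `3`. -/
def cartanE6 : Matrix (Fin 6) (Fin 6) ℤ :=
  !![ 2, -1,  0,  0,  0,  0;
     -1,  2, -1,  0,  0,  0;
      0, -1,  2, -1,  0, -1;
      0,  0, -1,  2, -1,  0;
      0,  0,  0, -1,  2,  0;
      0,  0, -1,  0,  0,  2]

/-- The Cartan matrix `⟨αᵢ, αⱼ^∨⟩` of each type. -/
def SimpleType.cartan : {n : ℕ} → SimpleType n → Matrix (Fin n) (Fin n) ℤ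
  | _, .A n _ => CartanMatrix.A n
  | _, .B n _ => CartanMatrix.B n
  | _, .C n _ => CartanMatrix.C n
  | _, .D n _ => CartanMatrix.D n
  | _, .E6 => cartanE6
  | _, .E7 => CartanMatrix.E₇
  | _, .E8 => CartanMatrix.E₈
  | _, .F4 => CartanMatrix.F₄
  | _, .G2 => CartanMatrix.G₂

/-- The pairing of indices `j ↔ j'` according to which the functions `Z_j` and `Z_{j'}` are combined
in the `X`-transform: reversal of the diagram for `A_n`, exchange of the last two nodes for `D_n`
with `n` odd, `1 ↔ 5`, `2 ↔ 4` for `E₆`, and no pairing in all other cases. -/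
def SimpleType.partner : {n : ℕ} → SimpleType n → Fin n → Fin n
  | _, .A _ _ => Fin.rev
  | _, .D n hn =>
      if Odd n then Equiv.swap ⟨n - 2, by omega⟩ ⟨n - 1, by omega⟩ else id
  | _, .E6 => ![4, 3, 2, 1, 0, 5]
  | _, _ => id

/-- The constant `κ`. -/
def SimpleType.kappa : {n : ℕ} → SimpleType n → ℝ
  | _, .A n _ => (1 / 2) ^ (n / 2)
  | _, .D n _ => if Odd n then 1 / 2 else 1
  | _, .E6 => 1 / 4
  | _, _ => 1

variable {n : ℕ}

/-- The vectors dual to a basis `b` with respect to the scalar product: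
`⟨dualVec b i, b j⟩ = δ_{ij}`. -/
def dualVec (b : Basis (Fin n) ℝ (EuclideanSpace ℝ (Fin n))) (i : Fin n) :
    EuclideanSpace ℝ (Fin n) :=
  (InnerProductSpace.toDual ℝ (EuclideanSpace ℝ (Fin n))).symm
    (LinearMap.toContinuousLinearMap (b.coord i))

theorem inner_dualVec (b : Basis (Fin n) ℝ (EuclideanSpace ℝ (Fin n))) (i j : Fin n) :
    inner ℝ (dualVec b i) (b j) = if i = j then 1 else 0 := by
  simp [dualVec, Finsupp.single_apply, eq_comm]

/-- `α` is a system of simple roots of type `T`: the Cartan integers `2⟨αᵢ, αⱼ⟩ / ⟨αⱼ, αⱼ⟩` are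
those of `T`. -/
def IsSimpleRoots (T : SimpleType n) (α : Basis (Fin n) ℝ (EuclideanSpace ℝ (Fin n))) : Prop :=
  ∀ i j, 2 * inner ℝ (α i) (α j) / inner ℝ (α j) (α j) = (T.cartan i j : ℝ)

/-- The simple coroots `αᵢ^∨ = 2αᵢ / ⟨αᵢ, αᵢ⟩`, as a basis. -/
def coroot (α : Basis (Fin n) ℝ (EuclideanSpace ℝ (Fin n))) :
    Basis (Fin n) ℝ (EuclideanSpace ℝ (Fin n)) :=
  α.isUnitSMul (w := fun i => 2 / inner ℝ (α i) (α i)) fun i =>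
    (div_ne_zero two_ne_zero (inner_self_ne_zero.2 (α.ne_zero i))).isUnit

/-- The Weyl group, generated by the reflections in the hyperplanes orthogonal to the simple
roots. -/
def weylGroup (α : Basis (Fin n) ℝ (EuclideanSpace ℝ (Fin n))) :
    Subgroup (EuclideanSpace ℝ (Fin n) ≃ₗᵢ[ℝ] EuclideanSpace ℝ (Fin n)) :=
  Subgroup.closure (Set.range fun i => (ℝ ∙ α i)ᗮ.reflection)

/-- The orbit `W v`. -/
def orbit (α : Basis (Fin n) ℝ (EuclideanSpace ℝ (Fin n))) (v : EuclideanSpace ℝ (Fin n)) :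
    Set (EuclideanSpace ℝ (Fin n)) :=
  {u | ∃ w ∈ weylGroup α, w v = u}

/-- The root system `W {α₁, …, αₙ}`. -/
def roots (α : Basis (Fin n) ℝ (EuclideanSpace ℝ (Fin n))) : Set (EuclideanSpace ℝ (Fin n)) :=
  ⋃ i, orbit α (α i)

/-- `m₁, …, mₙ` are the coordinates, in the simple roots, of the highest root: the root that exceeds
every root by a sum of simple roots. -/
def IsMarks (α : Basis (Fin n) ℝ (EuclideanSpace ℝ (Fin n))) (m : Fin n → ℕ) : Prop :=
  (∑ i, (m i : ℝ) • α i) ∈ roots α ∧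
    ∀ β ∈ roots α, ∃ k : Fin n → ℕ, (∑ i, (m i : ℝ) • α i) - β = ∑ i, (k i : ℝ) • α i

/-- The marks `m₁, …, mₙ` of the highest root. -/
def marks (α : Basis (Fin n) ℝ (EuclideanSpace ℝ (Fin n))) : Fin n → ℕ :=
  Classical.epsilon (IsMarks α)

/-- The dual marks `m₁^∨, …, mₙ^∨` of the highest dual root. -/
def dualMarks (α : Basis (Fin n) ℝ (EuclideanSpace ℝ (Fin n))) : Fin n → ℕ :=
  marks (coroot α)

/-- The fundamental weights `ωᵢ`, given by `⟨ωᵢ, αⱼ^∨⟩ = δ_{ij}`. -/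
def fundWeight (α : Basis (Fin n) ℝ (EuclideanSpace ℝ (Fin n))) (i : Fin n) :
    EuclideanSpace ℝ (Fin n) :=
  dualVec (coroot α) i

/-- The fundamental coweights `ωᵢ^∨`, given by `⟨ωᵢ^∨, αⱼ⟩ = δ_{ij}`. -/
def fundCoweight (α : Basis (Fin n) ℝ (EuclideanSpace ℝ (Fin n))) (i : Fin n) :
    EuclideanSpace ℝ (Fin n) :=
  dualVec α i

/-- The dominant weight `λ = λ₁ω₁ + … + λₙωₙ`. The cone `P⁺` is parametrized by the coordinates
`(λ₁, …, λₙ)`, which are also the exponents of the monomial attached to `λ`. -/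
def weight (α : Basis (Fin n) ℝ (EuclideanSpace ℝ (Fin n))) (l : Fin n →₀ ℕ) :
    EuclideanSpace ℝ (Fin n) :=
  ∑ i, (l i : ℝ) • fundWeight α i

/-- `ρ = ω₁ + … + ωₙ`. -/
def rho (α : Basis (Fin n) ℝ (EuclideanSpace ℝ (Fin n))) : EuclideanSpace ℝ (Fin n) :=
  ∑ i, fundWeight α i

/-- `h_λ`, the order of the stabilizer of `λ` in `W`. -/
def stabOrder (α : Basis (Fin n) ℝ (EuclideanSpace ℝ (Fin n))) (l : Fin n →₀ ℕ) : ℕ :=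
  Nat.card {w : EuclideanSpace ℝ (Fin n) ≃ₗᵢ[ℝ] EuclideanSpace ℝ (Fin n) //
    w ∈ weylGroup α ∧ w (weight α l) = weight α l}

/-- The `m`-degree `|λ|_m = λ₁ m₁^∨ + … + λₙ mₙ^∨`. -/
def mDegree (α : Basis (Fin n) ℝ (EuclideanSpace ℝ (Fin n))) (l : Fin n →₀ ℕ) : ℕ :=
  Finsupp.weight (dualMarks α) l

/-- `P⁺_M`, the dominant weights of `m`-degree at most `M`. -/
def weightsUpTo (α : Basis (Fin n) ℝ (EuclideanSpace ℝ (Fin n))) (M : ℕ) : Set (Fin n →₀ ℕ) :=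
  {l | mDegree α l ≤ M}

/-- `Π_M`, the polynomials of `m`-degree at most `M`. -/
def polysUpTo (α : Basis (Fin n) ℝ (EuclideanSpace ℝ (Fin n))) (M : ℕ) :
    Set (MvPolynomial (Fin n) ℂ) :=
  {q | MvPolynomial.weightedTotalDegree (dualMarks α) q ≤ M}

/-- The symmetric orbit function `C_λ(x) = ∑_{ν ∈ Wλ} exp(2πi⟨ν, x⟩)`. -/
def orbitC (α : Basis (Fin n) ℝ (EuclideanSpace ℝ (Fin n))) (l : Fin n →₀ ℕ)
    (x : EuclideanSpace ℝ (Fin n)) : ℂ :=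
  ∑ᶠ ν ∈ orbit α (weight α l), Complex.exp (2 * Real.pi * Complex.I * (inner ℝ ν x : ℝ))

/-- The antisymmetric orbit function `S_ρ(x) = ∑_{w ∈ W} det(w) exp(2πi⟨wρ, x⟩)`. -/
def orbitSRho (α : Basis (Fin n) ℝ (EuclideanSpace ℝ (Fin n)))
    (x : EuclideanSpace ℝ (Fin n)) : ℂ :=
  ∑ᶠ w ∈ weylGroup α,
    ((LinearMap.det (w.toLinearEquiv : EuclideanSpace ℝ (Fin n) →ₗ[ℝ] EuclideanSpace ℝ (Fin n)) :
      ℝ) : ℂ) * Complex.exp (2 * Real.pi * Complex.I * (inner ℝ (w (rho α)) x : ℝ))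

/-- `Z_j = C_{ω_j}`. -/
def orbitZ (α : Basis (Fin n) ℝ (EuclideanSpace ℝ (Fin n))) (j : Fin n)
    (x : EuclideanSpace ℝ (Fin n)) : ℂ :=
  orbitC α (Finsupp.single j 1) x

/-- The functions `X_j`: equal to `Z_j` if `j` is unpaired, and to `(Z_j + Z_{j'}) / 2` and
`(Z_{j} - Z_{j'}) / (2i)` at the smaller index `j` and at the larger index `j'` of a pair. -/
def coordX (T : SimpleType n) (α : Basis (Fin n) ℝ (EuclideanSpace ℝ (Fin n))) (j : Fin n)
    (x : EuclideanSpace ℝ (Fin n)) : ℂ :=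
  if T.partner j = j then orbitZ α j x
  else if j < T.partner j then (orbitZ α j x + orbitZ α (T.partner j) x) / 2
  else (orbitZ α (T.partner j) x - orbitZ α j x) / (2 * Complex.I)

/-- The transform `X : ℝⁿ → ℝⁿ`. -/
def transformX (T : SimpleType n) (α : Basis (Fin n) ℝ (EuclideanSpace ℝ (Fin n)))
    (x : EuclideanSpace ℝ (Fin n)) : EuclideanSpace ℝ (Fin n) :=
  WithLp.toLp 2 fun j => (coordX T α j x).re

/-- The fundamental domain `F` of the affine Weyl group: the points `y₁ω₁^∨ + … + yₙωₙ^∨` with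
`y₀, …, yₙ ≥ 0` and `y₀ + y₁m₁ + … + yₙmₙ = 1`. -/
def fundDomain (α : Basis (Fin n) ℝ (EuclideanSpace ℝ (Fin n))) :
    Set (EuclideanSpace ℝ (Fin n)) :=
  {x | ∃ (y₀ : ℝ) (y : Fin n → ℝ), 0 ≤ y₀ ∧ (∀ i, 0 ≤ y i) ∧
    y₀ + ∑ i, y i * (marks α i : ℝ) = 1 ∧ x = ∑ i, y i • fundCoweight α i}

/-- `Ω = X(F)`. -/
def domainOmega (T : SimpleType n) (α : Basis (Fin n) ℝ (EuclideanSpace ℝ (Fin n))) :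
    Set (EuclideanSpace ℝ (Fin n)) :=
  transformX T α '' fundDomain α

/-- The function on `ℝⁿ` defined by a complex polynomial. -/
def polyFun (q : MvPolynomial (Fin n) ℂ) (y : EuclideanSpace ℝ (Fin n)) : ℂ :=
  MvPolynomial.eval (fun j => ((y j : ℝ) : ℂ)) q

/-- `K` is a polynomial with `|S_ρ|² = K(X₁, …, Xₙ)`. -/
def IsWeightPoly (T : SimpleType n) (α : Basis (Fin n) ℝ (EuclideanSpace ℝ (Fin n)))
    (K : MvPolynomial (Fin n) ℂ) : Prop :=
  ∀ x, ((‖orbitSRho α x‖ ^ 2 : ℝ) : ℂ) = polyFun K (transformX T α x)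

/-- `p_λ`, `λ ∈ P⁺`, are polynomials with `C_λ = p_λ(X₁, …, Xₙ)`. -/
def IsCPolys (T : SimpleType n) (α : Basis (Fin n) ℝ (EuclideanSpace ℝ (Fin n)))
    (p : (Fin n →₀ ℕ) → MvPolynomial (Fin n) ℂ) : Prop :=
  ∀ l x, orbitC α l x = polyFun (p l) (transformX T α x)

/-- The weight function `K^{-1/2}`. -/
def weightFun (K : MvPolynomial (Fin n) ℂ) (y : EuclideanSpace ℝ (Fin n)) : ℝ :=
  (polyFun K y).re ^ (-(1 / 2) : ℝ)

/-- `(f, g)_K = (κ (2π)ⁿ)⁻¹ ∫_Ω f(y) conj(g(y)) K(y)^{-1/2} dy`. -/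
def scalarK (T : SimpleType n) (α : Basis (Fin n) ℝ (EuclideanSpace ℝ (Fin n)))
    (K : MvPolynomial (Fin n) ℂ) (f g : EuclideanSpace ℝ (Fin n) → ℂ) : ℂ :=
  ((1 / (T.kappa * (2 * Real.pi) ^ n) : ℝ) : ℂ) *
    ∫ y in domainOmega T α, f y * conj (g y) * (weightFun K y : ℂ)

/-- The measure `(κ (2π)ⁿ)⁻¹ K(y)^{-1/2} dy` on `Ω`. -/
def measureK (T : SimpleType n) (α : Basis (Fin n) ℝ (EuclideanSpace ℝ (Fin n)))
    (K : MvPolynomial (Fin n) ℂ) : Measure (EuclideanSpace ℝ (Fin n)) :=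
  (volume.restrict (domainOmega T α)).withDensity fun y =>
    ENNReal.ofReal (1 / (T.kappa * (2 * Real.pi) ^ n) * weightFun K y)

/-- The Hilbert space `L²_K(Ω)`. -/
abbrev L2K (T : SimpleType n) (α : Basis (Fin n) ℝ (EuclideanSpace ℝ (Fin n)))
    (K : MvPolynomial (Fin n) ℂ) : Type :=
  Lp ℂ 2 (measureK T α K)

/-- The coefficient `a_λ = h_λ (f, p_λ)_K`. -/
def coeffK (T : SimpleType n) (α : Basis (Fin n) ℝ (EuclideanSpace ℝ (Fin n)))
    (K : MvPolynomial (Fin n) ℂ) (p : (Fin n →₀ ℕ) → MvPolynomial (Fin n) ℂ)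
    (f : EuclideanSpace ℝ (Fin n) → ℂ) (l : Fin n →₀ ℕ) : ℂ :=
  (stabOrder α l : ℂ) * scalarK T α K f (polyFun (p l))

/-- The polynomial `u_M[f] = ∑_{λ ∈ P⁺_M} h_λ (f, p_λ)_K p_λ`. -/
def truncation (T : SimpleType n) (α : Basis (Fin n) ℝ (EuclideanSpace ℝ (Fin n)))
    (K : MvPolynomial (Fin n) ℂ) (p : (Fin n →₀ ℕ) → MvPolynomial (Fin n) ℂ) (M : ℕ)
    (f : EuclideanSpace ℝ (Fin n) → ℂ) : MvPolynomial (Fin n) ℂ :=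
  ∑ᶠ l ∈ weightsUpTo α M, coeffK T α K p f l • p l

end WeylOrbit

end

noncomputable section

namespace WeylOrbit

open MeasureTheory Module

open scoped ComplexConjugate

/-- The Euclidean space in which the root systems live. -/
abbrev Eucl (n : ℕ) := EuclideanSpace ℝ (Fin n)

variable {n : ℕ} {α : Basis (Fin n) ℝ (Eucl n)}

/-! ### Simple reflections and the Weyl group -/

theorem inner_self_pos (α : Basis (Fin n) ℝ (Eucl n)) (i : Fin n) :
    0 < inner ℝ (α i) (α i) :=
  real_inner_self_pos.2 (α.ne_zero i)

theorem coroot_apply (α : Basis (Fin n) ℝ (Eucl n)) (i : Fin n) :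
    coroot α i = (2 / inner ℝ (α i) (α i)) • α i := by
  rw [coroot, Basis.isUnitSMul_apply]

theorem inner_coroot (α : Basis (Fin n) ℝ (Eucl n)) (v : Eucl n) (i : Fin n) :
    inner ℝ v (coroot α i) = 2 * inner ℝ v (α i) / inner ℝ (α i) (α i) := by
  rw [coroot_apply, real_inner_smul_right]; ring

theorem inner_eq_inner_coroot (α : Basis (Fin n) ℝ (Eucl n)) (v : Eucl n) (i : Fin n) :
    2 * inner ℝ v (α i) = inner ℝ v (coroot α i) * inner ℝ (α i) (α i) := by
  rw [inner_coroot, div_mul_cancel₀ _ (inner_self_pos α i).ne']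

theorem inner_coroot_self (α : Basis (Fin n) ℝ (Eucl n)) (i : Fin n) :
    inner ℝ (α i) (coroot α i) = 2 := by
  rw [inner_coroot, mul_div_assoc, div_self (inner_self_pos α i).ne', mul_one]

theorem inner_coroot_coroot (α : Basis (Fin n) ℝ (Eucl n)) (i : Fin n) :
    inner ℝ (coroot α i) (coroot α i) = 4 / inner ℝ (α i) (α i) := by
  have := (inner_self_pos α i).ne'
  rw [inner_coroot, coroot_apply, real_inner_smul_left]; field_simp; norm_num

@[simp] theorem coroot_coroot (α : Basis (Fin n) ℝ (Eucl n)) : coroot (coroot α) = α := by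
  apply Basis.eq_of_apply_eq
  intro i
  have := (inner_self_pos α i).ne'
  rw [coroot_apply, inner_coroot_coroot, coroot_apply, smul_smul]
  rw [show 2 / (4 / inner ℝ (α i) (α i)) * (2 / inner ℝ (α i) (α i)) = 1 by field_simp; norm_num,
    one_smul]

theorem repr_coroot (α : Basis (Fin n) ℝ (Eucl n)) (v : Eucl n) (i : Fin n) :
    α.repr v i = 2 / inner ℝ (α i) (α i) * (coroot α).repr v i := by
  conv_lhs => rw [← (coroot α).sum_repr v]
  simp [coroot_apply, Finsupp.single_apply, mul_comm]

/-- The reflection in the hyperplane orthogonal to the `i`-th simple root. -/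
def simpleRefl (α : Basis (Fin n) ℝ (Eucl n)) (i : Fin n) : Eucl n ≃ₗᵢ[ℝ] Eucl n :=
  (ℝ ∙ α i)ᗮ.reflection

theorem simpleRefl_apply (α : Basis (Fin n) ℝ (Eucl n)) (i : Fin n) (v : Eucl n) :
    simpleRefl α i v = v - inner ℝ v (coroot α i) • α i := by
  rw [simpleRefl, Submodule.reflection_orthogonal_apply, Submodule.reflection_singleton_apply,
    inner_coroot, real_inner_self_eq_norm_sq, real_inner_comm, two_smul, neg_sub]
  simp only [RCLike.ofReal_real_eq_id, id]
  rw [← add_smul]; congr 2; ring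

theorem simpleRefl_self (α : Basis (Fin n) ℝ (Eucl n)) (i : Fin n) :
    simpleRefl α i (α i) = -α i := by
  rw [simpleRefl_apply, inner_coroot_self, two_smul]; abel

theorem simpleRefl_simpleRefl (α : Basis (Fin n) ℝ (Eucl n)) (i : Fin n) (v : Eucl n) :
    simpleRefl α i (simpleRefl α i v) = v :=
  Submodule.reflection_reflection _ v

theorem simpleRefl_mul_self (α : Basis (Fin n) ℝ (Eucl n)) (i : Fin n) :
    simpleRefl α i * simpleRefl α i = 1 := by
  ext1 v; exact simpleRefl_simpleRefl α i v

theorem simpleRefl_mem (α : Basis (Fin n) ℝ (Eucl n)) (i : Fin n) :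
    simpleRefl α i ∈ weylGroup α :=
  Subgroup.subset_closure ⟨i, rfl⟩

theorem simpleRefl_coroot (α : Basis (Fin n) ℝ (Eucl n)) (i : Fin n) :
    simpleRefl (coroot α) i = simpleRefl α i := by
  ext1 v
  rw [simpleRefl_apply, simpleRefl_apply, coroot_coroot, coroot_apply, real_inner_smul_right,
    smul_smul, mul_comm]

theorem weylGroup_coroot (α : Basis (Fin n) ℝ (Eucl n)) :
    weylGroup (coroot α) = weylGroup α := by
  have := simpleRefl_coroot α
  simp only [simpleRefl] at this
  simp only [weylGroup, this]

/-- The product of the simple reflections of a word. -/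
def wordProd (α : Basis (Fin n) ℝ (Eucl n)) (L : List (Fin n)) : Eucl n ≃ₗᵢ[ℝ] Eucl n :=
  (L.map (simpleRefl α)).prod

theorem wordProd_mem (α : Basis (Fin n) ℝ (Eucl n)) (L : List (Fin n)) :
    wordProd α L ∈ weylGroup α :=
  Subgroup.list_prod_mem _ fun x hx => by
    obtain ⟨i, -, rfl⟩ := List.mem_map.1 hx
    exact simpleRefl_mem α i

theorem exists_wordProd {w : Eucl n ≃ₗᵢ[ℝ] Eucl n} (hw : w ∈ weylGroup α) :
    ∃ L, w = wordProd α L := by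
  induction hw using Subgroup.closure_induction with
  | mem x hx => obtain ⟨i, rfl⟩ := hx; exact ⟨[i], by simp [wordProd, simpleRefl]⟩
  | one => exact ⟨[], rfl⟩
  | mul x y _ _ hx hy =>
    obtain ⟨L, rfl⟩ := hx
    obtain ⟨L', rfl⟩ := hy
    exact ⟨L ++ L', by simp [wordProd]⟩
  | inv x _ hx =>
    obtain ⟨L, rfl⟩ := hx
    refine ⟨L.reverse, ?_⟩
    rw [wordProd, List.prod_inv_reverse, wordProd, List.map_reverse, List.map_map]
    congr 2

theorem simpleRefl_mem_orbit_induction {S : Set (Eucl n)} (hS : ∀ v ∈ S, ∀ i, simpleRefl α i v ∈ S)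
    {w : Eucl n ≃ₗᵢ[ℝ] Eucl n} (hw : w ∈ weylGroup α) {v : Eucl n} (hv : v ∈ S) : w v ∈ S := by
  obtain ⟨L, rfl⟩ := exists_wordProd hw
  induction L with
  | nil => exact hv
  | cons i L ih => exact hS _ (ih (wordProd_mem α L)) i

theorem inner_weyl_left (w : Eucl n ≃ₗᵢ[ℝ] Eucl n) (u v : Eucl n) :
    inner ℝ (w u) v = inner ℝ u (w⁻¹ v) := by
  rw [← LinearIsometryEquiv.inner_map_map w u (w⁻¹ v)]
  congr 1
  exact (w.apply_symm_apply v).symm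

/-! ### The root lattice and its positive cone -/

/-- The integer combinations of the simple roots. -/
def rootLattice (α : Basis (Fin n) ℝ (Eucl n)) : AddSubgroup (Eucl n) where
  carrier := {v | ∀ i, ∃ k : ℤ, α.repr v i = k}
  add_mem' {a b} ha hb i := by
    obtain ⟨k, hk⟩ := ha i
    obtain ⟨l, hl⟩ := hb i
    exact ⟨k + l, by simp [hk, hl]⟩
  zero_mem' i := ⟨0, by simp⟩
  neg_mem' {a} ha i := by
    obtain ⟨k, hk⟩ := ha i
    exact ⟨-k, by simp [hk]⟩

/-- The sums of simple roots. -/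
def posCone (α : Basis (Fin n) ℝ (Eucl n)) : AddSubmonoid (Eucl n) where
  carrier := {v | ∀ i, ∃ k : ℕ, α.repr v i = k}
  add_mem' {a b} ha hb i := by
    obtain ⟨k, hk⟩ := ha i
    obtain ⟨l, hl⟩ := hb i
    exact ⟨k + l, by simp [hk, hl]⟩
  zero_mem' i := ⟨0, by simp⟩

theorem mem_posCone_iff {v : Eucl n} :
    v ∈ posCone α ↔ v ∈ rootLattice α ∧ ∀ i, 0 ≤ α.repr v i := by
  refine ⟨fun h => ⟨fun i => ?_, fun i => ?_⟩, fun h i => ?_⟩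
  · obtain ⟨k, hk⟩ := h i; exact ⟨k, by simp [hk]⟩
  · obtain ⟨k, hk⟩ := h i; simp [hk]
  · obtain ⟨k, hk⟩ := h.1 i
    have := h.2 i
    rw [hk] at this
    refine ⟨k.toNat, ?_⟩
    rw [hk]; exact_mod_cast (Int.toNat_of_nonneg (by exact_mod_cast this)).symm

theorem posCone_le {v : Eucl n} (h : v ∈ posCone α) : v ∈ rootLattice α := (mem_posCone_iff.1 h).1

theorem simple_mem_posCone (α : Basis (Fin n) ℝ (Eucl n)) (i : Fin n) : α i ∈ posCone α := by
  intro j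
  by_cases h : i = j
  · exact ⟨1, by simp [h]⟩
  · exact ⟨0, by simp [h]⟩

theorem simple_mem_rootLattice (α : Basis (Fin n) ℝ (Eucl n)) (i : Fin n) : α i ∈ rootLattice α :=
  posCone_le (simple_mem_posCone α i)

theorem posCone_iff_exists_sum {v : Eucl n} :
    v ∈ posCone α ↔ ∃ k : Fin n → ℕ, v = ∑ i, (k i : ℝ) • α i := by
  refine ⟨fun h => ?_, ?_⟩
  · choose k hk using h
    exact ⟨k, by rw [← α.sum_repr v]; simp [hk]⟩
  · rintro ⟨k, rfl⟩ i
    exact ⟨k i, by simp [Finsupp.single_apply]⟩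

theorem rootLattice_iff_exists_sum {v : Eucl n} :
    v ∈ rootLattice α ↔ ∃ k : Fin n → ℤ, v = ∑ i, (k i : ℝ) • α i := by
  refine ⟨fun h => ?_, ?_⟩
  · choose k hk using h
    exact ⟨k, by rw [← α.sum_repr v]; simp [hk]⟩
  · rintro ⟨k, rfl⟩ i
    exact ⟨k i, by simp [Finsupp.single_apply]⟩

theorem int_smul_mem_rootLattice {v : Eucl n} (hv : v ∈ rootLattice α) (k : ℤ) :
    (k : ℝ) • v ∈ rootLattice α := by
  rw [Int.cast_smul_eq_zsmul]; exact zsmul_mem hv k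

theorem nat_smul_mem_posCone {v : Eucl n} (hv : v ∈ posCone α) (k : ℕ) :
    (k : ℝ) • v ∈ posCone α := by
  rw [Nat.cast_smul_eq_nsmul]; exact nsmul_mem hv k

theorem eq_zero_of_posCone {v : Eucl n} (h : v ∈ posCone α) (h' : -v ∈ posCone α) : v = 0 := by
  refine α.ext_elem fun i => ?_
  have h1 := (mem_posCone_iff.1 h).2 i
  have h2 := (mem_posCone_iff.1 h').2 i
  simp only [map_neg, Finsupp.coe_neg, Pi.neg_apply] at h2
  simp; linarith

/-- A basis of simple roots of an irreducible root system, by the properties that are used. They are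
inherited by the simple coroots. -/
structure IsRootBasis (α : Basis (Fin n) ℝ (Eucl n)) : Prop where
  int : ∀ i j, ∃ k : ℤ, inner ℝ (α i) (coroot α j) = k
  nonpos : ∀ i j, i ≠ j → inner ℝ (α i) (α j) ≤ 0
  conn : ∀ I : Set (Fin n), I.Nonempty →
    (∀ i ∈ I, ∀ j, inner ℝ (α i) (α j) ≠ 0 → j ∈ I) → ∀ j, j ∈ I
  len : ∃ (s : ℝ) (r : ℕ), 0 < s ∧ 0 < r ∧
    ∀ i, inner ℝ (α i) (α i) = s ∨ inner ℝ (α i) (α i) = r * s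

theorem IsRootBasis.dual (h : IsRootBasis α) : IsRootBasis (coroot α) where
  int i j := by
    obtain ⟨k, hk⟩ := h.int j i
    exact ⟨k, by rw [coroot_coroot, real_inner_comm, hk]⟩
  nonpos i j hij := by
    rw [coroot_apply, coroot_apply, real_inner_smul_left, real_inner_smul_right]
    have h1 := inner_self_pos α i
    have h2 := inner_self_pos α j
    have := h.nonpos i j hij
    exact mul_nonpos_of_nonneg_of_nonpos (by positivity)
      (mul_nonpos_of_nonneg_of_nonpos (by positivity) this)
  conn I hI hc := by
    refine h.conn I hI fun i hi j hij => hc i hi j ?_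
    have h1 := inner_self_pos α i
    have h2 := inner_self_pos α j
    rw [coroot_apply, coroot_apply, real_inner_smul_left, real_inner_smul_right]
    positivity
  len := by
    obtain ⟨s, r, hs, hr, hl⟩ := h.len
    refine ⟨4 / (r * s), r, by positivity, hr, fun i => ?_⟩
    rw [inner_coroot_coroot]
    have : (r : ℝ) ≠ 0 := by positivity
    rcases hl i with h' | h' <;> rw [h']
    · right; field_simp
    · left; rfl

theorem IsRootBasis.int_pairing (h : IsRootBasis α) {v : Eucl n} (hv : v ∈ rootLattice α)
    (j : Fin n) : ∃ k : ℤ, inner ℝ v (coroot α j) = k := by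
  obtain ⟨k, rfl⟩ := rootLattice_iff_exists_sum.1 hv
  choose A hA using h.int
  exact ⟨∑ i, k i * A i j, by simp [sum_inner, real_inner_smul_left, hA]⟩

theorem IsRootBasis.weyl_mem_rootLattice (h : IsRootBasis α) {w : Eucl n ≃ₗᵢ[ℝ] Eucl n}
    (hw : w ∈ weylGroup α) {v : Eucl n} (hv : v ∈ rootLattice α) : w v ∈ rootLattice α := by
  refine simpleRefl_mem_orbit_induction (S := rootLattice α) (fun v hv i => ?_) hw hv
  obtain ⟨k, hk⟩ := h.int_pairing hv i
  rw [simpleRefl_apply, hk]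
  exact sub_mem hv (int_smul_mem_rootLattice (simple_mem_rootLattice α i) k)

theorem IsRootBasis.finite_weylGroup (h : IsRootBasis α) :
    (weylGroup α : Set (Eucl n ≃ₗᵢ[ℝ] Eucl n)).Finite := by
  let S : Set (Eucl n) := Metric.closedBall 0 (∑ i, ‖α i‖) ∩ Submodule.span ℤ (Set.range α)
  have hS : S.Finite := ZSpan.setFinite_inter α Metric.isBounded_closedBall
  have hfin : (Set.pi Set.univ fun _ : Fin n => S).Finite := Set.Finite.pi fun _ => hS
  refine Set.Finite.of_finite_image (f := fun w i => w (α i)) (hfin.subset ?_) ?_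
  · rintro _ ⟨w, hw, rfl⟩ i -
    refine ⟨?_, ?_⟩
    · simp only [Metric.mem_closedBall, dist_zero_right, LinearIsometryEquiv.norm_map]
      exact Finset.single_le_sum (f := fun i => ‖α i‖) (fun i _ => norm_nonneg _)
        (Finset.mem_univ i)
    · rw [SetLike.mem_coe, Basis.mem_span_iff_repr_mem]
      intro j
      obtain ⟨k, hk⟩ := h.weyl_mem_rootLattice hw (simple_mem_rootLattice α i) j
      exact ⟨k, by simp [hk]⟩
  · intro w _ w' _ hww
    apply LinearIsometryEquiv.toLinearEquiv_injective
    apply α.ext'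
    exact fun i => congrFun hww i

/-! ### Positivity of roots -/

theorem mem_roots {β : Eucl n} : β ∈ roots α ↔ ∃ i, ∃ w ∈ weylGroup α, w (α i) = β := by
  simp [roots, orbit]

theorem simple_mem_roots (α : Basis (Fin n) ℝ (Eucl n)) (i : Fin n) : α i ∈ roots α :=
  mem_roots.2 ⟨i, 1, one_mem _, rfl⟩

theorem weyl_mem_roots {w : Eucl n ≃ₗᵢ[ℝ] Eucl n} (hw : w ∈ weylGroup α) {β : Eucl n}
    (hβ : β ∈ roots α) : w β ∈ roots α := by
  obtain ⟨i, w', hw', rfl⟩ := mem_roots.1 hβ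
  exact mem_roots.2 ⟨i, w * w', mul_mem hw hw', rfl⟩

theorem neg_mem_roots {β : Eucl n} (hβ : β ∈ roots α) : -β ∈ roots α := by
  obtain ⟨i, w, hw, rfl⟩ := mem_roots.1 hβ
  refine mem_roots.2 ⟨i, w * simpleRefl α i, mul_mem hw (simpleRefl_mem α i), ?_⟩
  change w (simpleRefl α i (α i)) = _
  rw [simpleRefl_self, map_neg]

theorem root_ne_zero {β : Eucl n} (hβ : β ∈ roots α) : β ≠ 0 := by
  obtain ⟨i, w, hw, rfl⟩ := mem_roots.1 hβ
  simpa using α.ne_zero i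

theorem IsRootBasis.root_mem_rootLattice (h : IsRootBasis α) {β : Eucl n} (hβ : β ∈ roots α) :
    β ∈ rootLattice α := by
  obtain ⟨i, w, hw, rfl⟩ := mem_roots.1 hβ
  exact h.weyl_mem_rootLattice hw (simple_mem_rootLattice α i)

theorem IsRootBasis.finite_roots (h : IsRootBasis α) : (roots α).Finite := by
  refine ((Set.finite_univ (α := Fin n)).image2 (fun i w => w (α i)) h.finite_weylGroup).subset ?_
  intro β hβ
  obtain ⟨i, w, hw, rfl⟩ := mem_roots.1 hβ
  exact ⟨i, trivial, w, hw, rfl⟩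

theorem IsRootBasis.exists_int_norm (h : IsRootBasis α) {s : ℝ}
    (hs : ∀ i, ∃ k : ℤ, inner ℝ (α i) (α i) = k * s) {v : Eucl n} (hv : v ∈ rootLattice α) :
    ∃ k : ℤ, inner ℝ v v = k * s := by
  obtain ⟨k, rfl⟩ := rootLattice_iff_exists_sum.1 hv
  suffices H : ∀ S : Finset (Fin n), ∃ l : ℤ,
      inner ℝ (∑ i ∈ S, (k i : ℝ) • α i) (∑ i ∈ S, (k i : ℝ) • α i) = l * s from H _
  intro S
  induction S using Finset.induction_on with
  | empty => exact ⟨0, by simp⟩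
  | insert i S hi ih =>
    obtain ⟨l, hl⟩ := ih
    set v := ∑ i ∈ S, (k i : ℝ) • α i with hv
    have hvL : v ∈ rootLattice α :=
      sum_mem fun i _ => int_smul_mem_rootLattice (simple_mem_rootLattice α i) _
    obtain ⟨a, ha⟩ := h.int_pairing hvL i
    obtain ⟨b, hb⟩ := hs i
    have h2 := inner_eq_inner_coroot α v i
    rw [ha, hb] at h2
    refine ⟨k i ^ 2 * b + k i * a * b + l, ?_⟩
    rw [Finset.sum_insert hi, ← hv, inner_add_left, inner_add_right, inner_add_right,
      real_inner_smul_left, real_inner_smul_right, real_inner_smul_left, real_inner_smul_right, hl,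
      hb, real_inner_comm v (α i)]
    push_cast
    linear_combination (k i : ℝ) * h2

theorem IsRootBasis.pos_or_neg_of_norm (h : IsRootBasis α) {s : ℝ} (h0 : 0 < s)
    (hs : ∀ i, ∃ k : ℤ, inner ℝ (α i) (α i) = k * s) {v : Eucl n} (hv : v ∈ rootLattice α)
    (hvs : inner ℝ v v = s) : v ∈ posCone α ∨ -v ∈ posCone α := by
  have hmin : ∀ u ∈ rootLattice α, u ≠ 0 → s ≤ inner ℝ u u := by
    intro u hu hu0
    obtain ⟨k, hk⟩ := h.exists_int_norm hs hu
    have hpos : 0 < inner ℝ u u := real_inner_self_pos.2 hu0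
    rw [hk] at hpos ⊢
    have : (0 : ℝ) < k := by
      by_contra hneg
      exact absurd hpos (not_lt.2 (mul_nonpos_of_nonpos_of_nonneg (not_lt.1 hneg) h0.le))
    have : (1 : ℝ) ≤ k := by exact_mod_cast (show (0 : ℤ) < k by exact_mod_cast this)
    nlinarith
  obtain ⟨k, rfl⟩ := rootLattice_iff_exists_sum.1 hv
  set p := ∑ i, (((k i).toNat : ℕ) : ℝ) • α i with hp
  set m := ∑ i, (((-k i).toNat : ℕ) : ℝ) • α i with hm
  have hpm : ∑ i, (k i : ℝ) • α i = p - m := by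
    rw [hp, hm, ← Finset.sum_sub_distrib]
    refine Finset.sum_congr rfl fun i _ => ?_
    rw [← sub_smul]
    congr 1
    have : k i = ((k i).toNat : ℤ) - ((-k i).toNat : ℤ) := by omega
    exact_mod_cast this
  have hpc : p ∈ posCone α := posCone_iff_exists_sum.2 ⟨_, rfl⟩
  have hmc : m ∈ posCone α := posCone_iff_exists_sum.2 ⟨_, rfl⟩
  rw [hpm] at hvs ⊢
  by_cases hp0 : p = 0
  · right; simpa [hp0] using hmc
  by_cases hm0 : m = 0
  · left; simpa [hm0] using hpc
  exfalso
  have h1 := hmin p (posCone_le hpc) hp0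
  have h2 := hmin m (posCone_le hmc) hm0
  have h3 : inner ℝ p m ≤ 0 := by
    rw [hp, hm, sum_inner]
    refine Finset.sum_nonpos fun i _ => ?_
    rw [inner_sum]
    refine Finset.sum_nonpos fun j _ => ?_
    rw [real_inner_smul_left, real_inner_smul_right, ← mul_assoc]
    by_cases hij : i = j
    · subst hij
      have : (k i).toNat = 0 ∨ (-k i).toNat = 0 := by omega
      rcases this with h | h <;> simp [h]
    · exact mul_nonpos_of_nonneg_of_nonpos (by positivity) (h.nonpos i j hij)
  rw [inner_sub_left, inner_sub_right, inner_sub_right, real_inner_comm p m] at hvs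
  linarith

theorem IsRootBasis.root_pos_or_neg (h : IsRootBasis α) {β : Eucl n} (hβ : β ∈ roots α) :
    β ∈ posCone α ∨ -β ∈ posCone α := by
  obtain ⟨i, w, hw, rfl⟩ := mem_roots.1 hβ
  obtain ⟨s, r, hs, hr, hl⟩ := h.len
  have hr' : (r : ℝ) ≠ 0 := by positivity
  have hL := h.root_mem_rootLattice hβ
  rcases hl i with hi | hi
  · refine h.pos_or_neg_of_norm hs (fun j => ?_) hL ?_
    · rcases hl j with hj | hj
      · exact ⟨1, by rw [hj]; simp⟩
      · exact ⟨r, by rw [hj]; simp⟩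
    · rw [LinearIsometryEquiv.inner_map_map, hi]
  · have key : w (coroot α i) ∈ posCone (coroot α) ∨ -w (coroot α i) ∈ posCone (coroot α) := by
      refine h.dual.pos_or_neg_of_norm (s := 4 / (r * s)) (by positivity) (fun j => ?_) ?_ ?_
      · rw [inner_coroot_coroot]
        rcases hl j with hj | hj <;> rw [hj]
        · exact ⟨r, by push_cast; field_simp⟩
        · exact ⟨1, by simp⟩
      · exact h.dual.weyl_mem_rootLattice (by rwa [weylGroup_coroot])
          (simple_mem_rootLattice _ i)
      · rw [LinearIsometryEquiv.inner_map_map, inner_coroot_coroot, hi]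
    have hpos : ∀ v : Eucl n, (∀ j, 0 ≤ (coroot α).repr v j) → ∀ j, 0 ≤ α.repr v j := by
      intro v hv j
      rw [repr_coroot]
      exact mul_nonneg (div_nonneg zero_le_two (inner_self_pos α j).le) (hv j)
    have hwc : w (α i) = (inner ℝ (α i) (α i) / 2) • w (coroot α i) := by
      have := (inner_self_pos α i).ne'
      rw [coroot_apply, map_smul, smul_smul, show inner ℝ (α i) (α i) / 2 *
        (2 / inner ℝ (α i) (α i)) = 1 by field_simp, one_smul]
    have hc : 0 ≤ inner ℝ (α i) (α i) / 2 := by have := inner_self_pos α i; positivity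
    rcases key with h' | h'
    · left
      refine mem_posCone_iff.2 ⟨hL, hpos _ fun j => ?_⟩
      rw [hwc, map_smul]
      exact mul_nonneg hc ((mem_posCone_iff.1 h').2 j)
    · right
      refine mem_posCone_iff.2 ⟨neg_mem hL, hpos _ fun j => ?_⟩
      rw [hwc, ← smul_neg, map_smul]
      exact mul_nonneg hc ((mem_posCone_iff.1 h').2 j)

/-! ### Exchange and dominance -/

theorem simple_notMem_neg (α : Basis (Fin n) ℝ (Eucl n)) (i : Fin n) : -α i ∉ posCone α :=
  fun h => α.ne_zero i (eq_zero_of_posCone (simple_mem_posCone α i) h)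

theorem IsRootBasis.root_eq_simple (h : IsRootBasis α) {β : Eucl n} (hβ : β ∈ roots α)
    (hpos : β ∈ posCone α) {i : Fin n} (hi : ∀ j, j ≠ i → α.repr β j = 0) : β = α i := by
  obtain ⟨k, hk⟩ := hpos i
  have hβi : β = (k : ℝ) • α i := by
    rw [← α.sum_repr β, Finset.sum_eq_single i (fun j _ hj => by rw [hi j hj, zero_smul])
      (by simp), hk]
  obtain ⟨j, w, hw, hwj⟩ := mem_roots.1 hβ
  obtain ⟨l, hl⟩ := h.weyl_mem_rootLattice (inv_mem hw) (simple_mem_rootLattice α i) j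
  have h1 : α j = (k : ℝ) • w⁻¹ (α i) := by
    rw [← map_smul, ← hβi, ← hwj]
    exact (w.symm_apply_apply (α j)).symm
  have h2 : (1 : ℝ) = k * l := by
    have := congrArg (fun v => α.repr v j) h1
    simp only [map_smul, Finsupp.smul_apply, hl, Basis.repr_self, Finsupp.single_eq_same,
      smul_eq_mul] at this
    exact this
  have h3 : (1 : ℤ) = k * l := by exact_mod_cast h2
  have h4 : (k : ℤ) = 1 := Int.eq_one_of_dvd_one (by positivity) ⟨l, h3⟩
  have h5 : k = 1 := by exact_mod_cast h4
  rw [hβi, h5]; simp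

theorem IsRootBasis.simpleRefl_mem_posCone (h : IsRootBasis α) {β : Eucl n} (hβ : β ∈ roots α)
    (hpos : β ∈ posCone α) {i : Fin n} (hi : β ≠ α i) : simpleRefl α i β ∈ posCone α := by
  rcases h.root_pos_or_neg (weyl_mem_roots (simpleRefl_mem α i) hβ) with h' | h'
  · exact h'
  · refine absurd (h.root_eq_simple hβ hpos fun j hj => ?_) hi
    have h1 := (mem_posCone_iff.1 h').2 j
    have h2 := (mem_posCone_iff.1 hpos).2 j
    rw [simpleRefl_apply] at h1
    simp [hj.symm] at h1
    exact le_antisymm h1 h2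

theorem isometry_map_coroot {w : Eucl n ≃ₗᵢ[ℝ] Eucl n} {i j : Fin n} (hw : w (α j) = α i) :
    w (coroot α j) = coroot α i := by
  rw [coroot_apply, coroot_apply, map_smul, hw, ← LinearIsometryEquiv.inner_map_map w, hw]

theorem mul_simpleRefl_of_map_eq {w : Eucl n ≃ₗᵢ[ℝ] Eucl n} {i j : Fin n} (hw : w (α j) = α i) :
    w * simpleRefl α j = simpleRefl α i * w := by
  ext1 v
  change w (simpleRefl α j v) = simpleRefl α i (w v)
  rw [simpleRefl_apply, simpleRefl_apply, map_sub, map_smul, hw, ← isometry_map_coroot hw,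
    LinearIsometryEquiv.inner_map_map]

theorem wordProd_cons (i : Fin n) (L : List (Fin n)) :
    wordProd α (i :: L) = simpleRefl α i * wordProd α L := by simp [wordProd]

theorem wordProd_append (L L' : List (Fin n)) :
    wordProd α (L ++ L') = wordProd α L * wordProd α L' := by simp [wordProd]

theorem wordProd_singleton (i : Fin n) : wordProd α [i] = simpleRefl α i := by simp [wordProd]

theorem IsRootBasis.exchange (h : IsRootBasis α) (L : List (Fin n)) (j : Fin n)
    (hL : -(wordProd α L (α j)) ∈ posCone α) :
    ∃ L' : List (Fin n), L'.length + 1 = L.length ∧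
      wordProd α L' = wordProd α L * simpleRefl α j := by
  induction L with
  | nil => exact absurd hL (simple_notMem_neg α j)
  | cons i L ih =>
    have hroot := weyl_mem_roots (wordProd_mem α L) (simple_mem_roots α j)
    rcases h.root_pos_or_neg hroot with hp | hp
    · by_cases he : wordProd α L (α j) = α i
      · refine ⟨L, rfl, ?_⟩
        rw [wordProd_cons, mul_assoc, mul_simpleRefl_of_map_eq he, ← mul_assoc,
          simpleRefl_mul_self, one_mul]
      · have h1 := h.simpleRefl_mem_posCone hroot hp he
        rw [wordProd_cons] at hL
        have h2 := eq_zero_of_posCone h1 hL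
        rw [LinearIsometryEquiv.map_eq_zero_iff] at h2
        exact absurd h2 (root_ne_zero hroot)
    · obtain ⟨L', hl, hw⟩ := ih hp
      exact ⟨i :: L', by simp [hl], by rw [wordProd_cons, wordProd_cons, hw, mul_assoc]⟩

theorem wordProd_concat_apply (L : List (Fin n)) (j : Fin n) (v : Eucl n) :
    v - wordProd α (L ++ [j]) v =
      (v - wordProd α L v) + inner ℝ v (coroot α j) • wordProd α L (α j) := by
  rw [wordProd_append, wordProd_singleton]
  change v - wordProd α L (simpleRefl α j v) = _
  rw [simpleRefl_apply, map_sub, map_smul]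
  abel

theorem IsRootBasis.sub_wordProd_mem_posCone (h : IsRootBasis α) {v : Eucl n}
    (hv : ∀ i, ∃ k : ℕ, inner ℝ v (coroot α i) = k) (L : List (Fin n)) :
    v - wordProd α L v ∈ posCone α := by
  induction hN : L.length using Nat.strong_induction_on generalizing L with
  | _ N ih =>
    rcases List.eq_nil_or_concat' L with rfl | ⟨L₁, j, rfl⟩
    · simp [wordProd, zero_mem]
    · rw [List.length_append, List.length_singleton] at hN
      rcases h.root_pos_or_neg (weyl_mem_roots (wordProd_mem α L₁) (simple_mem_roots α j)) with
        hp | hp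
      · obtain ⟨k, hk⟩ := hv j
        rw [wordProd_concat_apply, hk]
        exact add_mem (ih _ (by omega) _ rfl) (nat_smul_mem_posCone hp k)
      · obtain ⟨L', hl, hw⟩ := h.exchange L₁ j hp
        rw [wordProd_append, wordProd_singleton, ← hw]
        exact ih _ (by omega) _ rfl

/-- Dominant weights. -/
def IsDominant (α : Basis (Fin n) ℝ (Eucl n)) (v : Eucl n) : Prop :=
  ∀ i, ∃ k : ℕ, inner ℝ v (coroot α i) = k

theorem IsRootBasis.sub_weyl_mem_posCone (h : IsRootBasis α) {v : Eucl n} (hv : IsDominant α v)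
    {w : Eucl n ≃ₗᵢ[ℝ] Eucl n} (hw : w ∈ weylGroup α) : v - w v ∈ posCone α := by
  obtain ⟨L, rfl⟩ := exists_wordProd hw
  exact h.sub_wordProd_mem_posCone hv L

theorem IsRootBasis.eq_of_dominant (h : IsRootBasis α) {u v : Eucl n} (hu : IsDominant α u)
    (hv : IsDominant α v) {w : Eucl n ≃ₗᵢ[ℝ] Eucl n} (hw : w ∈ weylGroup α) (huv : w u = v) :
    u = v := by
  have h1 := h.sub_weyl_mem_posCone hu hw
  have h2 := h.sub_weyl_mem_posCone hv (inv_mem hw)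
  have h3 : w⁻¹ v = u := by rw [← huv]; exact w.symm_apply_apply u
  rw [huv] at h1
  rw [h3, ← neg_sub] at h2
  exact sub_eq_zero.1 (eq_zero_of_posCone h1 h2)

theorem IsRootBasis.stabilizer_trivial (h : IsRootBasis α) {v : Eucl n}
    (hv : ∀ i, ∃ k : ℕ, inner ℝ v (coroot α i) = k + 1) {w : Eucl n ≃ₗᵢ[ℝ] Eucl n}
    (hw : w ∈ weylGroup α) (hwv : w v = v) : w = 1 := by
  have hdom : IsDominant α v := fun i => by
    obtain ⟨k, hk⟩ := hv i; exact ⟨k + 1, by rw [hk]; push_cast; rfl⟩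
  obtain ⟨L, rfl⟩ := exists_wordProd hw
  clear hw
  induction hN : L.length using Nat.strong_induction_on generalizing L with
  | _ N ih =>
    rcases List.eq_nil_or_concat' L with rfl | ⟨L₁, j, rfl⟩
    · rfl
    · rw [List.length_append, List.length_singleton] at hN
      have hroot := weyl_mem_roots (wordProd_mem α L₁) (simple_mem_roots α j)
      rcases h.root_pos_or_neg hroot with hp | hp
      · exfalso
        have h1 := wordProd_concat_apply (α := α) L₁ j v
        obtain ⟨k, hk⟩ := hv j
        have h3 : inner ℝ v (coroot α j) • wordProd α L₁ (α j) ∈ posCone α := by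
          rw [hk]; exact_mod_cast nat_smul_mem_posCone hp (k + 1)
        rw [hwv, sub_self] at h1
        have h2 : inner ℝ v (coroot α j) • wordProd α L₁ (α j) = 0 := by
          refine eq_zero_of_posCone h3 ?_
          rw [← eq_neg_of_add_eq_zero_left h1.symm]
          exact h.sub_wordProd_mem_posCone hdom L₁
        rw [hk] at h2
        have h4 : (k : ℝ) + 1 ≠ 0 := by positivity
        exact root_ne_zero hroot ((smul_eq_zero.1 h2).resolve_left h4)
      · obtain ⟨L', hl, hw⟩ := h.exchange L₁ j hp
        have he : wordProd α (L₁ ++ [j]) = wordProd α L' := by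
          rw [wordProd_append, wordProd_singleton, ← hw]
        rw [he] at hwv ⊢
        exact ih _ (by omega) _ hwv rfl

/-! ### Heights -/

/-- The sum of the coordinates in the simple roots. -/
def height (α : Basis (Fin n) ℝ (Eucl n)) : Eucl n →ₗ[ℝ] ℝ := ∑ i, α.coord i

theorem height_apply (v : Eucl n) : height α v = ∑ i, α.repr v i := by simp [height]

@[simp] theorem height_simple (i : Fin n) : height α (α i) = 1 := by
  simp [height_apply, Finsupp.single_apply]

theorem height_nonneg {v : Eucl n} (hv : v ∈ posCone α) : 0 ≤ height α v := by
  rw [height_apply]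
  exact Finset.sum_nonneg fun i _ => (mem_posCone_iff.1 hv).2 i

theorem height_nat {v : Eucl n} (hv : v ∈ posCone α) : ∃ k : ℕ, height α v = k := by
  choose k hk using hv
  exact ⟨∑ i, k i, by simp [height_apply, hk]⟩

theorem eq_zero_of_height {v : Eucl n} (hv : v ∈ posCone α) (h0 : height α v ≤ 0) : v = 0 := by
  have h1 : ∑ i, α.repr v i = 0 := by
    rw [← height_apply]; exact le_antisymm h0 (height_nonneg hv)
  rw [Finset.sum_eq_zero_iff_of_nonneg fun i _ => (mem_posCone_iff.1 hv).2 i] at h1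
  exact α.ext_elem fun i => by simp [h1 i (Finset.mem_univ i)]

theorem one_le_height {v : Eucl n} (hv : v ∈ posCone α) (h0 : v ≠ 0) : 1 ≤ height α v := by
  obtain ⟨k, hk⟩ := height_nat hv
  rw [hk]
  have : k ≠ 0 := fun hk0 => h0 (eq_zero_of_height hv (by rw [hk, hk0]; simp))
  exact_mod_cast Nat.one_le_iff_ne_zero.2 this

theorem exists_simple_of_height {v : Eucl n} (hv : v ∈ posCone α) (h1 : height α v = 1) :
    ∃ i, v = α i := by
  have h0 : v ≠ 0 := by rintro rfl; simp at h1
  obtain ⟨i, hi⟩ : ∃ i, α.repr v i ≠ 0 := by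
    by_contra hcon
    push Not at hcon
    exact h0 (α.ext_elem fun i => by simp [hcon i])
  refine ⟨i, sub_eq_zero.1 (eq_zero_of_height (α := α) ?_ (by simp [h1]))⟩
  intro j
  obtain ⟨k, hk⟩ := hv j
  by_cases hij : i = j
  · subst hij
    refine ⟨k - 1, ?_⟩
    have : k ≠ 0 := by rintro rfl; simp [hk] at hi
    rw [Nat.cast_sub (by omega)]
    simp [hk]
  · exact ⟨k, by simp [hij, hk]⟩

theorem height_simpleRefl (i : Fin n) (v : Eucl n) :
    height α (simpleRefl α i v) = height α v - inner ℝ v (coroot α i) := by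
  rw [simpleRefl_apply, map_sub, map_smul, height_simple, smul_eq_mul, mul_one]

theorem inner_sum_dualVec (v : Eucl n) : inner ℝ v (∑ i, dualVec α i) = height α v := by
  conv_lhs => rw [← α.sum_repr v]
  rw [inner_sum, height_apply]
  refine Finset.sum_congr rfl fun i _ => ?_
  rw [sum_inner]
  simp_rw [real_inner_comm, real_inner_smul_right, inner_dualVec]
  simp

theorem IsRootBasis.exists_dominant (h : IsRootBasis α) (v : Eucl n) :
    ∃ w ∈ weylGroup α, ∀ i, 0 ≤ inner ℝ (w v) (coroot α i) := by
  obtain ⟨w, hw, hmax⟩ := Set.exists_max_image _ (fun w => height α (w v)) h.finite_weylGroup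
    ⟨1, one_mem (weylGroup α)⟩
  refine ⟨w, hw, fun i => ?_⟩
  have := hmax (simpleRefl α i * w) (mul_mem (simpleRefl_mem α i) hw)
  change height α (simpleRefl α i (w v)) ≤ _ at this
  rw [height_simpleRefl] at this
  linarith

theorem IsRootBasis.exists_longest (h : IsRootBasis α) :
    ∃ w ∈ weylGroup α, ∃ σ : Equiv.Perm (Fin n), ∀ i, w (α i) = -α (σ i) := by
  obtain ⟨w, hw, hdom⟩ := h.dual.exists_dominant (-∑ i, dualVec α i)
  rw [weylGroup_coroot] at hw
  rw [coroot_coroot] at hdom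
  have hpos1 : ∀ i, -w⁻¹ (α i) ∈ posCone α := by
    intro i
    have h1 := hdom i
    rw [inner_weyl_left, inner_neg_left, real_inner_comm, inner_sum_dualVec] at h1
    have hr := weyl_mem_roots (inv_mem hw) (simple_mem_roots α i)
    rcases h.root_pos_or_neg hr with hp | hp
    · exact absurd (eq_zero_of_height hp (by linarith)) (root_ne_zero hr)
    · exact hp
  have hcone : ∀ u : Eucl n ≃ₗᵢ[ℝ] Eucl n, (∀ i, -u (α i) ∈ posCone α) → ∀ v ∈ posCone α,
      -u v ∈ posCone α := by
    intro u hu v hv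
    obtain ⟨k, rfl⟩ := posCone_iff_exists_sum.1 hv
    rw [map_sum, ← Finset.sum_neg_distrib]
    refine sum_mem fun i _ => ?_
    rw [map_smul, ← smul_neg]
    exact nat_smul_mem_posCone (hu i) _
  have hpos2 : ∀ i, -w (α i) ∈ posCone α := by
    intro i
    have hr := weyl_mem_roots hw (simple_mem_roots α i)
    rcases h.root_pos_or_neg hr with hp | hp
    · have := hcone _ hpos1 _ hp
      rw [show w⁻¹ (w (α i)) = α i from w.symm_apply_apply _] at this
      exact absurd this (simple_notMem_neg α i)
    · exact hp
  have hht : ∀ u : Eucl n ≃ₗᵢ[ℝ] Eucl n, (∀ i, -u (α i) ∈ posCone α) → ∀ v ∈ posCone α,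
      height α v ≤ height α (-u v) := by
    intro u hu v hv
    obtain ⟨k, rfl⟩ := posCone_iff_exists_sum.1 hv
    rw [map_sum u, ← Finset.sum_neg_distrib, map_sum, map_sum]
    refine Finset.sum_le_sum fun i _ => ?_
    rw [map_smul u, ← smul_neg, map_smul, map_smul, height_simple]
    refine mul_le_mul_of_nonneg_left (one_le_height (hu i) ?_) (Nat.cast_nonneg _)
    rw [Ne, neg_eq_zero, LinearIsometryEquiv.map_eq_zero_iff]
    exact α.ne_zero i
  have hone : ∀ i, ∃ j, -w (α i) = α j := fun i => by
    refine exists_simple_of_height (hpos2 i) (le_antisymm ?_ ?_)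
    · have := hht _ hpos1 _ (hpos2 i)
      rw [map_neg w⁻¹, show w⁻¹ (w (α i)) = α i from w.symm_apply_apply _, neg_neg, height_simple]
        at this
      exact this
    · simpa using hht _ hpos2 _ (simple_mem_posCone α i)
  choose f hf using hone
  have hinj : Function.Injective f := fun i j hij => by
    have : -w (α i) = -w (α j) := by rw [hf, hf, hij]
    exact α.injective (w.injective (neg_injective this))
  refine ⟨w, hw, Equiv.ofBijective f (Finite.injective_iff_bijective.1 hinj), fun i => ?_⟩
  rw [Equiv.ofBijective_apply, ← hf, neg_neg]

/-! ### Reflections in roots and the highest root -/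

theorem exists_root_reflection {γ : Eucl n} (hγ : γ ∈ roots α) :
    ∃ w ∈ weylGroup α, ∀ v, w v = v - (2 * inner ℝ v γ / inner ℝ γ γ) • γ := by
  obtain ⟨i, w, hw, rfl⟩ := mem_roots.1 hγ
  refine ⟨w * simpleRefl α i * w⁻¹, mul_mem (mul_mem hw (simpleRefl_mem α i)) (inv_mem hw),
    fun v => ?_⟩
  change w (simpleRefl α i (w⁻¹ v)) = _
  rw [simpleRefl_apply, map_sub, map_smul, show w (w⁻¹ v) = v from w.apply_symm_apply v,
    LinearIsometryEquiv.inner_map_map, inner_coroot, inner_weyl_left, inv_inv]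

theorem IsRootBasis.int_pairing_root (h : IsRootBasis α) {v γ : Eucl n} (hv : v ∈ rootLattice α)
    (hγ : γ ∈ roots α) : ∃ k : ℤ, 2 * inner ℝ v γ / inner ℝ γ γ = k := by
  obtain ⟨i, w, hw, rfl⟩ := mem_roots.1 hγ
  obtain ⟨k, hk⟩ := h.int_pairing (h.weyl_mem_rootLattice (inv_mem hw) hv) i
  refine ⟨k, ?_⟩
  rw [← hk, inner_coroot, LinearIsometryEquiv.inner_map_map, inner_weyl_left, inv_inv]

theorem IsRootBasis.root_sub_root (h : IsRootBasis α) {β γ : Eucl n} (hβ : β ∈ roots α)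
    (hγ : γ ∈ roots α) (hpos : 0 < inner ℝ β γ) : β = γ ∨ β - γ ∈ roots α := by
  obtain ⟨a, ha⟩ := h.int_pairing_root (h.root_mem_rootLattice hβ) hγ
  obtain ⟨b, hb⟩ := h.int_pairing_root (h.root_mem_rootLattice hγ) hβ
  have hββ : 0 < inner ℝ β β := real_inner_self_pos.2 (root_ne_zero hβ)
  have hγγ : 0 < inner ℝ γ γ := real_inner_self_pos.2 (root_ne_zero hγ)
  have hcs := real_inner_mul_inner_self_le β γ
  have ha0 : 0 < a := by
    have : (0 : ℝ) < a := by rw [← ha]; positivity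
    exact_mod_cast this
  have hb0 : 0 < b := by
    have : (0 : ℝ) < b := by rw [← hb, real_inner_comm]; positivity
    exact_mod_cast this
  have hab : a * b ≤ 4 := by
    have : (a : ℝ) * b ≤ 4 := by
      rw [← ha, ← hb, real_inner_comm β γ, div_mul_div_comm, div_le_iff₀ (by positivity)]
      nlinarith
    exact_mod_cast this
  by_cases ha1 : a = 1
  · obtain ⟨w, hw, hwv⟩ := exists_root_reflection hγ
    have := weyl_mem_roots hw hβ
    rw [hwv, ha, ha1] at this
    right; simpa using this
  by_cases hb1 : b = 1
  · obtain ⟨w, hw, hwv⟩ := exists_root_reflection hβ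
    have := neg_mem_roots (weyl_mem_roots hw hγ)
    rw [hwv, hb, hb1] at this
    right; simpa using this
  have ha2 : a = 2 := by nlinarith [show 2 ≤ a by omega, show 2 ≤ b by omega]
  have hb2 : b = 2 := by nlinarith [show 2 ≤ a by omega, show 2 ≤ b by omega]
  left
  rw [ha2, div_eq_iff hγγ.ne'] at ha
  rw [hb2, div_eq_iff hββ.ne', real_inner_comm] at hb
  push_cast at ha hb
  rw [← sub_eq_zero, ← inner_self_eq_zero (𝕜 := ℝ), inner_sub_left, inner_sub_right,
    inner_sub_right, real_inner_comm β γ]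
  linarith

theorem inner_nonneg_iff_coroot {v : Eucl n} {i : Fin n} :
    0 ≤ inner ℝ v (coroot α i) ↔ 0 ≤ inner ℝ v (α i) := by
  rw [inner_coroot, div_nonneg_iff]
  have := inner_self_pos α i
  constructor
  · rintro (h | h)
    · linarith [h.1]
    · linarith [h.2]
  · intro h; left; constructor <;> linarith

theorem inner_eq_sum_repr (u v : Eucl n) : inner ℝ u v = ∑ i, α.repr u i * inner ℝ (α i) v := by
  conv_lhs => rw [← α.sum_repr u, sum_inner]
  simp [real_inner_smul_left]

theorem IsRootBasis.repr_pos_of_dominant (h : IsRootBasis α) {v : Eucl n} (hv : v ∈ roots α)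
    (hdom : ∀ i, 0 ≤ inner ℝ v (α i)) (j : Fin n) : 0 < α.repr v j := by
  have hpos : v ∈ posCone α := by
    rcases h.root_pos_or_neg hv with hp | hp
    · exact hp
    · exfalso
      have h1 : inner ℝ v v ≤ 0 := by
        rw [inner_eq_sum_repr (α := α) v v]
        refine Finset.sum_nonpos fun i _ => mul_nonpos_of_nonpos_of_nonneg ?_ ?_
        · have := (mem_posCone_iff.1 hp).2 i
          simpa using this
        · rw [real_inner_comm]; exact hdom i
      exact absurd (real_inner_self_pos.2 (root_ne_zero hv)) (not_lt.2 h1)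
  have hnn := (mem_posCone_iff.1 hpos).2
  by_contra hj
  have hne : (∑ i, α.repr v i * inner ℝ (α i) v) ≠ 0 := by
    rw [← inner_eq_sum_repr]
    exact (real_inner_self_pos.2 (root_ne_zero hv)).ne'
  obtain ⟨i₀, -, hi₀⟩ := Finset.exists_ne_zero_of_sum_ne_zero hne
  refine hj (h.conn {i | 0 < α.repr v i} ⟨i₀, ?_⟩ ?_ j)
  · exact lt_of_le_of_ne (hnn i₀) (left_ne_zero_of_mul hi₀).symm
  · intro i hi k hik
    by_contra hk
    have hk0 : α.repr v k = 0 := le_antisymm (not_lt.1 hk) (hnn k)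
    have h1 := hdom k
    rw [inner_eq_sum_repr (α := α)] at h1
    have hle : ∀ l, α.repr v l * inner ℝ (α l) (α k) ≤ 0 := by
      intro l
      by_cases hlk : l = k
      · rw [hlk, hk0, zero_mul]
      · exact mul_nonpos_of_nonneg_of_nonpos (hnn l) (h.nonpos l k hlk)
    have hik' : i ≠ k := by rintro rfl; exact hk hi
    have hlt : α.repr v i * inner ℝ (α i) (α k) < 0 :=
      mul_neg_of_pos_of_neg hi (lt_of_le_of_ne (h.nonpos i k hik') hik)
    have := Finset.sum_lt_sum (s := Finset.univ) (fun l _ => hle l) ⟨i, Finset.mem_univ i, hlt⟩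
    simp only [Finset.sum_const_zero] at this
    linarith

theorem IsRootBasis.exists_marks (h : IsRootBasis α) (hn : 0 < n) : ∃ m, IsMarks α m := by
  obtain ⟨θ, hθ, hmax⟩ := Set.exists_max_image _ (height α) h.finite_roots
    ⟨_, simple_mem_roots α ⟨0, hn⟩⟩
  have hdom : ∀ β ∈ roots α, (∀ γ ∈ roots α, γ - β ∈ posCone α → height α γ ≤ height α β) →
      ∀ i, 0 ≤ inner ℝ β (α i) := by
    intro β hβ hm i
    by_contra hcon
    rw [not_le] at hcon
    rcases h.root_sub_root hβ (neg_mem_roots (simple_mem_roots α i))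
      (by rw [inner_neg_right]; linarith) with h' | h'
    · have := hm (α i) (simple_mem_roots α i)
        (by rw [h', sub_neg_eq_add]; exact add_mem (simple_mem_posCone α i)
              (simple_mem_posCone α i))
      rw [h', map_neg, height_simple] at this
      linarith
    · rw [sub_neg_eq_add] at h'
      have := hm _ h' (by rw [add_sub_cancel_left]; exact simple_mem_posCone α i)
      rw [map_add, height_simple] at this
      linarith
  have hθdom := hdom θ hθ fun γ hγ _ => hmax γ hγ
  have hθpos := h.repr_pos_of_dominant hθ hθdom
  have hθcone : θ ∈ posCone α := mem_posCone_iff.2 ⟨h.root_mem_rootLattice hθ, fun i =>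
    (hθpos i).le⟩
  obtain ⟨m, hm⟩ := posCone_iff_exists_sum.1 hθcone
  refine ⟨m, hm ▸ hθ, fun β hβ => ?_⟩
  rw [← hm]
  refine posCone_iff_exists_sum.1 ?_
  obtain ⟨β', ⟨hβ', hle⟩, hmax'⟩ := Set.exists_max_image {γ | γ ∈ roots α ∧ γ - β ∈ posCone α}
    (height α) (h.finite_roots.subset fun _ h => h.1) ⟨β, hβ, by simp [zero_mem]⟩
  have hβ'dom := hdom β' hβ' fun γ hγ hγβ => hmax' γ ⟨hγ, by
    rw [← sub_add_sub_cancel γ β' β]; exact add_mem hγβ hle⟩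
  suffices hs : θ - β' ∈ posCone α by
    rw [← sub_add_sub_cancel θ β' β]; exact add_mem hs hle
  have hpos : 0 < inner ℝ β' θ := by
    rw [real_inner_comm, inner_eq_sum_repr (α := α)]
    refine Finset.sum_pos' (fun i _ => mul_nonneg (hθpos i).le
      (by rw [real_inner_comm]; exact hβ'dom i)) ?_
    by_contra hcon
    push Not at hcon
    have hz : ∀ i, inner ℝ (α i) β' ≤ 0 := fun i =>
      nonpos_of_mul_nonpos_right (hcon i (Finset.mem_univ i)) (hθpos i)
    refine absurd (real_inner_self_pos.2 (root_ne_zero hβ')) (not_lt.2 ?_)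
    rw [inner_eq_sum_repr (α := α)]
    exact Finset.sum_nonpos fun i _ => mul_nonpos_of_nonneg_of_nonpos
      (h.repr_pos_of_dominant hβ' hβ'dom i).le (hz i)
  rcases h.root_sub_root hβ' hθ hpos with h' | h'
  · rw [h', sub_self]; exact zero_mem _
  · rcases h.root_pos_or_neg h' with hp | hp
    · exfalso
      have h1 := one_le_height hp (root_ne_zero h')
      have h2 := hmax β' hβ'
      rw [map_sub] at h1
      linarith
    · rwa [neg_sub] at hp

/-- The highest root. -/
def highestRoot (α : Basis (Fin n) ℝ (Eucl n)) : Eucl n := ∑ i, (marks α i : ℝ) • α i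

theorem IsRootBasis.marks_spec (h : IsRootBasis α) (hn : 0 < n) : IsMarks α (marks α) :=
  Classical.epsilon_spec (h.exists_marks hn)

theorem IsRootBasis.highestRoot_mem (h : IsRootBasis α) (hn : 0 < n) :
    highestRoot α ∈ roots α := (h.marks_spec hn).1

theorem IsRootBasis.highestRoot_sub_mem (h : IsRootBasis α) (hn : 0 < n) {β : Eucl n}
    (hβ : β ∈ roots α) : highestRoot α - β ∈ posCone α :=
  posCone_iff_exists_sum.2 ((h.marks_spec hn).2 β hβ)

theorem repr_highestRoot (i : Fin n) : α.repr (highestRoot α) i = marks α i := by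
  simp [highestRoot, Finsupp.single_apply]

theorem IsRootBasis.marks_pos (h : IsRootBasis α) (hn : 0 < n) (i : Fin n) : 0 < marks α i := by
  have := (mem_posCone_iff.1 (h.highestRoot_sub_mem hn (simple_mem_roots α i))).2 i
  rw [map_sub, Finsupp.sub_apply, repr_highestRoot] at this
  simp only [Basis.repr_self, Finsupp.single_eq_same, sub_nonneg] at this
  exact_mod_cast this

theorem IsRootBasis.highestRoot_dominant (h : IsRootBasis α) (hn : 0 < n) (i : Fin n) :
    0 ≤ inner ℝ (highestRoot α) (α i) := by
  have h1 := height_nonneg (h.highestRoot_sub_mem hn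
    (weyl_mem_roots (simpleRefl_mem α i) (h.highestRoot_mem hn)))
  rw [map_sub, height_simpleRefl, sub_sub_cancel] at h1
  exact inner_nonneg_iff_coroot.1 h1

theorem IsRootBasis.marks_eq_of_neg (h : IsRootBasis α) (hn : 0 < n)
    {w : Eucl n ≃ₗᵢ[ℝ] Eucl n} (hw : w ∈ weylGroup α) {σ : Equiv.Perm (Fin n)}
    (hσ : ∀ i, w (α i) = -α (σ i)) (i : Fin n) : marks α (σ i) = marks α i := by
  have h1 : -w (highestRoot α) = ∑ i, (marks α (σ.symm i) : ℝ) • α i := by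
    rw [highestRoot, map_sum, ← Finset.sum_neg_distrib,
      ← Equiv.sum_comp σ fun i => (marks α (σ.symm i) : ℝ) • α i]
    simp [hσ]
  have h2 := h.highestRoot_sub_mem hn (neg_mem_roots (weyl_mem_roots hw (h.highestRoot_mem hn)))
  rw [h1] at h2
  have h3 : ∀ j, marks α (σ.symm j) ≤ marks α j := fun j => by
    have := (mem_posCone_iff.1 h2).2 j
    rw [map_sub, Finsupp.sub_apply, repr_highestRoot] at this
    simp [Finsupp.single_apply] at this
    exact this
  have h4 := (Finset.sum_eq_sum_iff_of_le (s := Finset.univ) fun j _ => h3 j).1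
    (Equiv.sum_comp σ.symm (marks α)) (σ i) (Finset.mem_univ _)
  rw [Equiv.symm_apply_apply] at h4
  exact h4.symm

/-! ### The types of simple Lie algebras -/

/-- Properties of an indecomposable symmetrizable Cartan matrix with at most two root lengths. -/
structure IsGoodCartan (A : Matrix (Fin n) (Fin n) ℤ) : Prop where
  nonpos : ∀ i j, i ≠ j → A i j ≤ 0
  conn : ∃ (i₀ : Fin n) (p : Fin n → Fin n), (∀ i, i = i₀ ∨ A i (p i) ≠ 0) ∧
    ∀ i, ∃ k, p^[k] i = i₀
  symm : ∃ (d : Fin n → ℕ) (r : ℕ), 0 < r ∧ (∀ i, d i = 1 ∨ d i = r) ∧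
    ∀ i j, A i j * d j = A j i * d i

theorem exists_iterate_eq {i₀ : Fin n} {p : Fin n → Fin n} (hp : ∀ i, i = i₀ ∨ p i < i)
    (i : Fin n) : ∃ k, p^[k] i = i₀ := by
  induction i using WellFoundedLT.induction with
  | _ i ih =>
    rcases hp i with h | h
    · exact ⟨0, h⟩
    · obtain ⟨k, hk⟩ := ih _ h
      exact ⟨k + 1, by rwa [Function.iterate_succ_apply]⟩

theorem isGoodCartan_A (n : ℕ) (hn : 1 ≤ n) : IsGoodCartan (CartanMatrix.A n) where
  nonpos := CartanMatrix.A_apply_le_zero_of_ne n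
  conn := by
    refine ⟨⟨0, hn⟩, fun i => ⟨i - 1, by omega⟩, fun i => ?_, exists_iterate_eq fun i => ?_⟩
    · simp only [CartanMatrix.A, Matrix.of_apply, Fin.ext_iff]; grind
    · simp only [Fin.ext_iff, Fin.lt_def]; omega
  symm := ⟨fun _ => 1, 1, one_pos, fun _ => Or.inl rfl, fun i j => by
    rw [← Matrix.transpose_apply (CartanMatrix.A n), CartanMatrix.A_transpose]⟩

theorem isGoodCartan_B (n : ℕ) (hn : 3 ≤ n) : IsGoodCartan (CartanMatrix.B n) where
  nonpos := CartanMatrix.B_off_diag_nonpos n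
  conn := by
    refine ⟨⟨0, by omega⟩, fun i => ⟨i - 1, by omega⟩, fun i => ?_, exists_iterate_eq fun i => ?_⟩
    · simp only [CartanMatrix.B, Matrix.of_apply, Fin.ext_iff]; grind
    · simp only [Fin.ext_iff, Fin.lt_def]; omega
  symm := by
    refine ⟨fun i => if i.val = n - 1 then 1 else 2, 2, two_pos, fun i => ?_, fun i j => ?_⟩
    · simp only; split_ifs <;> simp
    · simp only [CartanMatrix.B, Matrix.of_apply, Fin.ext_iff]; split_ifs <;> omega

theorem isGoodCartan_C (n : ℕ) (hn : 2 ≤ n) : IsGoodCartan (CartanMatrix.C n) where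
  nonpos := CartanMatrix.C_off_diag_nonpos n
  conn := by
    refine ⟨⟨0, by omega⟩, fun i => ⟨i - 1, by omega⟩, fun i => ?_, exists_iterate_eq fun i => ?_⟩
    · simp only [CartanMatrix.C, Matrix.of_apply, Fin.ext_iff]; grind
    · simp only [Fin.ext_iff, Fin.lt_def]; omega
  symm := by
    refine ⟨fun i => if i.val = n - 1 then 2 else 1, 2, two_pos, fun i => ?_, fun i j => ?_⟩
    · simp only; split_ifs <;> simp
    · simp only [CartanMatrix.C, Matrix.of_apply, Fin.ext_iff]; split_ifs <;> omega

theorem isGoodCartan_D (n : ℕ) (hn : 4 ≤ n) : IsGoodCartan (CartanMatrix.D n) where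
  nonpos := CartanMatrix.D_off_diag_nonpos n
  conn := by
    refine ⟨⟨0, by omega⟩, fun i => ⟨if i.val = n - 1 then n - 3 else i - 1, by split_ifs <;> omega⟩,
      fun i => ?_, exists_iterate_eq fun i => ?_⟩
    · by_cases h : i.val = n - 1
      · simp only [CartanMatrix.D, Matrix.of_apply, Fin.ext_iff, h, if_true]; grind
      · simp only [CartanMatrix.D, Matrix.of_apply, Fin.ext_iff, h, if_false]; grind
    · simp only [Fin.ext_iff, Fin.lt_def]; split_ifs <;> omega
  symm := ⟨fun _ => 1, 1, one_pos, fun _ => Or.inl rfl, fun i j => by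
    rw [← Matrix.transpose_apply (CartanMatrix.D n), CartanMatrix.D_transpose]⟩

theorem isGoodCartan_E6 : IsGoodCartan cartanE6 where
  nonpos i j := (by decide : ∀ j i : Fin 6, i ≠ j → cartanE6 i j ≤ 0) j i
  conn := ⟨0, ![0, 0, 1, 2, 3, 2], by decide, fun i => ⟨5, by revert i; decide⟩⟩
  symm := ⟨fun _ => 1, 1, one_pos, fun _ => Or.inl rfl, by decide⟩

theorem isGoodCartan_E7 : IsGoodCartan CartanMatrix.E₇ where
  nonpos i j := (by decide : ∀ j i : Fin 7, i ≠ j → CartanMatrix.E₇ i j ≤ 0) j i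
  conn := ⟨6, ![2, 3, 3, 4, 5, 6, 6], by decide, fun i => ⟨6, by revert i; decide⟩⟩
  symm := ⟨fun _ => 1, 1, one_pos, fun _ => Or.inl rfl, by decide⟩

theorem isGoodCartan_E8 : IsGoodCartan CartanMatrix.E₈ where
  nonpos i j := (by decide : ∀ j i : Fin 8, i ≠ j → CartanMatrix.E₈ i j ≤ 0) j i
  conn := ⟨7, ![2, 3, 3, 4, 5, 6, 7, 7], by decide, fun i => ⟨7, by revert i; decide⟩⟩
  symm := ⟨fun _ => 1, 1, one_pos, fun _ => Or.inl rfl, by decide⟩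

theorem isGoodCartan_F4 : IsGoodCartan CartanMatrix.F₄ where
  nonpos i j := (by decide : ∀ j i : Fin 4, i ≠ j → CartanMatrix.F₄ i j ≤ 0) j i
  conn := ⟨0, ![0, 0, 1, 2], by decide, fun i => ⟨3, by revert i; decide⟩⟩
  symm := ⟨![2, 2, 1, 1], 2, two_pos, by decide, by decide⟩

theorem isGoodCartan_G2 : IsGoodCartan CartanMatrix.G₂ where
  nonpos i j := (by decide : ∀ j i : Fin 2, i ≠ j → CartanMatrix.G₂ i j ≤ 0) j i
  conn := ⟨0, ![0, 0], by decide, fun i => ⟨1, by revert i; decide⟩⟩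
  symm := ⟨![3, 1], 3, three_pos, by decide, by decide⟩

theorem SimpleType.isGoodCartan (T : SimpleType n) : IsGoodCartan T.cartan := by
  cases T with
  | A n hn => exact isGoodCartan_A n hn
  | B n hn => exact isGoodCartan_B n hn
  | C n hn => exact isGoodCartan_C n hn
  | D n hn => exact isGoodCartan_D n hn
  | E6 => exact isGoodCartan_E6
  | E7 => exact isGoodCartan_E7
  | E8 => exact isGoodCartan_E8
  | F4 => exact isGoodCartan_F4
  | G2 => exact isGoodCartan_G2

theorem SimpleType.rank_pos (T : SimpleType n) : 0 < n := by
  cases T <;> omega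

theorem IsSimpleRoots.inner_coroot {T : SimpleType n} (hα : IsSimpleRoots T α) (i j : Fin n) :
    inner ℝ (α i) (coroot α j) = T.cartan i j := by
  rw [WeylOrbit.inner_coroot, hα]

theorem IsSimpleRoots.isRootBasis {T : SimpleType n} (hα : IsSimpleRoots T α) :
    IsRootBasis α := by
  have hA : ∀ i j, 2 * inner ℝ (α i) (α j) = T.cartan i j * inner ℝ (α j) (α j) := fun i j => by
    rw [inner_eq_inner_coroot, hα.inner_coroot]
  obtain ⟨hnp, ⟨i₀, p, hp, hit⟩, ⟨d, r, hr, hd, hsymm⟩⟩ := T.isGoodCartan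
  have hconn : ∀ I : Set (Fin n), I.Nonempty →
      (∀ i ∈ I, ∀ j, inner ℝ (α i) (α j) ≠ 0 → j ∈ I) → ∀ j, j ∈ I := by
    intro I ⟨i, hi⟩ hI j
    have hadj : ∀ i, i = i₀ ∨ inner ℝ (α i) (α (p i)) ≠ 0 := fun i => (hp i).imp_right fun h h0 => by
      have := hA i (p i)
      rw [h0, mul_zero, eq_comm, mul_eq_zero] at this
      exact this.elim (fun h' => h (by exact_mod_cast h')) (inner_self_pos α _).ne'
    have hI0 : ∀ k, i₀ ∈ I ∨ p^[k] i ∈ I := by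
      intro k
      induction k with
      | zero => exact Or.inr hi
      | succ k ih =>
        rcases ih with h | h
        · exact Or.inl h
        · rw [Function.iterate_succ_apply']
          rcases hadj (p^[k] i) with h' | h'
          · exact Or.inl (h' ▸ h)
          · exact Or.inr (hI _ h _ h')
    have h0 : i₀ ∈ I := by
      obtain ⟨k, hk⟩ := hit i
      rcases hI0 k with h | h
      · exact h
      · rwa [hk] at h
    obtain ⟨k, hk⟩ := hit j
    induction k generalizing j with
    | zero => rw [show j = i₀ from hk]; exact h0
    | succ k ih =>
      rw [Function.iterate_succ_apply] at hk
      rcases hadj j with h' | h'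
      · rw [h']; exact h0
      · exact hI _ (ih _ hk) _ (by rwa [real_inner_comm])
  refine ⟨fun i j => ⟨_, hα.inner_coroot i j⟩, fun i j hij => ?_, hconn, ?_⟩
  · have h1 : (T.cartan i j : ℝ) ≤ 0 := by exact_mod_cast hnp i j hij
    have := mul_nonpos_of_nonpos_of_nonneg h1 (inner_self_pos α j).le
    linarith [hA i j]
  · have hdpos : ∀ i, (0 : ℝ) < d i := fun i => by
      rcases hd i with h | h <;> rw [h]
      · norm_num
      · exact_mod_cast hr
    have key := hconn {i | inner ℝ (α i) (α i) * d i₀ = inner ℝ (α i₀) (α i₀) * d i} ⟨i₀, rfl⟩ (by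
      intro i hi j hij
      simp only [Set.mem_ofPred_eq] at hi ⊢
      have h1 := hA i j
      have h2 := hA j i
      rw [real_inner_comm] at h2
      have h3 : (T.cartan i j : ℝ) * d j = T.cartan j i * d i := by exact_mod_cast hsymm i j
      have h4 : (T.cartan i j : ℝ) ≠ 0 := by
        intro h0
        rw [h0, zero_mul] at h1
        exact hij (by linarith)
      apply mul_left_cancel₀ h4
      have h5 : (T.cartan i j : ℝ) * inner ℝ (α j) (α j) = T.cartan j i * inner ℝ (α i) (α i) := by
        linarith
      linear_combination d i₀ * h5 + (T.cartan j i : ℝ) * hi - inner ℝ (α i₀) (α i₀) * h3)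
    simp only [Set.mem_ofPred_eq] at key
    refine ⟨inner ℝ (α i₀) (α i₀) / d i₀, r, div_pos (inner_self_pos α i₀) (hdpos i₀), hr,
      fun i => ?_⟩
    have hne := (hdpos i₀).ne'
    have := key i
    rcases hd i with h | h
    · left; rw [eq_div_iff hne, this, h]; simp
    · right
      rw [← mul_div_assoc, eq_div_iff hne, this, h]; ring

/-! ### The diagram automorphism -/

theorem perm_eq_one_of_reverse {σ : Equiv.Perm (Fin n)}
    (H : ∀ i, (∀ j, i < j → σ j = j) → σ i = i) (i : Fin n) : σ i = i := by
  induction i using WellFoundedGT.induction with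
  | _ i ih => exact H i ih

theorem sum_fin_ite_val (n m : ℕ) (f : ℕ → ℤ) :
    (∑ j : Fin n, if j.val = m then f j.val else 0) = if m < n then f m else 0 := by
  rw [Fin.sum_univ_eq_sum_range (fun j => if j = m then f j else 0) n]
  simp

/-- A permutation of the nodes that preserves the Cartan matrix and acts as `-1` on the weights
modulo the roots. -/
structure IsOpposition (A : Matrix (Fin n) (Fin n) ℤ) (σ : Equiv.Perm (Fin n)) : Prop where
  cartan : ∀ i j, A (σ i) (σ j) = A i j
  char : ∀ (N : ℤ) (φ : Fin n → ℤ), (∀ i, N ∣ ∑ j, A i j * φ j) → ∀ j, N ∣ φ j + φ (σ j)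

theorem sum_cartan_A (f : ℕ → ℤ) (i : Fin n) :
    ∑ j, CartanMatrix.A n i j * f j.val = 2 * f i - (if i.val + 1 < n then f (i + 1) else 0)
      - (if i.val = 0 then 0 else f (i - 1)) := by
  have : ∀ j : Fin n, CartanMatrix.A n i j * f j.val
      = (if j.val = i.val then 2 * f j.val else 0)
      - (if j.val = i.val + 1 then f j.val else 0)
      - (if j.val = i.val - 1 then (if i.val = 0 then 0 else f j.val) else 0) := by
    intro j
    simp only [CartanMatrix.A, Matrix.of_apply, Fin.ext_iff]
    split_ifs <;> omega
  rw [Finset.sum_congr rfl fun j _ => this j, Finset.sum_sub_distrib, Finset.sum_sub_distrib,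
    sum_fin_ite_val n i.val fun j => 2 * f j, sum_fin_ite_val n (i.val + 1) f,
    sum_fin_ite_val n (i.val - 1) fun j => (if i.val = 0 then 0 else f j),
    if_pos i.isLt, if_pos (show i.val - 1 < n by omega)]

theorem cartan_D_apply (hn : 4 ≤ n) (i j : Fin n) :
    CartanMatrix.D n i j = (if j.val = i.val then 2 else 0)
      - (if j.val = i.val + 1 then (if i.val + 2 < n then 1 else 0) else 0)
      - (if j.val = i.val - 1 then (if i.val = 0 ∨ i.val + 1 = n then 0 else 1) else 0)
      - (if j.val = n - 1 then (if i.val + 3 = n then 1 else 0) else 0)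
      - (if j.val = n - 3 then (if i.val + 1 = n then 1 else 0) else 0) := by
  have hi := i.isLt
  have hj := j.isLt
  simp only [CartanMatrix.D, Matrix.of_apply, Fin.ext_iff, show ¬n ≤ 2 by omega, if_false]
  generalize i.val = a at *
  generalize j.val = b at *
  clear i j
  obtain ⟨m, rfl⟩ : ∃ m, n = m + 4 := ⟨n - 4, by omega⟩
  rw [show m + 4 - 1 = m + 3 by omega, show m + 4 - 3 = m + 1 by omega]
  rcases a with _ | a
  · grind (splits := 30)
  · rw [Nat.add_sub_cancel]; grind (splits := 30)

theorem sum_cartan_D (hn : 4 ≤ n) (f : ℕ → ℤ) (i : Fin n) :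
    ∑ j, CartanMatrix.D n i j * f j.val = 2 * f i - (if i.val + 2 < n then f (i + 1) else 0)
      - (if i.val = 0 ∨ i.val + 1 = n then 0 else f (i - 1))
      - (if i.val + 3 = n then f (n - 1) else 0) - (if i.val + 1 = n then f (n - 3) else 0) := by
  have hi := i.isLt
  simp_rw [cartan_D_apply hn, sub_mul, ite_mul, zero_mul, one_mul]
  simp only [Finset.sum_sub_distrib]
  rw [sum_fin_ite_val n i.val fun j => 2 * f j,
    sum_fin_ite_val n (i.val + 1) fun j => (if i.val + 2 < n then f j else 0),
    sum_fin_ite_val n (i.val - 1) fun j => (if i.val = 0 ∨ i.val + 1 = n then 0 else f j),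
    sum_fin_ite_val n (n - 1) fun j => (if i.val + 3 = n then f j else 0),
    sum_fin_ite_val n (n - 3) fun j => (if i.val + 1 = n then f j else 0),
    if_pos hi, if_pos (show i.val - 1 < n by omega), if_pos (show n - 1 < n by omega),
    if_pos (show n - 3 < n by omega)]
  congr 4
  split_ifs <;> omega

theorem opposition_A {σ : Equiv.Perm (Fin n)} (h : IsOpposition (CartanMatrix.A n) σ) (j : Fin n) :
    σ j = Fin.rev j := by
  have h1 := h.char (n + 1) (fun j => (j.val : ℤ) + 1) (fun i => by
    rw [sum_cartan_A fun j => (j : ℤ) + 1]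
    have := i.isLt
    split_ifs <;> first | exact ⟨0, by omega⟩ | exact ⟨1, by omega⟩) j
  have hj := j.isLt
  have hs := (σ j).isLt
  obtain ⟨k, hk⟩ := h1
  have hk1 : k = 1 := by
    have h1 : k < 2 := by by_contra hk2; nlinarith
    have h2 : 0 < k := by by_contra hk2; nlinarith
    omega
  subst hk1
  rw [Fin.ext_iff, Fin.val_rev]
  omega

theorem opposition_B (hn : 2 ≤ n) {σ : Equiv.Perm (Fin n)}
    (h : ∀ i j, CartanMatrix.B n (σ i) (σ j) = CartanMatrix.B n i j) (j : Fin n) : σ j = j := by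
  refine perm_eq_one_of_reverse (fun i ih => ?_) j
  by_cases hi : i.val + 1 = n
  · have := h ⟨n - 2, by omega⟩ ⟨n - 1, by omega⟩
    have hi' : i = ⟨n - 1, by omega⟩ := Fin.ext (by simp; omega)
    rw [← hi'] at this
    simp only [CartanMatrix.B, Matrix.of_apply, Fin.ext_iff] at this
    rw [Fin.ext_iff]
    split_ifs at this <;> omega
  · have h1 := ih ⟨i + 1, by omega⟩ (by simp [Fin.lt_def])
    have := h i ⟨i + 1, by omega⟩
    rw [h1] at this
    simp only [CartanMatrix.B, Matrix.of_apply, Fin.ext_iff] at this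
    rw [Fin.ext_iff]
    by_cases h2 : (σ i).val = i.val + 2
    · have h3 := ih ⟨i + 2, by omega⟩ (by simp [Fin.lt_def])
      have h4 : σ i = σ ⟨i + 2, by omega⟩ := by rw [h3, Fin.ext_iff]; exact h2
      have := σ.injective h4
      rw [Fin.ext_iff] at this
      simp at this
    · by_cases h5 : (σ i).val = i + 1
      · have h4 : σ i = σ ⟨i + 1, by omega⟩ := by rw [h1, Fin.ext_iff]; exact h5
        have := σ.injective h4
        rw [Fin.ext_iff] at this
        simp at this
      · split_ifs at this <;> omega

theorem opposition_C (hn : 2 ≤ n) {σ : Equiv.Perm (Fin n)}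
    (h : ∀ i j, CartanMatrix.C n (σ i) (σ j) = CartanMatrix.C n i j) (j : Fin n) : σ j = j := by
  refine opposition_B hn (fun i j => ?_) j
  rw [← CartanMatrix.C_transpose, Matrix.transpose_apply, Matrix.transpose_apply, h]

theorem opposition_D_tail (hn : 4 ≤ n) {σ : Equiv.Perm (Fin n)}
    (h : ∀ i j, CartanMatrix.D n (σ i) (σ j) = CartanMatrix.D n i j)
    (hσ : ∀ i : Fin n, n ≤ i.val + 2 → n ≤ (σ i).val + 2) (i : Fin n) (hi : i.val + 2 < n) :
    σ i = i := by
  have hσ' : ∀ i : Fin n, n ≤ (σ i).val + 2 → n ≤ i.val + 2 := by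
    let s : Finset (Fin n) := Finset.univ.filter fun i => n ≤ i.val + 2
    have hs : s.map σ.toEmbedding = s := Finset.eq_of_subset_of_card_le (by
      intro x hx
      obtain ⟨y, hy, rfl⟩ := Finset.mem_map.1 hx
      simp only [s, Finset.mem_filter, Finset.mem_univ, true_and] at hy
      simpa [s] using hσ y hy) (by rw [Finset.card_map])
    intro i hi
    have h1 : σ i ∈ s.map σ.toEmbedding := by rw [hs]; simpa [s] using hi
    obtain ⟨y, hy, hyi⟩ := Finset.mem_map.1 h1
    rw [show y = i from σ.injective hyi] at hy
    simpa [s] using hy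
  induction i using WellFoundedGT.induction with
  | _ i ih =>
    by_cases hl : i.val + 3 = n
    · have h1 := h i ⟨n - 1, by omega⟩
      have h2 := hσ ⟨n - 1, by omega⟩ (by simp; omega)
      have h3 := mt (hσ' i) (by omega)
      simp only [CartanMatrix.D, Matrix.of_apply, Fin.ext_iff] at h1
      rw [Fin.ext_iff]
      split_ifs at h1 <;> omega
    · have h1 := h i ⟨i + 1, by omega⟩
      have h0 := ih ⟨i + 1, by omega⟩ (by simp [Fin.lt_def]) (by simp; omega)
      have h3 := mt (hσ' i) (by omega)
      rw [h0] at h1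
      have h2 : (σ i).val ≠ i + 2 := by
        intro h2
        by_cases hl2 : i.val + 4 = n
        · omega
        · have h3 := ih ⟨i + 2, by omega⟩ (by simp [Fin.lt_def]) (by simp; omega)
          have h4 : σ i = σ ⟨i + 2, by omega⟩ := by rw [h3, Fin.ext_iff]; exact h2
          have := σ.injective h4
          rw [Fin.ext_iff] at this
          simp at this
      have h5 : (σ i).val ≠ i + 1 := by
        intro h5
        have h4 : σ i = σ ⟨i + 1, by omega⟩ := by rw [h0, Fin.ext_iff]; exact h5
        have := σ.injective h4
        rw [Fin.ext_iff] at this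
        simp at this
      have := i.isLt
      simp only [CartanMatrix.D, Matrix.of_apply, Fin.ext_iff] at h1
      rw [Fin.ext_iff]
      clear h0 ih hσ hσ' h
      grind (splits := 30)

theorem opposition_D_odd (hn : 4 ≤ n) (ho : Odd n) {σ : Equiv.Perm (Fin n)}
    (h : IsOpposition (CartanMatrix.D n) σ) (i : Fin n) :
    σ i = Equiv.swap (⟨n - 2, by omega⟩ : Fin n) ⟨n - 1, by omega⟩ i := by
  obtain ⟨k, hk⟩ := ho
  have h1 := h.char 4 (fun j => if j.val + 2 < n then 2 * ((j.val : ℤ) + 1) else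
    if j.val + 2 = n then 1 else -1) (fun i => by
    rw [sum_cartan_D hn fun j => if j + 2 < n then 2 * ((j : ℤ) + 1) else
      if j + 2 = n then 1 else -1]
    have := i.isLt
    push_cast
    split_ifs <;> omega)
  have hs : ∀ i : Fin n, n ≤ i.val + 2 → (σ i).val + i.val + 3 = 2 * n := fun i hi => by
    have := h1 i
    have := i.isLt
    have := (σ i).isLt
    split_ifs at * <;> omega
  by_cases hi : i.val + 2 < n
  · rw [opposition_D_tail hn h.cartan (fun i hi => by have := hs i hi; omega) i hi,
      Equiv.swap_apply_of_ne_of_ne] <;> simp only [Ne, Fin.ext_iff] <;> omega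
  · have h2 := hs i (by omega)
    have := i.isLt
    by_cases hi2 : i.val + 2 = n
    · rw [show i = ⟨n - 2, by omega⟩ from Fin.ext (by simp; omega), Equiv.swap_apply_left]
      rw [show i = ⟨n - 2, by omega⟩ from Fin.ext (by simp; omega)] at h2
      rw [Fin.ext_iff]; simp only at h2 ⊢; omega
    · rw [show i = ⟨n - 1, by omega⟩ from Fin.ext (by simp; omega), Equiv.swap_apply_right]
      rw [show i = ⟨n - 1, by omega⟩ from Fin.ext (by simp; omega)] at h2
      rw [Fin.ext_iff]; simp only at h2 ⊢; omega

theorem opposition_D_even (hn : 4 ≤ n) (he : ¬Odd n) {σ : Equiv.Perm (Fin n)}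
    (h : IsOpposition (CartanMatrix.D n) σ) (i : Fin n) : σ i = i := by
  obtain ⟨k, hk⟩ := Nat.not_odd_iff_even.1 he
  have h1 := h.char 2 (fun j => if j.val + 2 < n then 0 else 1) (fun i => by
    rw [sum_cartan_D hn fun j => if j + 2 < n then 0 else 1]
    have := i.isLt
    split_ifs <;> omega)
  have h2 := h.char 2 (fun j => if j.val + 2 < n then (j.val : ℤ) + 1 else
    if j.val + 2 = n then 0 else 1) (fun i => by
    rw [sum_cartan_D hn fun j => if j + 2 < n then (j : ℤ) + 1 else if j + 2 = n then 0 else 1]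
    have := i.isLt
    push_cast
    split_ifs <;> omega)
  have hs : ∀ i : Fin n, n ≤ i.val + 2 → (σ i).val = i.val := fun i hi => by
    have := h1 i
    have := h2 i
    have := i.isLt
    have := (σ i).isLt
    split_ifs at * <;> omega
  by_cases hi : i.val + 2 < n
  · exact opposition_D_tail hn h.cartan (fun i hi => by have := hs i hi; omega) i hi
  · exact Fin.ext (hs i (by omega))

/-- The simple edges of a diagram. -/
def diagramEdge (A : Matrix (Fin n) (Fin n) ℤ) (i j : Fin n) : Bool := decide (A i j = -1)

theorem IsOpposition.edge {A : Matrix (Fin n) (Fin n) ℤ} {σ : Equiv.Perm (Fin n)}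
    (h : IsOpposition A σ) {i j : Fin n} (hij : diagramEdge A i j) :
    diagramEdge A (σ i) (σ j) := by
  rw [diagramEdge, h.cartan]; exact hij

section search

set_option synthInstance.maxSize 10000
set_option synthInstance.maxHeartbeats 400000

theorem paths_E6 : ∀ a, a = 1 ∨ a = 4 → ∀ b, diagramEdge cartanE6 a b →
    ∀ c, diagramEdge cartanE6 b c → c ≠ a → ∀ d, diagramEdge cartanE6 c d → d ≠ b →
    ∀ e, diagramEdge cartanE6 d e → e ≠ c →
    ∀ f, diagramEdge cartanE6 c f → f ≠ b → f ≠ d →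
      a = 4 ∧ b = 3 ∧ c = 2 ∧ d = 1 ∧ e = 0 ∧ f = 5 := by decide +kernel

theorem paths_E7 : ∀ a b, diagramEdge CartanMatrix.E₇ a b →
    ∀ c, diagramEdge CartanMatrix.E₇ b c → c ≠ a → ∀ d, diagramEdge CartanMatrix.E₇ c d → d ≠ b →
    ∀ e, diagramEdge CartanMatrix.E₇ d e → e ≠ c → ∀ f, diagramEdge CartanMatrix.E₇ e f → f ≠ d →
    ∀ g, diagramEdge CartanMatrix.E₇ c g → g ≠ b → g ≠ d →
      a = 0 ∧ b = 2 ∧ c = 3 ∧ d = 4 ∧ e = 5 ∧ f = 6 ∧ g = 1 := by decide +kernel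

theorem paths_E8 : ∀ a b, diagramEdge CartanMatrix.E₈ a b →
    ∀ c, diagramEdge CartanMatrix.E₈ b c → c ≠ a → ∀ d, diagramEdge CartanMatrix.E₈ c d → d ≠ b →
    ∀ e, diagramEdge CartanMatrix.E₈ d e → e ≠ c → ∀ f, diagramEdge CartanMatrix.E₈ e f → f ≠ d →
    ∀ g, diagramEdge CartanMatrix.E₈ f g → g ≠ e →
    ∀ h, diagramEdge CartanMatrix.E₈ c h → h ≠ b → h ≠ d →
      a = 0 ∧ b = 2 ∧ c = 3 ∧ d = 4 ∧ e = 5 ∧ f = 6 ∧ g = 7 ∧ h = 1 := by decide +kernel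

theorem paths_F4 : ∀ c b, CartanMatrix.F₄ b c = -2 → ∀ a, diagramEdge CartanMatrix.F₄ a b →
    a ≠ c → ∀ d, diagramEdge CartanMatrix.F₄ c d → d ≠ b →
      a = 0 ∧ b = 1 ∧ c = 2 ∧ d = 3 := by decide +kernel

theorem paths_G2 : ∀ b a, CartanMatrix.G₂ a b = -3 → a = 0 ∧ b = 1 := by decide

end search

theorem opposition_E6 {σ : Equiv.Perm (Fin 6)} (h : IsOpposition cartanE6 σ) (j : Fin 6) :
    σ j = (![4, 3, 2, 1, 0, 5] : Fin 6 → Fin 6) j := by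
  have h0 : σ 0 = 1 ∨ σ 0 = 4 := by
    have h1 := h.char 3 ![1, 2, 0, 1, 2, 0] (by decide) 0
    revert h1
    generalize σ 0 = a
    revert a
    decide
  have hne : ∀ a b : Fin 6, a ≠ b → σ a ≠ σ b := fun a b => σ.injective.ne
  obtain ⟨ha, hb, hc, hd, he, hf⟩ := paths_E6 _ h0 (σ 1) (h.edge (by decide))
    (σ 2) (h.edge (by decide)) (hne _ _ (by decide)) (σ 3) (h.edge (by decide))
    (hne _ _ (by decide)) (σ 4) (h.edge (by decide)) (hne _ _ (by decide)) (σ 5)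
    (h.edge (by decide)) (hne _ _ (by decide)) (hne _ _ (by decide))
  fin_cases j <;> assumption

theorem opposition_E7 {σ : Equiv.Perm (Fin 7)} (h : IsOpposition CartanMatrix.E₇ σ) (j : Fin 7) :
    σ j = j := by
  have hne : ∀ a b : Fin 7, a ≠ b → σ a ≠ σ b := fun a b => σ.injective.ne
  obtain ⟨ha, hb, hc, hd, he, hf, hg⟩ := paths_E7 (σ 0) (σ 2) (h.edge (by decide))
    (σ 3) (h.edge (by decide)) (hne _ _ (by decide)) (σ 4) (h.edge (by decide))
    (hne _ _ (by decide)) (σ 5) (h.edge (by decide)) (hne _ _ (by decide)) (σ 6)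
    (h.edge (by decide)) (hne _ _ (by decide)) (σ 1)
    (h.edge (by decide)) (hne _ _ (by decide)) (hne _ _ (by decide))
  fin_cases j <;> assumption

theorem opposition_E8 {σ : Equiv.Perm (Fin 8)} (h : IsOpposition CartanMatrix.E₈ σ) (j : Fin 8) :
    σ j = j := by
  have hne : ∀ a b : Fin 8, a ≠ b → σ a ≠ σ b := fun a b => σ.injective.ne
  obtain ⟨ha, hb, hc, hd, he, hf, hg, hh⟩ := paths_E8 (σ 0) (σ 2) (h.edge (by decide))
    (σ 3) (h.edge (by decide)) (hne _ _ (by decide)) (σ 4) (h.edge (by decide))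
    (hne _ _ (by decide)) (σ 5) (h.edge (by decide)) (hne _ _ (by decide)) (σ 6)
    (h.edge (by decide)) (hne _ _ (by decide)) (σ 7)
    (h.edge (by decide)) (hne _ _ (by decide)) (σ 1)
    (h.edge (by decide)) (hne _ _ (by decide)) (hne _ _ (by decide))
  fin_cases j <;> assumption

theorem opposition_F4 {σ : Equiv.Perm (Fin 4)} (h : IsOpposition CartanMatrix.F₄ σ) (j : Fin 4) :
    σ j = j := by
  have hne : ∀ a b : Fin 4, a ≠ b → σ a ≠ σ b := fun a b => σ.injective.ne
  obtain ⟨ha, hb, hc, hd⟩ := paths_F4 (σ 2) (σ 1) ((h.cartan 1 2).trans (by decide))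
    (σ 0) (h.edge (by decide)) (hne _ _ (by decide)) (σ 3) (h.edge (by decide))
    (hne _ _ (by decide))
  fin_cases j <;> assumption

theorem opposition_G2 {σ : Equiv.Perm (Fin 2)} (h : IsOpposition CartanMatrix.G₂ σ) (j : Fin 2) :
    σ j = j := by
  obtain ⟨ha, hb⟩ := paths_G2 (σ 1) (σ 0) ((h.cartan 0 1).trans (by decide))
  fin_cases j <;> assumption

theorem SimpleType.eq_partner (T : SimpleType n) {σ : Equiv.Perm (Fin n)}
    (h : IsOpposition T.cartan σ) (j : Fin n) : σ j = T.partner j := by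
  cases T with
  | A n hn => exact opposition_A h j
  | B n hn => exact opposition_B (by omega) h.cartan j
  | C n hn => exact opposition_C hn h.cartan j
  | D n hn =>
    simp only [SimpleType.partner]
    split_ifs with ho
    · exact opposition_D_odd hn ho h j
    · exact opposition_D_even hn ho h j
  | E6 => exact opposition_E6 h j
  | E7 => exact opposition_E7 h j
  | E8 => exact opposition_E8 h j
  | F4 => exact opposition_F4 h j
  | G2 => exact opposition_G2 h j

theorem SimpleType.partner_partner (T : SimpleType n) (j : Fin n) :
    T.partner (T.partner j) = j := by
  cases T with
  | A n hn => exact Fin.rev_rev j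
  | D n hn =>
    simp only [SimpleType.partner]
    split_ifs with ho
    · exact Equiv.swap_apply_self _ _ j
    · rfl
  | E6 => revert j; decide
  | _ => rfl

theorem SimpleType.kappa_sq (T : SimpleType n) :
    T.kappa ^ 2 = ∏ j, if T.partner j = j then (1 : ℝ) else 1 / 2 := by
  cases T with
  | A n hn =>
    rw [Finset.prod_ite, Finset.prod_const_one, one_mul, Finset.prod_const, SimpleType.kappa,
      ← pow_mul]
    congr 1
    simp only [SimpleType.partner]
    have : (Finset.univ.filter fun j : Fin n => ¬Fin.rev j = j).card =
        n - if Odd n then 1 else 0 := by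
      rw [Finset.filter_not, Finset.card_sdiff_of_subset (Finset.filter_subset _ _),
        Finset.card_univ, Fintype.card_fin]
      congr 1
      split_ifs with ho
      · rw [Finset.card_eq_one]
        refine ⟨⟨n / 2, by omega⟩, ?_⟩
        ext j
        obtain ⟨k, hk⟩ := ho
        simp only [Finset.mem_filter, Finset.mem_univ, true_and, Finset.mem_singleton, Fin.ext_iff,
          Fin.val_rev]
        omega
      · rw [Finset.card_eq_zero, Finset.filter_eq_empty_iff]
        obtain ⟨k, hk⟩ := Nat.not_odd_iff_even.1 ho
        intro j _
        rw [Fin.ext_iff, Fin.val_rev]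
        omega
    refine Eq.trans ?_ (this.symm.trans rfl)
    split_ifs with ho
    · obtain ⟨k, hk⟩ := ho; omega
    · obtain ⟨k, hk⟩ := Nat.not_odd_iff_even.1 ho; omega
  | D n hn =>
    simp only [SimpleType.partner, SimpleType.kappa]
    split_ifs with ho
    · rw [Finset.prod_ite, Finset.prod_const_one, one_mul, Finset.prod_const]
      congr 1
      have hne : (⟨n - 2, by omega⟩ : Fin n) ≠ ⟨n - 1, by omega⟩ := by
        simp only [Ne, Fin.ext_iff]; omega
      refine (Finset.card_pair hne).symm.trans ?_
      refine congrArg _ ?_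
      ext j
      rw [Finset.mem_filter, Equiv.swap_apply_def, Finset.mem_insert, Finset.mem_singleton]
      split_ifs with h1 h2 <;> simp_all [eq_comm]
    · simp
  | E6 =>
    simp [SimpleType.partner, SimpleType.kappa, Fin.prod_univ_succ]
    norm_num
  | _ => simp [SimpleType.partner, SimpleType.kappa]

theorem SimpleType.kappa_pos (T : SimpleType n) : 0 < T.kappa := by
  cases T <;> simp only [SimpleType.kappa] <;> positivity

theorem inner_fundWeight_coroot (i j : Fin n) :
    inner ℝ (fundWeight α i) (coroot α j) = if i = j then 1 else 0 :=
  inner_dualVec _ _ _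

theorem ext_inner_coroot {u v : Eucl n} (h : ∀ j, inner ℝ u (coroot α j) = inner ℝ v (coroot α j)) :
    u = v :=
  InnerProductSpace.ext_inner_left_basis (coroot α) fun j => by
    rw [real_inner_comm, h, real_inner_comm]

theorem IsSimpleRoots.exists_longest {T : SimpleType n} (hα : IsSimpleRoots T α) :
    ∃ w ∈ weylGroup α, ∃ σ : Equiv.Perm (Fin n), (∀ i, w (α i) = -α (σ i)) ∧
      ∀ j, σ j = T.partner j := by
  have h := hα.isRootBasis
  obtain ⟨w, hw, σ, hσ⟩ := h.exists_longest
  have hnorm : ∀ i, inner ℝ (α (σ i)) (α (σ i)) = inner ℝ (α i) (α i) := fun i => by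
    rw [← LinearIsometryEquiv.inner_map_map w (α i), hσ, inner_neg_neg]
  have hco : ∀ i, w (coroot α i) = -coroot α (σ i) := fun i => by
    rw [coroot_apply, coroot_apply, map_smul, hσ, hnorm, smul_neg]
  refine ⟨w, hw, σ, hσ, T.eq_partner ⟨fun i j => ?_, fun N φ hφ j => ?_⟩⟩
  · have h1 := hα.inner_coroot i j
    rw [← LinearIsometryEquiv.inner_map_map w, hσ, hco, inner_neg_neg, hα.inner_coroot] at h1
    exact_mod_cast h1
  · have hww : -w (fundWeight α j) = fundWeight α (σ j) := by
      refine ext_inner_coroot (α := α) fun k => ?_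
      obtain ⟨l, rfl⟩ := σ.surjective k
      rw [inner_neg_left, ← inner_neg_right, ← hco, LinearIsometryEquiv.inner_map_map,
        inner_fundWeight_coroot, inner_fundWeight_coroot]
      simp
    have hQ : fundWeight α j + fundWeight α (σ j) ∈ rootLattice α := by
      rw [← hww, ← sub_eq_add_neg]
      refine posCone_le (h.sub_weyl_mem_posCone (fun i => ?_) hw)
      exact ⟨if j = i then 1 else 0, by rw [inner_fundWeight_coroot]; split_ifs <;> simp⟩
    obtain ⟨c, hc⟩ := rootLattice_iff_exists_sum.1 hQ
    have h2 : ∀ k, (if j = k then 1 else 0) + (if σ j = k then 1 else 0) =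
        ∑ i, c i * T.cartan i k := fun k => by
      have := congrArg (fun v => inner ℝ v (coroot α k)) hc
      simp only [inner_add_left, inner_fundWeight_coroot, sum_inner, real_inner_smul_left,
        hα.inner_coroot] at this
      exact_mod_cast this
    have h3 : φ j + φ (σ j) = ∑ i, c i * ∑ k, T.cartan i k * φ k := by
      calc φ j + φ (σ j)
          = ∑ k, ((if j = k then 1 else 0) + (if σ j = k then 1 else 0)) * φ k := by
            simp [add_mul, Finset.sum_add_distrib]
        _ = ∑ k, (∑ i, c i * T.cartan i k) * φ k := by simp_rw [h2]
        _ = _ := by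
          simp_rw [Finset.sum_mul, Finset.mul_sum]
          rw [Finset.sum_comm]
          simp_rw [mul_assoc]
    rw [h3]
    exact Finset.dvd_sum fun i _ => Dvd.dvd.mul_left (hφ i) _

/-! ### Trigonometric polynomials -/

/-- Trigonometric polynomials, as formal combinations of exponents. -/
abbrev TrigPoly (n : ℕ) := AddMonoidAlgebra ℂ (Eucl n)

/-- The exponential `x ↦ exp(2πi⟨μ, x⟩)`. -/
def chr (μ x : Eucl n) : ℂ := Complex.exp (2 * Real.pi * Complex.I * (inner ℝ μ x : ℝ))

theorem chr_comm (μ x : Eucl n) : chr μ x = chr x μ := by rw [chr, chr, real_inner_comm]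

@[simp] theorem chr_zero_left (x : Eucl n) : chr 0 x = 1 := by simp [chr]

theorem chr_add_left (μ ν x : Eucl n) : chr (μ + ν) x = chr μ x * chr ν x := by
  rw [chr, chr, chr, ← Complex.exp_add, inner_add_left]; push_cast; ring_nf

theorem chr_add_right (μ x y : Eucl n) : chr μ (x + y) = chr μ x * chr μ y := by
  rw [chr_comm, chr_add_left, chr_comm x, chr_comm y]

theorem chr_neg_left (μ x : Eucl n) : chr (-μ) x = (chr μ x)⁻¹ := by
  rw [chr, chr, ← Complex.exp_neg, inner_neg_left]; push_cast; ring_nf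

theorem chr_sub_left (μ ν x : Eucl n) : chr (μ - ν) x = chr μ x * (chr ν x)⁻¹ := by
  rw [sub_eq_add_neg, chr_add_left, chr_neg_left]

theorem norm_chr (μ x : Eucl n) : ‖chr μ x‖ = 1 := by
  rw [chr, show (2 * Real.pi * Complex.I * (inner ℝ μ x : ℝ) : ℂ) =
    ((2 * Real.pi * inner ℝ μ x : ℝ) : ℂ) * Complex.I by push_cast; ring,
    Complex.norm_exp_ofReal_mul_I]

theorem chr_ne_zero (μ x : Eucl n) : chr μ x ≠ 0 := Complex.exp_ne_zero _

theorem conj_chr (μ x : Eucl n) : conj (chr μ x) = chr (-μ) x := by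
  rw [chr_neg_left, Complex.inv_def, Complex.normSq_eq_norm_sq, norm_chr]; simp

theorem chr_weyl (w : Eucl n ≃ₗᵢ[ℝ] Eucl n) (μ x : Eucl n) : chr (w μ) (w x) = chr μ x := by
  rw [chr, chr, LinearIsometryEquiv.inner_map_map]

theorem chr_weyl_right (w : Eucl n ≃ₗᵢ[ℝ] Eucl n) (μ x : Eucl n) : chr μ (w x) = chr (w⁻¹ μ) x := by
  rw [← chr_weyl w (w⁻¹ μ) x]; congr 1; exact (w.apply_symm_apply μ).symm

theorem chr_simpleRefl (i : Fin n) (μ x : Eucl n) :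
    chr μ (simpleRefl α i x) = chr (simpleRefl α i μ) x := by
  rw [← chr_weyl (simpleRefl α i) _ x, simpleRefl_simpleRefl]

theorem chr_eq_one_of_int {μ x : Eucl n} {k : ℤ} (h : inner ℝ μ x = k) : chr μ x = 1 := by
  rw [chr, h, show (2 * Real.pi * Complex.I * ((k : ℝ) : ℂ) : ℂ) = k * (2 * Real.pi * Complex.I) by
    push_cast; ring]
  exact Complex.exp_int_mul_two_pi_mul_I k

theorem chr_eq_one_iff {μ x : Eucl n} : chr μ x = 1 ↔ ∃ k : ℤ, inner ℝ μ x = k := by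
  refine ⟨fun h => ?_, fun ⟨k, hk⟩ => chr_eq_one_of_int hk⟩
  obtain ⟨k, hk⟩ := Complex.exp_eq_one_iff.1 h
  refine ⟨k, ?_⟩
  have h2 : (2 * Real.pi * Complex.I : ℂ) ≠ 0 := Complex.two_pi_I_ne_zero
  rw [mul_comm (k : ℂ)] at hk
  exact_mod_cast mul_left_cancel₀ h2 hk

/-- The value of a trigonometric polynomial. -/
def evalAt (x : Eucl n) : TrigPoly n →ₐ[ℂ] ℂ :=
  AddMonoidAlgebra.lift ℂ ℂ (Eucl n)
    { toFun := fun μ => chr μ.toAdd x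
      map_one' := chr_zero_left x
      map_mul' := fun μ ν => chr_add_left μ.toAdd ν.toAdd x }

theorem evalAt_apply (x : Eucl n) (f : TrigPoly n) :
    evalAt x f = f.coeff.sum fun μ c => c * chr μ x :=
  AddMonoidAlgebra.lift_apply _ _

@[simp] theorem evalAt_single (x μ : Eucl n) (c : ℂ) :
    evalAt x (AddMonoidAlgebra.single μ c) = c * chr μ x :=
  AddMonoidAlgebra.lift_single _ _ _

theorem evalAt_injective {f : TrigPoly n} (h : ∀ x, evalAt x f = 0) : f = 0 := by
  let c : Eucl n → (Multiplicative (Eucl n) →* ℂ) := fun μ =>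
    { toFun := fun x => chr μ x.toAdd
      map_one' := by rw [chr_comm]; exact chr_zero_left μ
      map_mul' := fun x y => chr_add_right μ x.toAdd y.toAdd }
  have hc : Function.Injective c := by
    intro μ ν hμν
    by_contra hne
    set v := μ - ν with hv
    have hv0 : inner ℝ v v ≠ 0 := (real_inner_self_pos.2 (sub_ne_zero.2 hne)).ne'
    have h1 : chr v ((1 / (2 * inner ℝ v v)) • v) = 1 := by
      rw [hv, chr_sub_left, ← hv]
      have := DFunLike.congr_fun hμν (Multiplicative.ofAdd ((1 / (2 * inner ℝ v v)) • v))
      change chr μ ((1 / (2 * inner ℝ v v)) • v) = chr ν ((1 / (2 * inner ℝ v v)) • v) at this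
      rw [this, mul_inv_cancel₀ (chr_ne_zero _ _)]
    obtain ⟨k, hk⟩ := chr_eq_one_iff.1 h1
    rw [real_inner_smul_right] at hk
    field_simp at hk
    have : (1 : ℤ) = 2 * k := by exact_mod_cast hk
    omega
  have hli := (linearIndependent_monoidHom (Multiplicative (Eucl n)) ℂ).comp c hc
  rw [linearIndependent_iff] at hli
  rw [← AddMonoidAlgebra.coeff_eq_zero]
  refine hli f.coeff ?_
  ext x
  have := h x.toAdd
  rw [evalAt_apply] at this
  rw [Finsupp.linearCombination_apply, Finsupp.sum, Finset.sum_apply]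
  exact this

theorem evalAt_ext {f g : TrigPoly n} (h : ∀ x, evalAt x f = evalAt x g) : f = g :=
  sub_eq_zero.1 (evalAt_injective fun x => by rw [map_sub, h, sub_self])

theorem coeff_of_evalAt_map {w : Eucl n ≃ₗᵢ[ℝ] Eucl n} {c : ℂ} {f : TrigPoly n}
    (h : ∀ x, evalAt (w x) f = c * evalAt x f) (μ : Eucl n) :
    f.coeff (w μ) = c * f.coeff μ := by
  have hg : AddMonoidAlgebra.domCongr ℂ ℂ w.toLinearEquiv.toAddEquiv.symm f = c • f := by
    refine evalAt_ext fun x => ?_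
    rw [map_smul, smul_eq_mul, ← h]
    have h2 : (evalAt x).comp (AddMonoidAlgebra.domCongr ℂ ℂ
        w.toLinearEquiv.toAddEquiv.symm : TrigPoly n ≃ₐ[ℂ] TrigPoly n).toAlgHom =
          evalAt (w x) := by
      apply AddMonoidAlgebra.algHom_ext _ (Subsingleton.elim _ _)
      intro μ
      change evalAt x ((AddMonoidAlgebra.domCongr ℂ ℂ w.toLinearEquiv.toAddEquiv.symm :
        TrigPoly n ≃ₐ[ℂ] TrigPoly n) (AddMonoidAlgebra.single μ 1)) = _
      rw [AddMonoidAlgebra.domCongr_single, evalAt_single, evalAt_single, chr_weyl_right]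
      rfl
    exact DFunLike.congr_fun h2 f
  have := congrArg (fun f : TrigPoly n => f.coeff μ) hg
  simpa using this

/-! ### Weights -/

/-- The weight lattice. -/
def IsWeight (α : Basis (Fin n) ℝ (Eucl n)) (v : Eucl n) : Prop :=
  ∀ i, ∃ k : ℤ, inner ℝ v (coroot α i) = k

theorem IsDominant.isWeight {v : Eucl n} (h : IsDominant α v) : IsWeight α v := fun i => by
  obtain ⟨k, hk⟩ := h i; exact ⟨k, by rw [hk]; simp⟩

theorem IsWeight.add {u v : Eucl n} (hu : IsWeight α u) (hv : IsWeight α v) :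
    IsWeight α (u + v) := fun i => by
  obtain ⟨k, hk⟩ := hu i
  obtain ⟨l, hl⟩ := hv i
  exact ⟨k + l, by rw [inner_add_left, hk, hl]; push_cast; rfl⟩

theorem IsWeight.neg {v : Eucl n} (hv : IsWeight α v) : IsWeight α (-v) := fun i => by
  obtain ⟨l, hl⟩ := hv i
  exact ⟨-l, by rw [inner_neg_left, hl]; push_cast; rfl⟩

theorem IsWeight.sub {u v : Eucl n} (hu : IsWeight α u) (hv : IsWeight α v) :
    IsWeight α (u - v) := by
  rw [sub_eq_add_neg]; exact hu.add hv.neg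

theorem isWeight_zero : IsWeight α 0 := fun i => ⟨0, by simp⟩

theorem IsRootBasis.isWeight_of_mem (h : IsRootBasis α) {v : Eucl n} (hv : v ∈ rootLattice α) :
    IsWeight α v := fun i => h.int_pairing hv i

theorem IsWeight.int_pairing {u v : Eucl n} (hu : IsWeight α u) (hv : v ∈ rootLattice (coroot α)) :
    ∃ k : ℤ, inner ℝ u v = k := by
  obtain ⟨c, rfl⟩ := rootLattice_iff_exists_sum.1 hv
  choose k hk using hu
  exact ⟨∑ i, c i * k i, by simp [inner_sum, real_inner_smul_right, hk]⟩

theorem IsRootBasis.isWeight_weyl (h : IsRootBasis α) {w : Eucl n ≃ₗᵢ[ℝ] Eucl n}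
    (hw : w ∈ weylGroup α) {v : Eucl n} (hv : IsWeight α v) : IsWeight α (w v) :=
  simpleRefl_mem_orbit_induction (S := {v | IsWeight α v}) (fun v hv i => by
    obtain ⟨k, hk⟩ := hv i
    rw [simpleRefl_apply, hk]
    exact hv.sub (h.isWeight_of_mem (int_smul_mem_rootLattice (simple_mem_rootLattice α i) k)))
    hw hv

theorem isWeight_fundWeight (i : Fin n) : IsWeight α (fundWeight α i) := fun j =>
  ⟨if i = j then 1 else 0, by rw [inner_fundWeight_coroot]; split_ifs <;> simp⟩

theorem inner_weight_coroot (l : Fin n →₀ ℕ) (i : Fin n) :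
    inner ℝ (weight α l) (coroot α i) = l i := by
  simp [weight, sum_inner, real_inner_smul_left, inner_fundWeight_coroot]

theorem isDominant_weight (l : Fin n →₀ ℕ) : IsDominant α (weight α l) := fun i =>
  ⟨l i, inner_weight_coroot l i⟩

theorem isWeight_weight (l : Fin n →₀ ℕ) : IsWeight α (weight α l) :=
  (isDominant_weight l).isWeight

theorem weight_injective : Function.Injective (weight α) := fun l l' h => by
  ext i
  have := congrArg (fun v => inner ℝ v (coroot α i)) h
  simpa [inner_weight_coroot] using this

theorem IsDominant.exists_weight {v : Eucl n} (h : IsDominant α v) : ∃ l, weight α l = v := by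
  choose k hk using h
  exact ⟨Finsupp.equivFunOnFinite.symm k, ext_inner_coroot (α := α) fun i => by
    rw [inner_weight_coroot, hk]; simp⟩

theorem IsWeight.isDominant {v : Eucl n} (h : IsWeight α v)
    (hpos : ∀ i, 0 ≤ inner ℝ v (coroot α i)) : IsDominant α v := fun i => by
  obtain ⟨k, hk⟩ := h i
  have := hpos i
  rw [hk] at this
  exact ⟨k.toNat, by
    rw [hk]; exact_mod_cast (Int.toNat_of_nonneg (by exact_mod_cast this)).symm⟩

theorem weight_single (j : Fin n) : weight α (Finsupp.single j 1) = fundWeight α j := by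
  simp [weight, Finsupp.single_apply, ite_smul]

theorem weight_eq_sum (l : Fin n →₀ ℕ) : weight α l = ∑ i, l i • fundWeight α i := by
  simp [weight, Nat.cast_smul_eq_nsmul]

theorem inner_rho_coroot (i : Fin n) : inner ℝ (rho α) (coroot α i) = 1 := by
  simp [rho, sum_inner, inner_fundWeight_coroot]

theorem isDominant_rho : IsDominant α (rho α) := fun i => ⟨1, by rw [inner_rho_coroot]; simp⟩

/-! ### Positive roots -/

open Classical in
/-- The positive roots. -/
def IsRootBasis.posRoots (h : IsRootBasis α) : Finset (Eucl n) :=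
  h.finite_roots.toFinset.filter (· ∈ posCone α)

theorem IsRootBasis.mem_posRoots (h : IsRootBasis α) {β : Eucl n} :
    β ∈ h.posRoots ↔ β ∈ roots α ∧ β ∈ posCone α := by
  simp [IsRootBasis.posRoots]

theorem IsRootBasis.simple_mem_posRoots (h : IsRootBasis α) (i : Fin n) : α i ∈ h.posRoots :=
  h.mem_posRoots.2 ⟨simple_mem_roots α i, simple_mem_posCone α i⟩

open Classical in
theorem IsRootBasis.simpleRefl_mem_erase (h : IsRootBasis α) {i : Fin n} {β : Eucl n}
    (hβ : β ∈ h.posRoots.erase (α i)) : simpleRefl α i β ∈ h.posRoots.erase (α i) := by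
  obtain ⟨h1, h2⟩ := Finset.mem_erase.1 hβ
  obtain ⟨h3, h4⟩ := h.mem_posRoots.1 h2
  refine Finset.mem_erase.2 ⟨fun he => ?_, h.mem_posRoots.2
    ⟨weyl_mem_roots (simpleRefl_mem α i) h3, h.simpleRefl_mem_posCone h3 h4 h1⟩⟩
  have h5 : β = -α i := by rw [← simpleRefl_simpleRefl α i β, he, simpleRefl_self]
  exact simple_notMem_neg α i (h5 ▸ h4)

open Classical in
@[to_additive]
theorem IsRootBasis.prod_erase_simpleRefl (h : IsRootBasis α) {M : Type*} [CommMonoid M] (i : Fin n)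
    (F : Eucl n → M) : ∏ β ∈ h.posRoots.erase (α i), F (simpleRefl α i β) =
      ∏ β ∈ h.posRoots.erase (α i), F β :=
  Finset.prod_nbij' (simpleRefl α i) (simpleRefl α i) (fun _ => h.simpleRefl_mem_erase)
    (fun _ => h.simpleRefl_mem_erase) (fun _ _ => simpleRefl_simpleRefl α i _)
    (fun _ _ => simpleRefl_simpleRefl α i _) fun _ _ => rfl

theorem IsRootBasis.sum_posRoots (h : IsRootBasis α) :
    ∑ β ∈ h.posRoots, β = (2 : ℝ) • rho α := by
  classical
  refine ext_inner_coroot (α := α) fun i => ?_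
  rw [real_inner_smul_left, inner_rho_coroot, mul_one]
  have h1 := Finset.add_sum_erase _ (fun β => β) (h.simple_mem_posRoots i)
  have h2 := h.sum_erase_simpleRefl i fun β => β
  rw [← map_sum] at h2
  set v := ∑ β ∈ h.posRoots.erase (α i), β
  rw [← h1, inner_add_left, inner_coroot_self, add_eq_left]
  rw [simpleRefl_apply, sub_eq_self, smul_eq_zero] at h2
  exact h2.resolve_right (α.ne_zero i)

theorem IsRootBasis.two_mul_height (h : IsRootBasis α) (v : Eucl n) :
    2 * height α v = ∑ β ∈ h.dual.posRoots, inner ℝ v β := by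
  have : rho (coroot α) = ∑ i, dualVec α i := by simp [rho, fundWeight]
  rw [← inner_sum, h.dual.sum_posRoots, real_inner_smul_right, this, inner_sum_dualVec]

theorem IsRootBasis.two_mul_height_int (h : IsRootBasis α) {v : Eucl n} (hv : IsWeight α v) :
    ∃ k : ℤ, 2 * height α v = k := by
  rw [h.two_mul_height]
  have : ∀ β : Eucl n, ∃ k : ℤ, β ∈ h.dual.posRoots → inner ℝ v β = k := fun β => by
    by_cases hβ : β ∈ h.dual.posRoots
    · obtain ⟨k, hk⟩ := hv.int_pairing (posCone_le (h.dual.mem_posRoots.1 hβ).2)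
      exact ⟨k, fun _ => hk⟩
    · exact ⟨0, fun h' => absurd h' hβ⟩
  choose k hk using this
  exact ⟨∑ β ∈ h.dual.posRoots, k β, by push_cast; exact Finset.sum_congr rfl hk⟩

theorem inner_nonneg_of_dominant {u v : Eucl n} (hu : ∀ i, 0 ≤ inner ℝ u (α i))
    (hv : v ∈ posCone α) : 0 ≤ inner ℝ u v := by
  rw [real_inner_comm, inner_eq_sum_repr (α := α)]
  refine Finset.sum_nonneg fun i _ => mul_nonneg ((mem_posCone_iff.1 hv).2 i) ?_
  rw [real_inner_comm]; exact hu i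

theorem IsRootBasis.height_nonneg_of_dominant (h : IsRootBasis α) {v : Eucl n}
    (hv : IsDominant α v) : 0 ≤ 2 * height α v := by
  rw [h.two_mul_height]
  refine Finset.sum_nonneg fun β hβ => inner_nonneg_of_dominant (α := coroot α) (fun i => ?_)
    (h.dual.mem_posRoots.1 hβ).2
  obtain ⟨k, hk⟩ := hv i
  rw [hk]; positivity

theorem eq_of_height_eq {u v : Eucl n} (h : u - v ∈ posCone α) (hh : height α u ≤ height α v) :
    u = v :=
  sub_eq_zero.1 (eq_zero_of_height h (by rw [map_sub]; linarith))

theorem eq_rho {μ : Eucl n} (hμ : rho α - μ ∈ posCone α)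
    (hpos : ∀ i, 0 ≤ inner ℝ (μ - rho α) (coroot α i)) : μ = rho α := by
  have h1 : 0 ≤ inner ℝ (μ - rho α) (rho α - μ) :=
    inner_nonneg_of_dominant (fun i => inner_nonneg_iff_coroot.1 (hpos i)) hμ
  rw [← neg_sub μ, inner_neg_right] at h1
  have h2 : inner ℝ (μ - rho α) (μ - rho α) = 0 :=
    le_antisymm (by linarith) (real_inner_self_nonneg)
  exact sub_eq_zero.1 (inner_self_eq_zero.1 h2)

/-! ### Highest exponents -/

/-- The exponent `v` occurs in `f` with coefficient `c`, and dominates all exponents of `f`. -/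
def HasTop (α : Basis (Fin n) ℝ (Eucl n)) (f : TrigPoly n) (v : Eucl n) (c : ℂ) : Prop :=
  f.coeff v = c ∧ ∀ μ, f.coeff μ ≠ 0 → v - μ ∈ posCone α

/-- The exponent `v` occurs in `f` with coefficient `1`, and dominates all others. -/
abbrev IsTop (α : Basis (Fin n) ℝ (Eucl n)) (f : TrigPoly n) (v : Eucl n) : Prop :=
  HasTop α f v 1

theorem isTop_single (v : Eucl n) : IsTop α (AddMonoidAlgebra.single v 1) v := by
  classical
  refine ⟨by simp, fun μ hμ => ?_⟩
  have : v = μ := by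
    by_contra hne
    rw [AddMonoidAlgebra.coeff_single, Finsupp.single_apply, if_neg hne] at hμ
    exact hμ rfl
  rw [this, sub_self]
  exact zero_mem _

theorem isTop_one : IsTop α (1 : TrigPoly n) 0 := isTop_single 0

theorem HasTop.mul {f g : TrigPoly n} {u v : Eucl n} {c d : ℂ} (hf : HasTop α f u c)
    (hg : HasTop α g v d) : HasTop α (f * g) (u + v) (c * d) := by
  classical
  refine ⟨?_, fun μ hμ => ?_⟩
  · rw [AddMonoidAlgebra.coeff_mul_add_of_uniqueAdd, hf.1, hg.1]
    intro a b ha hb hab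
    have h1 := hf.2 a (Finsupp.mem_support_iff.1 ha)
    have h2 := hg.2 b (Finsupp.mem_support_iff.1 hb)
    have h3 : v - b = -(u - a) := by
      rw [neg_sub, sub_eq_sub_iff_add_eq_add, add_comm v, ← hab]
    rw [h3] at h2
    have h4 := eq_zero_of_posCone h1 h2
    rw [h4, neg_zero] at h3
    exact ⟨(sub_eq_zero.1 h4).symm, (sub_eq_zero.1 h3).symm⟩
  · have := AddMonoidAlgebra.support_coeff_mul_subset f g (Finsupp.mem_support_iff.2 hμ)
    obtain ⟨a, ha, b, hb, rfl⟩ := Finset.mem_add.1 this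
    rw [add_sub_add_comm]
    exact add_mem (hf.2 a (Finsupp.mem_support_iff.1 ha)) (hg.2 b (Finsupp.mem_support_iff.1 hb))

theorem HasTop.prod {ι : Type*} (s : Finset ι) {f : ι → TrigPoly n} {v : ι → Eucl n} {c : ι → ℂ}
    (hf : ∀ i ∈ s, HasTop α (f i) (v i) (c i)) :
    HasTop α (∏ i ∈ s, f i) (∑ i ∈ s, v i) (∏ i ∈ s, c i) := by
  classical
  induction s using Finset.induction_on with
  | empty => simpa using isTop_one
  | insert i s hi ih =>
    rw [Finset.prod_insert hi, Finset.sum_insert hi, Finset.prod_insert hi]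
    exact (hf i (Finset.mem_insert_self i s)).mul
      (ih fun j hj => hf j (Finset.mem_insert_of_mem hj))

theorem HasTop.sum {ι : Type*} (s : Finset ι) {f : ι → TrigPoly n} {v : Eucl n} {c : ι → ℂ}
    (hf : ∀ i ∈ s, HasTop α (f i) v (c i)) : HasTop α (∑ i ∈ s, f i) v (∑ i ∈ s, c i) := by
  refine ⟨?_, fun μ hμ => ?_⟩
  · rw [AddMonoidAlgebra.coeff_sum, Finset.sum_apply']
    exact Finset.sum_congr rfl fun i hi => (hf i hi).1
  · rw [AddMonoidAlgebra.coeff_sum, Finset.sum_apply'] at hμ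
    obtain ⟨i, hi, h0⟩ := Finset.exists_ne_zero_of_sum_ne_zero hμ
    exact (hf i hi).2 μ h0

theorem HasTop.smul {f : TrigPoly n} {v : Eucl n} {c : ℂ} (d : ℂ) (hf : HasTop α f v c) :
    HasTop α (d • f) v (d * c) := by
  refine ⟨?_, fun μ hμ => hf.2 μ fun h0 => hμ ?_⟩
  · rw [AddMonoidAlgebra.coeff_smul, Finsupp.smul_apply, hf.1, smul_eq_mul]
  · rw [AddMonoidAlgebra.coeff_smul, Finsupp.smul_apply, h0, smul_zero]

theorem IsTop.mul {f g : TrigPoly n} {u v : Eucl n} (hf : IsTop α f u) (hg : IsTop α g v) :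
    IsTop α (f * g) (u + v) := by
  have := HasTop.mul hf hg
  rwa [one_mul] at this

theorem IsTop.pow {f : TrigPoly n} {v : Eucl n} (hf : IsTop α f v) (k : ℕ) :
    IsTop α (f ^ k) (k • v) := by
  induction k with
  | zero => simpa using isTop_one
  | succ k ih => rw [pow_succ, succ_nsmul]; exact ih.mul hf

theorem IsTop.prod {ι : Type*} (s : Finset ι) {f : ι → TrigPoly n} {v : ι → Eucl n}
    (hf : ∀ i ∈ s, IsTop α (f i) (v i)) : IsTop α (∏ i ∈ s, f i) (∑ i ∈ s, v i) := by
  have := HasTop.prod s hf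
  rwa [Finset.prod_const_one] at this

/-! ### Antisymmetric trigonometric polynomials -/

theorem IsRootBasis.antisymm_eq_zero (h : IsRootBasis α) {f : TrigPoly n}
    (hf : ∀ i x, evalAt (simpleRefl α i x) f = -evalAt x f)
    (htop : ∀ μ, f.coeff μ ≠ 0 → rho α - μ ∈ posCone α) (h0 : f.coeff (rho α) = 0) : f = 0 := by
  by_contra hne
  have hcoeff : ∀ i μ, f.coeff (simpleRefl α i μ) = -f.coeff μ := fun i μ => by
    rw [coeff_of_evalAt_map (c := -1) (fun x => by rw [hf]; ring), neg_one_mul]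
  have hsupp : f.coeff.support.Nonempty := by
    rw [Finsupp.support_nonempty_iff, Ne, AddMonoidAlgebra.coeff_eq_zero]; exact hne
  obtain ⟨μ, hμ, hmax⟩ := Finset.exists_max_image _ (height α) hsupp
  rw [Finsupp.mem_support_iff] at hμ
  have hw : IsWeight α μ := by
    rw [← sub_sub_cancel (rho α) μ]
    exact isDominant_rho.isWeight.sub (h.isWeight_of_mem (posCone_le (htop μ hμ)))
  have hpos : ∀ i, 0 ≤ inner ℝ (μ - rho α) (coroot α i) := by
    intro i
    obtain ⟨k, hk⟩ := hw i
    rw [inner_sub_left, inner_rho_coroot, hk]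
    have h1 := hmax (simpleRefl α i μ)
      (Finsupp.mem_support_iff.2 (by rw [hcoeff]; exact neg_ne_zero.2 hμ))
    rw [height_simpleRefl, hk] at h1
    have h2 : 0 ≤ k := by
      have : (0 : ℝ) ≤ k := by linarith
      exact_mod_cast this
    have h3 : k ≠ 0 := by
      rintro rfl
      have h4 := hcoeff i μ
      rw [simpleRefl_apply, hk, Int.cast_zero, zero_smul, sub_zero] at h4
      exact hμ (self_eq_neg.1 h4)
    have : (1 : ℝ) ≤ k := by exact_mod_cast (show 1 ≤ k by omega)
    linarith
  rw [eq_rho (htop μ hμ) hpos] at hμ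
  exact hμ h0

theorem IsRootBasis.antisymm_ext (h : IsRootBasis α) {f g : TrigPoly n} {c : ℂ}
    (hf : ∀ i x, evalAt (simpleRefl α i x) f = -evalAt x f)
    (hg : ∀ i x, evalAt (simpleRefl α i x) g = -evalAt x g)
    (hf' : HasTop α f (rho α) c) (hg' : HasTop α g (rho α) c) : f = g := by
  refine sub_eq_zero.1 (h.antisymm_eq_zero (fun i x => ?_) (fun μ hμ => ?_) ?_)
  · rw [map_sub, map_sub, hf, hg]; ring
  · by_contra hcon
    refine hμ ?_
    rw [AddMonoidAlgebra.coeff_sub, Finsupp.sub_apply, not_not.1 (mt (hf'.2 μ) hcon),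
      not_not.1 (mt (hg'.2 μ) hcon), sub_zero]
  · rw [AddMonoidAlgebra.coeff_sub, Finsupp.sub_apply, hf'.1, hg'.1, sub_self]

/-- The Weyl denominator. -/
def IsRootBasis.denominator (h : IsRootBasis α) : TrigPoly n :=
  AddMonoidAlgebra.single (rho α) 1 *
    ∏ β ∈ h.posRoots, (1 - AddMonoidAlgebra.single (-β) 1)

theorem IsRootBasis.evalAt_denominator (h : IsRootBasis α) (x : Eucl n) :
    evalAt x h.denominator = chr (rho α) x * ∏ β ∈ h.posRoots, (1 - chr (-β) x) := by
  simp [IsRootBasis.denominator]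

theorem IsRootBasis.isTop_denominator (h : IsRootBasis α) : IsTop α h.denominator (rho α) := by
  classical
  have h1 : IsTop α (∏ β ∈ h.posRoots, (1 - AddMonoidAlgebra.single (-β) (1 : ℂ)))
      (∑ _β ∈ h.posRoots, (0 : Eucl n)) := by
    refine IsTop.prod _ fun β hβ => ?_
    obtain ⟨h2, h3⟩ := h.mem_posRoots.1 hβ
    have h4 : -β ≠ 0 := neg_ne_zero.2 (root_ne_zero h2)
    refine ⟨?_, fun μ hμ => ?_⟩
    · rw [AddMonoidAlgebra.coeff_sub, Finsupp.sub_apply, AddMonoidAlgebra.one_def,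
        AddMonoidAlgebra.coeff_single, Finsupp.single_apply, AddMonoidAlgebra.coeff_single,
        Finsupp.single_apply, if_pos rfl,
        if_neg h4, sub_zero]
    · rw [AddMonoidAlgebra.coeff_sub, Finsupp.sub_apply, AddMonoidAlgebra.one_def,
        AddMonoidAlgebra.coeff_single, Finsupp.single_apply, AddMonoidAlgebra.coeff_single,
        Finsupp.single_apply] at hμ
      by_cases h5 : (0 : Eucl n) = μ
      · rw [← h5, sub_self]; exact zero_mem _
      · by_cases h6 : -β = μ
        · rw [← h6, zero_sub, neg_neg]; exact h3
        · rw [if_neg h5, if_neg h6, sub_zero] at hμ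
          exact absurd rfl hμ
  rw [Finset.sum_const_zero] at h1
  have h2 := (isTop_single (α := α) (rho α)).mul h1
  rw [add_zero] at h2
  exact h2

theorem IsRootBasis.denominator_antisymm (h : IsRootBasis α) (i : Fin n) (x : Eucl n) :
    evalAt (simpleRefl α i x) h.denominator = -evalAt x h.denominator := by
  classical
  rw [h.evalAt_denominator, h.evalAt_denominator]
  simp only [chr_simpleRefl, map_neg]
  rw [← Finset.mul_prod_erase _ _ (h.simple_mem_posRoots i),
    ← Finset.mul_prod_erase _ _ (h.simple_mem_posRoots i),
    h.prod_erase_simpleRefl i fun β => 1 - chr (-β) x, simpleRefl_self, simpleRefl_apply,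
    inner_rho_coroot, one_smul, chr_sub_left, neg_neg, chr_neg_left]
  have := chr_ne_zero (α i) x
  field_simp
  ring

theorem IsRootBasis.denominator_ne_zero (h : IsRootBasis α) {x : Eucl n}
    (hx : ∀ β ∈ h.posRoots, ∀ k : ℤ, inner ℝ β x ≠ k) : evalAt x h.denominator ≠ 0 := by
  rw [h.evalAt_denominator]
  refine mul_ne_zero (chr_ne_zero _ _) (Finset.prod_ne_zero_iff.2 fun β hβ h0 => ?_)
  obtain ⟨k, hk⟩ := chr_eq_one_iff.1 (sub_eq_zero.1 h0).symm
  refine hx β hβ (-k) ?_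
  rw [inner_neg_left] at hk
  push_cast; linarith

/-! ### The orbit functions as trigonometric polynomials -/

/-- The elements of the Weyl group. -/
def IsRootBasis.weylFinset (h : IsRootBasis α) : Finset (Eucl n ≃ₗᵢ[ℝ] Eucl n) :=
  h.finite_weylGroup.toFinset

theorem IsRootBasis.mem_weylFinset (h : IsRootBasis α) {w : Eucl n ≃ₗᵢ[ℝ] Eucl n} :
    w ∈ h.weylFinset ↔ w ∈ weylGroup α := by
  simp [IsRootBasis.weylFinset]

/-- The determinant of an isometry. -/
def isoDet (w : Eucl n ≃ₗᵢ[ℝ] Eucl n) : ℝ :=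
  LinearMap.det (w.toLinearEquiv : Eucl n →ₗ[ℝ] Eucl n)

theorem isoDet_mul (w w' : Eucl n ≃ₗᵢ[ℝ] Eucl n) : isoDet (w * w') = isoDet w * isoDet w' :=
  LinearMap.det_comp _ _

theorem isoDet_one : isoDet (1 : Eucl n ≃ₗᵢ[ℝ] Eucl n) = 1 := LinearMap.det_id

theorem isoDet_simpleRefl (i : Fin n) : isoDet (simpleRefl α i) = -1 := by
  have h1 := Submodule.det_reflection (ℝ ∙ α i)ᗮ
  rw [Submodule.orthogonal_orthogonal, finrank_span_singleton (α.ne_zero i), pow_one] at h1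
  exact h1

/-- `S_ρ` as a trigonometric polynomial. -/
def IsRootBasis.polyS (h : IsRootBasis α) : TrigPoly n :=
  ∑ w ∈ h.weylFinset, AddMonoidAlgebra.single (w (rho α)) (isoDet w : ℂ)

theorem IsRootBasis.evalAt_polyS (h : IsRootBasis α) (x : Eucl n) :
    evalAt x h.polyS = orbitSRho α x := by
  rw [orbitSRho, IsRootBasis.polyS, map_sum]
  refine Eq.trans ?_ (finsum_mem_eq_finite_toFinset_sum _ h.finite_weylGroup).symm
  refine Finset.sum_congr rfl fun w _ => ?_
  rw [evalAt_single]; rfl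

theorem IsRootBasis.polyS_antisymm (h : IsRootBasis α) (i : Fin n) (x : Eucl n) :
    evalAt (simpleRefl α i x) h.polyS = -evalAt x h.polyS := by
  simp only [IsRootBasis.polyS, map_sum, evalAt_single, chr_simpleRefl]
  rw [← Finset.sum_neg_distrib]
  refine Finset.sum_nbij' (simpleRefl α i * ·) (simpleRefl α i * ·) ?_ ?_ ?_ ?_ ?_
  · exact fun w hw => h.mem_weylFinset.2 (mul_mem (simpleRefl_mem α i) (h.mem_weylFinset.1 hw))
  · exact fun w hw => h.mem_weylFinset.2 (mul_mem (simpleRefl_mem α i) (h.mem_weylFinset.1 hw))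
  · intro w _; rw [← mul_assoc, simpleRefl_mul_self, one_mul]
  · intro w _; rw [← mul_assoc, simpleRefl_mul_self, one_mul]
  · intro w _
    rw [isoDet_mul, isoDet_simpleRefl]
    change _ = -(((-1 * isoDet w : ℝ) : ℂ) * chr (simpleRefl α i (w (rho α))) x)
    push_cast
    ring

theorem IsRootBasis.isTop_polyS (h : IsRootBasis α) : IsTop α h.polyS (rho α) := by
  classical
  have hc : ∀ μ, h.polyS.coeff μ =
      ∑ w ∈ h.weylFinset, if w (rho α) = μ then (isoDet w : ℂ) else 0 := fun μ => by
    rw [IsRootBasis.polyS, AddMonoidAlgebra.coeff_sum, Finset.sum_apply']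
    exact Finset.sum_congr rfl fun w _ => by
      rw [AddMonoidAlgebra.coeff_single, Finsupp.single_apply]
  refine ⟨?_, fun μ hμ => ?_⟩
  · rw [hc, Finset.sum_eq_single 1]
    · rw [if_pos (show (1 : Eucl n ≃ₗᵢ[ℝ] Eucl n) (rho α) = rho α from rfl), isoDet_one, Complex.ofReal_one]
    · intro w hw hw1
      refine if_neg fun he => hw1 ?_
      exact h.stabilizer_trivial (fun i => ⟨0, by rw [inner_rho_coroot]; simp⟩)
        (h.mem_weylFinset.1 hw) he
    · exact fun h1 => absurd (h.mem_weylFinset.2 (one_mem _)) h1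
  · rw [hc] at hμ
    obtain ⟨w, hw, hwμ⟩ := Finset.exists_ne_zero_of_sum_ne_zero hμ
    have : w (rho α) = μ := by
      by_contra hne
      exact hwμ (if_neg hne)
    rw [← this]
    exact h.sub_weyl_mem_posCone isDominant_rho (h.mem_weylFinset.1 hw)

theorem IsRootBasis.denominator_eq (h : IsRootBasis α) : h.denominator = h.polyS :=
  h.antisymm_ext h.denominator_antisymm h.polyS_antisymm h.isTop_denominator h.isTop_polyS

/-! ### Symmetric trigonometric polynomials -/

theorem inner_weight_highestRoot (l : Fin n →₀ ℕ) :
    inner ℝ (weight α l) (highestRoot (coroot α)) = mDegree α l := by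
  rw [highestRoot, inner_sum, mDegree, Finsupp.weight_apply,
    Finsupp.sum_fintype l (fun i c => c • dualMarks α i) (fun _ => zero_smul ℕ _)]
  push_cast
  refine Finset.sum_congr rfl fun i _ => ?_
  rw [real_inner_smul_right, inner_weight_coroot, dualMarks, smul_eq_mul, Nat.cast_mul, mul_comm]

theorem IsRootBasis.inner_highestRoot_le (h : IsRootBasis α) (hn : 0 < n) {u v : Eucl n}
    (huv : u - v ∈ posCone α) :
    inner ℝ v (highestRoot (coroot α)) ≤ inner ℝ u (highestRoot (coroot α)) := by
  rw [← sub_nonneg, ← inner_sub_left, real_inner_comm]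
  refine inner_nonneg_of_dominant (fun i => ?_) huv
  exact inner_nonneg_iff_coroot.1 (h.dual.highestRoot_dominant hn i)

/-- The symmetric trigonometric polynomials whose exponents are weights, of `m`-degree at most
`M`. -/
def symmBelow (α : Basis (Fin n) ℝ (Eucl n)) (M : ℕ) : Submodule ℂ (TrigPoly n) where
  carrier := {f | (∀ i x, evalAt (simpleRefl α i x) f = evalAt x f) ∧
    ∀ μ, f.coeff μ ≠ 0 → IsWeight α μ ∧ inner ℝ μ (highestRoot (coroot α)) ≤ M}
  add_mem' {f g} hf hg := ⟨fun i x => by rw [map_add, map_add, hf.1, hg.1], fun μ hμ => by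
    rw [AddMonoidAlgebra.coeff_add, Finsupp.add_apply] at hμ
    by_cases h0 : f.coeff μ = 0
    · exact hg.2 μ fun h1 => hμ (by rw [h0, h1, add_zero])
    · exact hf.2 μ h0⟩
  zero_mem' := ⟨fun i x => by rw [map_zero, map_zero], fun μ hμ => by simp at hμ⟩
  smul_mem' c f hf := ⟨fun i x => by rw [map_smul, map_smul, hf.1], fun μ hμ => by
    rw [AddMonoidAlgebra.coeff_smul, Finsupp.smul_apply] at hμ
    exact hf.2 μ fun h0 => hμ (by rw [h0, smul_zero])⟩

theorem coeff_simpleRefl_of_symm {f : TrigPoly n} {i : Fin n}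
    (hf : ∀ x, evalAt (simpleRefl α i x) f = evalAt x f) (μ : Eucl n) :
    f.coeff (simpleRefl α i μ) = f.coeff μ := by
  rw [coeff_of_evalAt_map (c := 1) (fun x => by rw [hf, one_mul]), one_mul]

theorem isDominant_of_maximal {f : TrigPoly n} (hf : ∀ i x, evalAt (simpleRefl α i x) f = evalAt x f)
    {μ : Eucl n} (hμ : f.coeff μ ≠ 0) (hw : IsWeight α μ)
    (hmax : ∀ ν, f.coeff ν ≠ 0 → height α ν ≤ height α μ) : IsDominant α μ := by
  refine hw.isDominant fun i => ?_
  have := hmax (simpleRefl α i μ) (by rwa [coeff_simpleRefl_of_symm (hf i)])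
  rw [height_simpleRefl] at this
  linarith

theorem symm_eq_zero {M : ℕ} {f : TrigPoly n} (hf : f ∈ symmBelow α M)
    (h0 : ∀ l, f.coeff (weight α l) = 0) : f = 0 := by
  by_contra hne
  have hsupp : f.coeff.support.Nonempty := by
    rw [Finsupp.support_nonempty_iff, Ne, AddMonoidAlgebra.coeff_eq_zero]; exact hne
  obtain ⟨μ, hμ, hmax⟩ := Finset.exists_max_image _ (height α) hsupp
  rw [Finsupp.mem_support_iff] at hμ
  obtain ⟨l, rfl⟩ := (isDominant_of_maximal hf.1 hμ (hf.2 μ hμ).1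
    fun ν hν => hmax ν (Finsupp.mem_support_iff.2 hν)).exists_weight
  exact hμ (h0 l)

open Classical in
/-- The orbit of a vector. -/
def IsRootBasis.orbitFinset (h : IsRootBasis α) (v : Eucl n) : Finset (Eucl n) :=
  h.weylFinset.image fun w => w v

theorem IsRootBasis.mem_orbitFinset (h : IsRootBasis α) {u v : Eucl n} :
    u ∈ h.orbitFinset v ↔ u ∈ orbit α v := by
  simp [IsRootBasis.orbitFinset, orbit, h.mem_weylFinset]

theorem simpleRefl_mem_orbit {u v : Eucl n} (hu : u ∈ orbit α v) (i : Fin n) :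
    simpleRefl α i u ∈ orbit α v := by
  obtain ⟨w, hw, rfl⟩ := hu
  exact ⟨simpleRefl α i * w, mul_mem (simpleRefl_mem α i) hw, rfl⟩

/-- `C_λ` as a trigonometric polynomial. -/
def IsRootBasis.polyC (h : IsRootBasis α) (l : Fin n →₀ ℕ) : TrigPoly n :=
  ∑ ν ∈ h.orbitFinset (weight α l), AddMonoidAlgebra.single ν 1

theorem IsRootBasis.evalAt_polyC' (h : IsRootBasis α) (l : Fin n →₀ ℕ) (x : Eucl n) :
    evalAt x (h.polyC l) = ∑ ν ∈ h.orbitFinset (weight α l), chr ν x := by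
  rw [IsRootBasis.polyC, map_sum]
  exact Finset.sum_congr rfl fun ν _ => by rw [evalAt_single, one_mul]

theorem IsRootBasis.evalAt_polyC (h : IsRootBasis α) (l : Fin n →₀ ℕ) (x : Eucl n) :
    evalAt x (h.polyC l) = orbitC α l x := by
  rw [h.evalAt_polyC', orbitC,
    finsum_mem_eq_sum_of_inter_support_eq (t := h.orbitFinset (weight α l)) _
      (by congr 1; ext ν; exact (h.mem_orbitFinset).symm)]
  rfl

theorem IsRootBasis.coeff_polyC (h : IsRootBasis α) (l : Fin n →₀ ℕ) (μ : Eucl n) [Decidable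
    (μ ∈ orbit α (weight α l))] :
    (h.polyC l).coeff μ = if μ ∈ orbit α (weight α l) then 1 else 0 := by
  classical
  rw [IsRootBasis.polyC, AddMonoidAlgebra.coeff_sum, Finset.sum_apply']
  simp only [AddMonoidAlgebra.coeff_single, Finsupp.single_apply, Finset.sum_ite_eq',
    h.mem_orbitFinset]

theorem IsRootBasis.polyC_symm (h : IsRootBasis α) (l : Fin n →₀ ℕ) (i : Fin n) (x : Eucl n) :
    evalAt (simpleRefl α i x) (h.polyC l) = evalAt x (h.polyC l) := by
  rw [h.evalAt_polyC', h.evalAt_polyC']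
  simp only [chr_simpleRefl]
  have h1 : ∀ ν ∈ h.orbitFinset (weight α l), simpleRefl α i ν ∈ h.orbitFinset (weight α l) :=
    fun ν hν => h.mem_orbitFinset.2 (simpleRefl_mem_orbit (h.mem_orbitFinset.1 hν) i)
  exact Finset.sum_nbij' (simpleRefl α i) (simpleRefl α i) h1 h1
    (fun _ _ => simpleRefl_simpleRefl α i _) (fun _ _ => simpleRefl_simpleRefl α i _)
    fun _ _ => rfl

theorem IsRootBasis.isTop_polyC (h : IsRootBasis α) (l : Fin n →₀ ℕ) :
    IsTop α (h.polyC l) (weight α l) := by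
  classical
  refine ⟨?_, fun μ hμ => ?_⟩
  · rw [h.coeff_polyC, if_pos]
    exact ⟨1, one_mem _, rfl⟩
  · rw [h.coeff_polyC] at hμ
    obtain ⟨w, hw, rfl⟩ : μ ∈ orbit α (weight α l) := by
      by_contra hcon
      exact hμ (if_neg hcon)
    exact h.sub_weyl_mem_posCone (isDominant_weight l) hw

theorem IsRootBasis.mem_symmBelow_of_isTop (h : IsRootBasis α) (hn : 0 < n) {f : TrigPoly n}
    (hf : ∀ i x, evalAt (simpleRefl α i x) f = evalAt x f) {l : Fin n →₀ ℕ}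
    (ht : IsTop α f (weight α l)) {M : ℕ} (hM : mDegree α l ≤ M) : f ∈ symmBelow α M := by
  refine ⟨hf, fun μ hμ => ⟨?_, ?_⟩⟩
  · rw [← sub_sub_cancel (weight α l) μ]
    exact (isWeight_weight l).sub (h.isWeight_of_mem (posCone_le (ht.2 μ hμ)))
  · refine (h.inner_highestRoot_le hn (ht.2 μ hμ)).trans ?_
    rw [inner_weight_highestRoot]
    exact_mod_cast hM

theorem IsRootBasis.polyC_mem (h : IsRootBasis α) (hn : 0 < n) {l : Fin n →₀ ℕ} {M : ℕ}
    (hM : mDegree α l ≤ M) : h.polyC l ∈ symmBelow α M :=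
  h.mem_symmBelow_of_isTop hn (h.polyC_symm l) (h.isTop_polyC l) hM

theorem IsRootBasis.finite_weightsUpTo (h : IsRootBasis α) (hn : 0 < n) (M : ℕ) :
    (weightsUpTo α M).Finite := by
  refine (Finsupp.finite_of_degree_le (σ := Fin n) M).subset fun l hl => ?_
  refine le_trans ?_ (show mDegree α l ≤ M from hl)
  rw [mDegree, Finsupp.weight_apply, Finsupp.sum, Finsupp.degree_apply]
  refine Finset.sum_le_sum fun i _ => ?_
  rw [smul_eq_mul]
  exact Nat.le_mul_of_pos_right _ (h.dual.marks_pos hn i)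

theorem IsRootBasis.weight_mem_orbit_iff (h : IsRootBasis α) {l l' : Fin n →₀ ℕ} :
    weight α l ∈ orbit α (weight α l') ↔ l = l' := by
  refine ⟨fun ⟨w, hw, he⟩ => ?_, fun he => he ▸ ⟨1, one_mem _, rfl⟩⟩
  exact (weight_injective (h.eq_of_dominant (isDominant_weight l') (isDominant_weight l) hw he)).symm

theorem IsRootBasis.eq_sum_polyC (h : IsRootBasis α) (hn : 0 < n) {M : ℕ} {f : TrigPoly n}
    (hf : f ∈ symmBelow α M) :
    f = ∑ l ∈ (h.finite_weightsUpTo hn M).toFinset, f.coeff (weight α l) • h.polyC l := by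
  classical
  refine sub_eq_zero.1 (symm_eq_zero (α := α) (M := M) (sub_mem hf (sum_mem fun l hl =>
    Submodule.smul_mem _ _ (h.polyC_mem hn ?_))) fun l => ?_)
  · simpa [weightsUpTo] using hl
  · rw [AddMonoidAlgebra.coeff_sub, Finsupp.sub_apply, AddMonoidAlgebra.coeff_sum,
      Finset.sum_apply']
    simp only [AddMonoidAlgebra.coeff_smul, Finsupp.smul_apply, h.coeff_polyC,
      h.weight_mem_orbit_iff, smul_eq_mul, mul_ite, mul_one, mul_zero, Finset.sum_ite_eq,
      Set.Finite.mem_toFinset]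
    split_ifs with h1
    · exact sub_self _
    · rw [sub_zero]
      by_contra h2
      have := (hf.2 _ h2).2
      rw [inner_weight_highestRoot] at this
      exact h1 (by exact_mod_cast this : mDegree α l ≤ M)

/-! ### Polynomials in the fundamental orbit functions -/

/-- `Z_j` as a trigonometric polynomial. -/
def IsRootBasis.polyZ (h : IsRootBasis α) (j : Fin n) : TrigPoly n :=
  h.polyC (Finsupp.single j 1)

theorem IsRootBasis.evalAt_polyZ (h : IsRootBasis α) (j : Fin n) (x : Eucl n) :
    evalAt x (h.polyZ j) = orbitZ α j x := h.evalAt_polyC _ x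

/-- Substitution of the `Z_j` in a polynomial. -/
def IsRootBasis.evalZ (h : IsRootBasis α) : MvPolynomial (Fin n) ℂ →ₐ[ℂ] TrigPoly n :=
  MvPolynomial.aeval h.polyZ

theorem IsRootBasis.evalZ_X (h : IsRootBasis α) (j : Fin n) :
    h.evalZ (MvPolynomial.X j) = h.polyZ j := MvPolynomial.aeval_X _ _

theorem IsRootBasis.evalAt_evalZ (h : IsRootBasis α) (x : Eucl n) (q : MvPolynomial (Fin n) ℂ) :
    evalAt x (h.evalZ q) = MvPolynomial.aeval (fun j => evalAt x (h.polyZ j)) q := by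
  rw [IsRootBasis.evalZ, ← AlgHom.comp_apply, MvPolynomial.comp_aeval]

theorem IsRootBasis.evalZ_symm (h : IsRootBasis α) (q : MvPolynomial (Fin n) ℂ) (i : Fin n)
    (x : Eucl n) : evalAt (simpleRefl α i x) (h.evalZ q) =
      evalAt x (h.evalZ q) := by
  rw [h.evalAt_evalZ, h.evalAt_evalZ]
  simp only [IsRootBasis.polyZ, h.polyC_symm]

theorem IsRootBasis.isTop_monomial (h : IsRootBasis α) (l : Fin n →₀ ℕ) :
    IsTop α (h.evalZ (MvPolynomial.monomial l 1)) (weight α l) := by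
  rw [IsRootBasis.evalZ, MvPolynomial.aeval_monomial, map_one, one_mul, weight_eq_sum,
    Finsupp.prod_fintype _ _ fun i => pow_zero _]
  refine IsTop.prod _ fun i _ => IsTop.pow ?_ _
  rw [← weight_single]
  exact h.isTop_polyC _

theorem mem_polysUpTo {M : ℕ} {q : MvPolynomial (Fin n) ℂ} :
    q ∈ polysUpTo α M ↔ ∀ l ∈ q.support, mDegree α l ≤ M := by
  simp only [polysUpTo, MvPolynomial.weightedTotalDegree, Set.mem_ofPred_eq, Finset.sup_le_iff]
  rfl

/-- `Π_M` as a subspace. -/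
def polysBelow (α : Basis (Fin n) ℝ (Eucl n)) (M : ℕ) : Submodule ℂ (MvPolynomial (Fin n) ℂ) where
  carrier := polysUpTo α M
  add_mem' {p q} hp hq := by
    classical
    rw [mem_polysUpTo] at *
    intro l hl
    rcases Finset.mem_union.1 (MvPolynomial.support_add hl) with h | h
    · exact hp l h
    · exact hq l h
  zero_mem' := mem_polysUpTo.2 (by simp)
  smul_mem' c p hp := by
    rw [mem_polysUpTo] at *
    exact fun l hl => hp l (MvPolynomial.support_smul hl)

theorem monomial_mem_polysBelow {M : ℕ} {l : Fin n →₀ ℕ} (hl : mDegree α l ≤ M) (c : ℂ) :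
    MvPolynomial.monomial l c ∈ polysBelow α M := by
  classical
  refine mem_polysUpTo.2 fun l' hl' => ?_
  rw [Finset.mem_singleton.1 (MvPolynomial.support_monomial_subset hl')]
  exact hl

theorem IsRootBasis.evalZ_mem (h : IsRootBasis α) (hn : 0 < n) {M : ℕ}
    {q : MvPolynomial (Fin n) ℂ} (hq : q ∈ polysUpTo α M) :
    h.evalZ q ∈ symmBelow α M := by
  rw [q.as_sum, map_sum]
  refine sum_mem fun l hl => ?_
  rw [← mul_one (q.coeff l), ← smul_eq_mul, ← MvPolynomial.smul_monomial, map_smul]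
  exact Submodule.smul_mem _ _ (h.mem_symmBelow_of_isTop hn (h.evalZ_symm _)
    (h.isTop_monomial l) (mem_polysUpTo.1 hq l hl))

theorem IsRootBasis.evalZ_injective (h : IsRootBasis α) :
    Function.Injective h.evalZ := by
  rw [injective_iff_map_eq_zero]
  intro q hq
  by_contra hne
  obtain ⟨l, hl, hmax⟩ := Finset.exists_max_image _ (fun l => height α (weight α l))
    (MvPolynomial.support_nonempty.2 hne)
  rw [q.as_sum, map_sum] at hq
  have h1 := congrArg (fun f : TrigPoly n => f.coeff (weight α l)) hq
  simp only [AddMonoidAlgebra.coeff_sum, Finset.sum_apply'] at h1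
  rw [Finset.sum_eq_single l] at h1
  · rw [← mul_one (q.coeff l), ← smul_eq_mul, ← MvPolynomial.smul_monomial, map_smul,
      AddMonoidAlgebra.coeff_smul, Finsupp.smul_apply, (h.isTop_monomial l).1] at h1
    simp at h1
    exact (MvPolynomial.mem_support_iff.1 hl) h1
  · intro l' hl' hne'
    rw [← mul_one (q.coeff l'), ← smul_eq_mul, ← MvPolynomial.smul_monomial, map_smul,
      AddMonoidAlgebra.coeff_smul, Finsupp.smul_apply]
    by_contra h2
    have h3 := (h.isTop_monomial l').2 (weight α l) fun h0 => h2 (by rw [h0, smul_zero])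
    exact hne' (weight_injective (eq_of_height_eq h3 (hmax l' hl')))
  · exact fun h2 => absurd hl h2

theorem IsRootBasis.exists_evalZ (h : IsRootBasis α) (hn : 0 < n) {M : ℕ} (d : ℕ) :
    ∀ f ∈ symmBelow α M, (∀ μ, f.coeff μ ≠ 0 → 2 * height α μ < d) →
      ∃ q ∈ polysUpTo α M, h.evalZ q = f := by
  classical
  induction d with
  | zero =>
    intro f hf hd
    refine ⟨0, (polysBelow α M).zero_mem, ?_⟩
    rw [map_zero]
    refine (symm_eq_zero hf fun l => ?_).symm
    by_contra h0
    have h1 := hd _ h0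
    have h2 := h.height_nonneg_of_dominant (isDominant_weight l)
    rw [Nat.cast_zero] at h1
    linarith
  | succ d ih =>
    intro f hf hd
    set D := (h.finite_weightsUpTo hn M).toFinset.filter
      fun l => 2 * height α (weight α l) = d with hD
    set r : MvPolynomial (Fin n) ℂ :=
      ∑ l ∈ D, f.coeff (weight α l) • MvPolynomial.monomial l 1 with hr
    have hrM : r ∈ polysBelow α M := sum_mem fun l hl => Submodule.smul_mem _ _
      (monomial_mem_polysBelow (by simpa [weightsUpTo] using (Finset.mem_filter.1 hl).1) 1)
    have hmax : ∀ μ, f.coeff μ ≠ 0 → 2 * height α μ ≤ d := fun μ hμ => by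
      obtain ⟨k, hk⟩ := h.two_mul_height_int (hf.2 μ hμ).1
      have := hd μ hμ
      rw [hk] at this ⊢
      have : k < (d + 1 : ℕ) := by exact_mod_cast this
      exact_mod_cast (show k ≤ (d : ℤ) by push_cast at this; omega)
    obtain ⟨q, hq, hqf⟩ := ih (f - h.evalZ r)
      (sub_mem hf (h.evalZ_mem hn hrM)) fun μ hμ => by
        by_contra hlt
        push Not at hlt
        refine hμ ?_
        have h1 : (h.evalZ r).coeff μ =
            ∑ l ∈ D, if weight α l = μ then f.coeff (weight α l) else 0 := by
          rw [hr, map_sum, AddMonoidAlgebra.coeff_sum, Finset.sum_apply']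
          refine Finset.sum_congr rfl fun l hl => ?_
          rw [map_smul, AddMonoidAlgebra.coeff_smul, Finsupp.smul_apply, smul_eq_mul]
          split_ifs with he
          · rw [← he, (h.isTop_monomial l).1, mul_one]
          · refine mul_eq_zero_of_right _ ?_
            by_contra h0
            refine he (eq_of_height_eq ((h.isTop_monomial l).2 μ h0) ?_)
            have := (Finset.mem_filter.1 hl).2
            linarith
        rw [AddMonoidAlgebra.coeff_sub, Finsupp.sub_apply, h1]
        by_cases h0 : f.coeff μ = 0
        · rw [h0, zero_sub, neg_eq_zero]
          refine Finset.sum_eq_zero fun l _ => ?_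
          split_ifs with he
          · rw [he, h0]
          · rfl
        · have h2 := hmax μ h0
          obtain ⟨l, rfl⟩ := (isDominant_of_maximal hf.1 h0 (hf.2 μ h0).1 fun ν hν => by
            have := hmax ν hν
            linarith).exists_weight
          have hl : l ∈ D := by
            refine Finset.mem_filter.2 ⟨?_, le_antisymm h2 hlt⟩
            have := (hf.2 _ h0).2
            rw [inner_weight_highestRoot] at this
            simpa [weightsUpTo] using (by exact_mod_cast this : mDegree α l ≤ M)
          rw [Finset.sum_eq_single l (fun l' _ hne => if_neg fun he => hne (weight_injective he))
            (fun h3 => absurd hl h3), if_pos rfl, sub_self]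
    exact ⟨q + r, (polysBelow α M).add_mem hq hrM, by rw [map_add, hqf, sub_add_cancel]⟩

theorem IsRootBasis.exists_poly_of_mem (h : IsRootBasis α) (hn : 0 < n) {M : ℕ} {f : TrigPoly n}
    (hf : f ∈ symmBelow α M) : ∃ q ∈ polysUpTo α M, h.evalZ q = f := by
  obtain ⟨B, hB⟩ := (f.coeff.support.image fun μ => 2 * height α μ).exists_le
  obtain ⟨d, hd⟩ := exists_nat_gt B
  exact h.exists_evalZ hn d f hf fun μ hμ => (hB _ (Finset.mem_image_of_mem _
    (Finsupp.mem_support_iff.2 hμ))).trans_lt hd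

/-! ### The transform `X` -/

/-- An element of the Weyl group that acts as `-1` up to the pairing of indices. -/
theorem IsSimpleRoots.exists_neg {T : SimpleType n} (hα : IsSimpleRoots T α) :
    ∃ w ∈ weylGroup α, (∀ i, w (coroot α i) = -coroot α (T.partner i)) ∧
      ∀ i, w (fundWeight α i) = -fundWeight α (T.partner i) := by
  obtain ⟨w, hw, σ, hσ, hT⟩ := hα.exists_longest
  have hco : ∀ i, w (coroot α i) = -coroot α (σ i) := fun i => by
    rw [coroot_apply, coroot_apply, map_smul, hσ, smul_neg,
      ← LinearIsometryEquiv.inner_map_map w (α i), hσ, inner_neg_neg]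
  refine ⟨w, hw, fun i => by rw [hco, hT], fun j => ext_inner_coroot (α := α) fun k => ?_⟩
  obtain ⟨l, rfl⟩ := σ.surjective k
  have h1 : inner ℝ (w (fundWeight α j)) (w (coroot α l)) = inner ℝ (fundWeight α j) (coroot α l) :=
    LinearIsometryEquiv.inner_map_map w _ _
  rw [hco, inner_neg_right, inner_fundWeight_coroot] at h1
  rw [inner_neg_left, ← hT, inner_fundWeight_coroot, ← neg_neg (inner ℝ (w _) _), h1]
  simp

theorem IsSimpleRoots.dualMarks_partner {T : SimpleType n} (hα : IsSimpleRoots T α) (i : Fin n) :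
    dualMarks α (T.partner i) = dualMarks α i := by
  obtain ⟨w, hw, hco, -⟩ := hα.exists_neg
  let σ : Equiv.Perm (Fin n) := ⟨T.partner, T.partner, T.partner_partner, T.partner_partner⟩
  exact hα.isRootBasis.dual.marks_eq_of_neg T.rank_pos (σ := σ)
    (by rw [weylGroup_coroot]; exact hw) hco i

theorem IsSimpleRoots.conj_orbitZ {T : SimpleType n} (hα : IsSimpleRoots T α) (j : Fin n)
    (x : Eucl n) : conj (orbitZ α j x) = orbitZ α (T.partner j) x := by
  have h := hα.isRootBasis
  obtain ⟨w, hw, -, hf⟩ := hα.exists_neg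
  rw [← h.evalAt_polyZ, ← h.evalAt_polyZ, IsRootBasis.polyZ, IsRootBasis.polyZ, h.evalAt_polyC',
    h.evalAt_polyC', weight_single, weight_single, map_sum]
  simp only [conj_chr]
  refine Finset.sum_nbij' (fun ν => -ν) (fun ν => -ν) (fun ν hν => ?_) (fun ν hν => ?_)
    (fun _ _ => neg_neg _) (fun _ _ => neg_neg _) fun _ _ => rfl
  · obtain ⟨v, hv, rfl⟩ := h.mem_orbitFinset.1 hν
    refine h.mem_orbitFinset.2 ⟨v * w⁻¹, mul_mem hv (inv_mem hw), ?_⟩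
    rw [← neg_neg (fundWeight α (T.partner j)), ← hf, map_neg]
    change -(v (w⁻¹ (w _))) = _
    congr 2
    exact w.symm_apply_apply _
  · obtain ⟨v, hv, rfl⟩ := h.mem_orbitFinset.1 hν
    refine h.mem_orbitFinset.2 ⟨v * w, mul_mem hv hw, ?_⟩
    change v (w _) = _
    rw [hf, map_neg]

theorem IsSimpleRoots.transformX_eq {T : SimpleType n} (hα : IsSimpleRoots T α) (x : Eucl n)
    (j : Fin n) : ((transformX T α x j : ℝ) : ℂ) = coordX T α j x := by
  change (((coordX T α j x).re : ℝ) : ℂ) = _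
  refine Complex.conj_eq_iff_re.1 ?_
  unfold coordX
  split_ifs with h1 h2
  · rw [hα.conj_orbitZ, h1]
  · rw [map_div₀, map_add, hα.conj_orbitZ, hα.conj_orbitZ, T.partner_partner, add_comm,
      Complex.conj_ofNat]
  · rw [map_div₀, map_sub, hα.conj_orbitZ, hα.conj_orbitZ, T.partner_partner, map_mul,
      Complex.conj_I, ← neg_sub, mul_neg, neg_div_neg_eq, Complex.conj_ofNat]

/-- The expression of `X_j` in the `Z_i`. -/
def SimpleType.xOfZ (T : SimpleType n) (j : Fin n) : MvPolynomial (Fin n) ℂ :=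
  if T.partner j = j then MvPolynomial.X j
  else if j < T.partner j then
    (1 / 2 : ℂ) • (MvPolynomial.X j + MvPolynomial.X (T.partner j))
  else (1 / (2 * Complex.I) : ℂ) • (MvPolynomial.X (T.partner j) - MvPolynomial.X j)

/-- The expression of `Z_j` in the `X_i`. -/
def SimpleType.zOfX (T : SimpleType n) (j : Fin n) : MvPolynomial (Fin n) ℂ :=
  if T.partner j = j then MvPolynomial.X j
  else if j < T.partner j then
    MvPolynomial.X j + Complex.I • MvPolynomial.X (T.partner j)
  else MvPolynomial.X (T.partner j) - Complex.I • MvPolynomial.X j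

theorem SimpleType.bind_zOfX (T : SimpleType n) (q : MvPolynomial (Fin n) ℂ) :
    MvPolynomial.bind₁ T.xOfZ (MvPolynomial.bind₁ T.zOfX q) = q := by
  have hI : (Complex.I * (1 / (2 * Complex.I)) : ℂ) = 1 / 2 := by
    field_simp
  have key : ∀ j, MvPolynomial.bind₁ T.xOfZ (T.zOfX j) = MvPolynomial.X j := fun j => by
    by_cases h1 : T.partner j = j
    · rw [SimpleType.zOfX, if_pos h1, MvPolynomial.bind₁_X_right, SimpleType.xOfZ, if_pos h1]
    · have h1' : T.partner (T.partner j) ≠ T.partner j := by rw [T.partner_partner]; exact Ne.symm h1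
      rcases lt_or_gt_of_ne (Ne.symm h1) with h2 | h2
      · rw [SimpleType.zOfX, if_neg h1, if_pos h2, map_add, map_smul, MvPolynomial.bind₁_X_right,
          MvPolynomial.bind₁_X_right, SimpleType.xOfZ, if_neg h1, if_pos h2, SimpleType.xOfZ,
          if_neg h1', if_neg (by rw [T.partner_partner]; exact h2.not_gt), T.partner_partner,
          smul_smul, hI]
        module
      · rw [SimpleType.zOfX, if_neg h1, if_neg h2.not_gt, map_sub, map_smul,
          MvPolynomial.bind₁_X_right, MvPolynomial.bind₁_X_right, SimpleType.xOfZ, if_neg h1',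
          if_pos (by rwa [T.partner_partner]), SimpleType.xOfZ, if_neg h1, if_neg h2.not_gt,
          T.partner_partner, smul_smul, hI]
        module
  have : (MvPolynomial.bind₁ T.xOfZ).comp (MvPolynomial.bind₁ T.zOfX) = AlgHom.id ℂ _ :=
    MvPolynomial.algHom_ext fun j => by
      rw [AlgHom.comp_apply, MvPolynomial.bind₁_X_right, key]; rfl
  exact DFunLike.congr_fun this q

theorem SimpleType.bind_xOfZ (T : SimpleType n) (q : MvPolynomial (Fin n) ℂ) :
    MvPolynomial.bind₁ T.zOfX (MvPolynomial.bind₁ T.xOfZ q) = q := by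
  have hI : (1 / (2 * Complex.I) * Complex.I : ℂ) = 1 / 2 := by
    field_simp
  have key : ∀ j, MvPolynomial.bind₁ T.zOfX (T.xOfZ j) = MvPolynomial.X j := fun j => by
    by_cases h1 : T.partner j = j
    · rw [SimpleType.xOfZ, if_pos h1, MvPolynomial.bind₁_X_right, SimpleType.zOfX, if_pos h1]
    · have h1' : T.partner (T.partner j) ≠ T.partner j := by rw [T.partner_partner]; exact Ne.symm h1
      rcases lt_or_gt_of_ne (Ne.symm h1) with h2 | h2
      · rw [SimpleType.xOfZ, if_neg h1, if_pos h2, map_smul, map_add, MvPolynomial.bind₁_X_right,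
          MvPolynomial.bind₁_X_right, SimpleType.zOfX, if_neg h1, if_pos h2, SimpleType.zOfX,
          if_neg h1', if_neg (by rw [T.partner_partner]; exact h2.not_gt), T.partner_partner]
        module
      · rw [SimpleType.xOfZ, if_neg h1, if_neg h2.not_gt, map_smul, map_sub,
          MvPolynomial.bind₁_X_right, MvPolynomial.bind₁_X_right, SimpleType.zOfX, if_neg h1',
          if_pos (by rwa [T.partner_partner]), SimpleType.zOfX, if_neg h1, if_neg h2.not_gt,
          T.partner_partner, add_sub_sub_cancel, ← add_smul, smul_smul, ← two_mul,
          show (1 / (2 * Complex.I) * (2 * Complex.I) : ℂ) = 1 by field_simp, one_smul]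
  have : (MvPolynomial.bind₁ T.zOfX).comp (MvPolynomial.bind₁ T.xOfZ) = AlgHom.id ℂ _ :=
    MvPolynomial.algHom_ext fun j => by
      rw [AlgHom.comp_apply, MvPolynomial.bind₁_X_right, key]; rfl
  exact DFunLike.congr_fun this q

theorem bind_mem_polysUpTo {s : Fin n → MvPolynomial (Fin n) ℂ}
    (hs : ∀ j, (s j).IsWeightedHomogeneous (dualMarks α) (dualMarks α j)) {M : ℕ}
    {q : MvPolynomial (Fin n) ℂ} (hq : q ∈ polysUpTo α M) :
    MvPolynomial.bind₁ s q ∈ polysUpTo α M := by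
  rw [q.as_sum, map_sum]
  refine (polysBelow α M).sum_mem fun l hl => ?_
  rw [MvPolynomial.bind₁_monomial, MvPolynomial.C_mul']
  refine Submodule.smul_mem _ _ (mem_polysUpTo.2 fun l' hl' => ?_)
  have h1 := MvPolynomial.IsWeightedHomogeneous.prod l.support (fun i => s i ^ l i)
    (fun i => l i • dualMarks α i) fun i _ => (hs i).pow (l i)
  have h2 : mDegree α l' = mDegree α l := h1 (MvPolynomial.mem_support_iff.1 hl')
  rw [h2]
  exact mem_polysUpTo.1 hq l hl

theorem isWeightedHomogeneous_smul_X {m : Fin n → ℕ} (c : ℂ) {i j : Fin n} (h : m i = m j) :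
    (c • MvPolynomial.X i : MvPolynomial (Fin n) ℂ).IsWeightedHomogeneous m (m j) :=
  (MvPolynomial.weightedHomogeneousSubmodule ℂ m (m j)).smul_mem c
    (h ▸ MvPolynomial.isWeightedHomogeneous_X ℂ m i)

theorem IsSimpleRoots.xOfZ_homogeneous {T : SimpleType n} (hα : IsSimpleRoots T α) (j : Fin n) :
    (T.xOfZ j).IsWeightedHomogeneous (dualMarks α) (dualMarks α j) := by
  have hp := hα.dualMarks_partner j
  unfold SimpleType.xOfZ
  split_ifs with h1 h2
  · exact MvPolynomial.isWeightedHomogeneous_X ℂ _ j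
  · rw [smul_add]
    exact (isWeightedHomogeneous_smul_X _ rfl).add (isWeightedHomogeneous_smul_X _ hp)
  · rw [smul_sub]
    exact (MvPolynomial.weightedHomogeneousSubmodule ℂ _ _).sub_mem
      (isWeightedHomogeneous_smul_X _ hp) (isWeightedHomogeneous_smul_X _ rfl)

theorem IsSimpleRoots.zOfX_homogeneous {T : SimpleType n} (hα : IsSimpleRoots T α) (j : Fin n) :
    (T.zOfX j).IsWeightedHomogeneous (dualMarks α) (dualMarks α j) := by
  have hp := hα.dualMarks_partner j
  unfold SimpleType.zOfX
  split_ifs with h1 h2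
  · exact MvPolynomial.isWeightedHomogeneous_X ℂ _ j
  · exact (MvPolynomial.isWeightedHomogeneous_X ℂ _ j).add (isWeightedHomogeneous_smul_X _ hp)
  · rw [← one_smul ℂ (MvPolynomial.X (T.partner j))]
    exact (MvPolynomial.weightedHomogeneousSubmodule ℂ _ _).sub_mem
      (isWeightedHomogeneous_smul_X _ hp) (isWeightedHomogeneous_smul_X _ rfl)

/-- Substitution of the `X_j` in a polynomial. -/
def IsRootBasis.evalX (h : IsRootBasis α) (T : SimpleType n) :
    MvPolynomial (Fin n) ℂ →ₐ[ℂ] TrigPoly n :=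
  h.evalZ.comp (MvPolynomial.bind₁ T.xOfZ)

theorem IsRootBasis.evalX_injective (h : IsRootBasis α) (T : SimpleType n) :
    Function.Injective (h.evalX T) := fun p q hpq => by
  have := h.evalZ_injective hpq
  rw [← T.bind_xOfZ p, ← T.bind_xOfZ q]
  exact congrArg _ this

theorem IsSimpleRoots.evalX_mem {T : SimpleType n} (hα : IsSimpleRoots T α) {M : ℕ}
    {q : MvPolynomial (Fin n) ℂ} (hq : q ∈ polysUpTo α M) :
    hα.isRootBasis.evalX T q ∈ symmBelow α M :=
  hα.isRootBasis.evalZ_mem T.rank_pos (bind_mem_polysUpTo hα.xOfZ_homogeneous hq)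

theorem IsSimpleRoots.exists_evalX {T : SimpleType n} (hα : IsSimpleRoots T α) {M : ℕ}
    {f : TrigPoly n} (hf : f ∈ symmBelow α M) :
    ∃ q ∈ polysUpTo α M, hα.isRootBasis.evalX T q = f := by
  obtain ⟨q, hq, hqf⟩ := hα.isRootBasis.exists_poly_of_mem T.rank_pos hf
  refine ⟨MvPolynomial.bind₁ T.zOfX q, bind_mem_polysUpTo hα.zOfX_homogeneous hq, ?_⟩
  rw [IsRootBasis.evalX, AlgHom.comp_apply, T.bind_zOfX, hqf]

theorem IsRootBasis.evalAt_xOfZ (h : IsRootBasis α) (T : SimpleType n) (j : Fin n) (x : Eucl n) :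
    evalAt x (h.evalZ (T.xOfZ j)) = coordX T α j x := by
  unfold SimpleType.xOfZ coordX
  split_ifs
  · rw [h.evalZ_X, h.evalAt_polyZ]
  · rw [map_smul, map_smul, map_add, map_add, h.evalZ_X, h.evalZ_X, h.evalAt_polyZ,
      h.evalAt_polyZ, smul_eq_mul, one_div_mul_eq_div]
  · rw [map_smul, map_smul, map_sub, map_sub, h.evalZ_X, h.evalZ_X, h.evalAt_polyZ,
      h.evalAt_polyZ, smul_eq_mul, one_div_mul_eq_div]

theorem IsSimpleRoots.polyFun_transformX {T : SimpleType n} (hα : IsSimpleRoots T α)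
    (q : MvPolynomial (Fin n) ℂ) (x : Eucl n) :
    polyFun q (transformX T α x) = evalAt x (hα.isRootBasis.evalX T q) := by
  have h1 : (evalAt x).comp (hα.isRootBasis.evalX T) =
      MvPolynomial.aeval fun j => ((transformX T α x j : ℝ) : ℂ) :=
    MvPolynomial.algHom_ext fun j => by
      rw [AlgHom.comp_apply, IsRootBasis.evalX, AlgHom.comp_apply, MvPolynomial.bind₁_X_right,
        hα.isRootBasis.evalAt_xOfZ, MvPolynomial.aeval_X, hα.transformX_eq]
  rw [← AlgHom.comp_apply, h1, polyFun, MvPolynomial.aeval_eq_eval]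

theorem IsSimpleRoots.poly_ext {T : SimpleType n} (hα : IsSimpleRoots T α)
    {p q : MvPolynomial (Fin n) ℂ}
    (hpq : ∀ x, polyFun p (transformX T α x) = polyFun q (transformX T α x)) : p = q :=
  hα.isRootBasis.evalX_injective T (evalAt_ext fun x => by
    rw [← hα.polyFun_transformX, ← hα.polyFun_transformX, hpq])

theorem IsSimpleRoots.evalX_of_isCPolys {T : SimpleType n} (hα : IsSimpleRoots T α)
    {p : (Fin n →₀ ℕ) → MvPolynomial (Fin n) ℂ} (hp : IsCPolys T α p) (l : Fin n →₀ ℕ) :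
    hα.isRootBasis.evalX T (p l) = hα.isRootBasis.polyC l :=
  evalAt_ext fun x => by rw [← hα.polyFun_transformX, ← hp, hα.isRootBasis.evalAt_polyC]

theorem IsSimpleRoots.isCPolys_mem {T : SimpleType n} (hα : IsSimpleRoots T α)
    {p : (Fin n →₀ ℕ) → MvPolynomial (Fin n) ℂ} (hp : IsCPolys T α p) {l : Fin n →₀ ℕ} {M : ℕ}
    (hl : mDegree α l ≤ M) : p l ∈ polysUpTo α M := by
  obtain ⟨q, hq, hqf⟩ := hα.exists_evalX (hα.isRootBasis.polyC_mem T.rank_pos hl)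
  rwa [hα.isRootBasis.evalX_injective T ((hα.evalX_of_isCPolys hp l).trans hqf.symm)]

/-- Every polynomial of `m`-degree at most `M` is a combination of the `p_λ`, `λ ∈ P⁺_M`. -/
theorem IsSimpleRoots.eq_sum_isCPolys {T : SimpleType n} (hα : IsSimpleRoots T α)
    {p : (Fin n →₀ ℕ) → MvPolynomial (Fin n) ℂ} (hp : IsCPolys T α p) {M : ℕ}
    {q : MvPolynomial (Fin n) ℂ} (hq : q ∈ polysUpTo α M) :
    ∃ c : (Fin n →₀ ℕ) → ℂ,
      q = ∑ l ∈ (hα.isRootBasis.finite_weightsUpTo T.rank_pos M).toFinset, c l • p l := by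
  refine ⟨fun l => (hα.isRootBasis.evalX T q).coeff (weight α l),
    hα.isRootBasis.evalX_injective T ((hα.isRootBasis.eq_sum_polyC T.rank_pos (hα.evalX_mem hq)).trans ?_)⟩
  rw [map_sum]
  refine Finset.sum_congr rfl fun l _ => ?_
  rw [map_smul, hα.evalX_of_isCPolys hp]

theorem IsSimpleRoots.existsUnique_isCPolys {T : SimpleType n} (hα : IsSimpleRoots T α) :
    ∃! p, IsCPolys T α p := by
  choose p hp hpf using fun l : Fin n →₀ ℕ =>
    hα.exists_evalX (hα.isRootBasis.polyC_mem T.rank_pos (le_refl (mDegree α l)))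
  refine ⟨p, fun l x => ?_, fun p' hp' => funext fun l => hα.isRootBasis.evalX_injective T ?_⟩
  · rw [hα.polyFun_transformX, hpf, hα.isRootBasis.evalAt_polyC]
  · rw [hα.evalX_of_isCPolys hp', hpf]

/-- The complex conjugate of `S_ρ`. -/
def IsRootBasis.polySConj (h : IsRootBasis α) : TrigPoly n :=
  ∑ w ∈ h.weylFinset, AddMonoidAlgebra.single (-w (rho α)) (isoDet w : ℂ)

theorem IsRootBasis.evalAt_polySConj (h : IsRootBasis α) (x : Eucl n) :
    evalAt x h.polySConj = conj (evalAt x h.polyS) := by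
  rw [IsRootBasis.polySConj, IsRootBasis.polyS, map_sum, map_sum, map_sum]
  refine Finset.sum_congr rfl fun w _ => ?_
  rw [evalAt_single, evalAt_single, map_mul, conj_chr, Complex.conj_ofReal]

theorem exists_mem_symmBelow {f : TrigPoly n} (hf : ∀ i x, evalAt (simpleRefl α i x) f = evalAt x f)
    (hw : ∀ μ, f.coeff μ ≠ 0 → IsWeight α μ) : ∃ M, f ∈ symmBelow α M := by
  classical
  obtain ⟨B, hB⟩ := (f.coeff.support.image fun μ =>
    inner ℝ μ (highestRoot (coroot α))).exists_le
  obtain ⟨M, hM⟩ := exists_nat_ge B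
  exact ⟨M, hf, fun μ hμ => ⟨hw μ hμ, (hB _ (Finset.mem_image_of_mem _
    (Finsupp.mem_support_iff.2 hμ))).trans hM⟩⟩

theorem IsRootBasis.exists_normSq_mem (h : IsRootBasis α) :
    ∃ M, h.polyS * h.polySConj ∈ symmBelow α M := by
  classical
  refine exists_mem_symmBelow (fun i x => ?_) fun μ hμ => ?_
  · rw [map_mul, map_mul, h.evalAt_polySConj, h.evalAt_polySConj, h.polyS_antisymm, map_neg,
      neg_mul_neg]
  · have := AddMonoidAlgebra.support_coeff_mul_subset _ _ (Finsupp.mem_support_iff.2 hμ)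
    obtain ⟨a, ha, b, hb, rfl⟩ := Finset.mem_add.1 this
    refine IsWeight.add ?_ ?_
    · rw [← sub_sub_cancel (rho α) a]
      exact isDominant_rho.isWeight.sub (h.isWeight_of_mem
        (posCone_le (h.isTop_polyS.2 a (Finsupp.mem_support_iff.1 ha))))
    · have hb' := Finsupp.mem_support_iff.1 hb
      rw [IsRootBasis.polySConj, AddMonoidAlgebra.coeff_sum, Finset.sum_apply'] at hb'
      obtain ⟨w, hw, hwb⟩ := Finset.exists_ne_zero_of_sum_ne_zero hb'
      rw [AddMonoidAlgebra.coeff_single, Finsupp.single_apply] at hwb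
      have : -w (rho α) = b := by
        by_contra hne
        exact hwb (if_neg hne)
      rw [← this]
      exact (h.isWeight_weyl (h.mem_weylFinset.1 hw) isDominant_rho.isWeight).neg

theorem IsSimpleRoots.existsUnique_isWeightPoly {T : SimpleType n} (hα : IsSimpleRoots T α) :
    ∃! K, IsWeightPoly T α K := by
  obtain ⟨M, hM⟩ := hα.isRootBasis.exists_normSq_mem
  obtain ⟨K, -, hK⟩ := hα.exists_evalX hM
  have hK' : IsWeightPoly T α K := fun x => by
    rw [hα.polyFun_transformX, hK, map_mul, hα.isRootBasis.evalAt_polySConj, Complex.mul_conj',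
      hα.isRootBasis.evalAt_polyS]
    push_cast
    rfl
  exact ⟨K, hK', fun K' h' => hα.poly_ext fun x => by rw [← h', ← hK']⟩

/-! ### Derivatives of trigonometric polynomials -/

theorem hasFDerivAt_chr (μ x : Eucl n) : HasFDerivAt (chr μ)
    ((2 * Real.pi * Complex.I * chr μ x) • (Complex.ofRealCLM ∘L innerSL ℝ μ)) x := by
  have h1 : HasFDerivAt (fun y : Eucl n => ((inner ℝ μ y : ℝ) : ℂ))
      (Complex.ofRealCLM ∘L innerSL ℝ μ) x := (Complex.ofRealCLM ∘L innerSL ℝ μ).hasFDerivAt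
  have h2 := (h1.const_mul (2 * Real.pi * Complex.I)).cexp
  rw [smul_smul, mul_comm (Complex.exp _)] at h2
  exact h2

/-- The derivative of a trigonometric polynomial. -/
def gradAt (f : TrigPoly n) (x : Eucl n) : Eucl n →L[ℝ] ℂ :=
  ∑ μ ∈ f.coeff.support,
    (f.coeff μ * (2 * Real.pi * Complex.I * chr μ x)) • (Complex.ofRealCLM ∘L innerSL ℝ μ)

theorem hasFDerivAt_evalAt (f : TrigPoly n) (x : Eucl n) :
    HasFDerivAt (fun y => evalAt y f) (gradAt f x) x := by
  have h1 : (fun y => evalAt y f) = fun y => ∑ μ ∈ f.coeff.support, f.coeff μ * chr μ y :=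
    funext fun y => evalAt_apply y f
  rw [h1]
  refine HasFDerivAt.fun_sum fun μ _ => ?_
  rw [← smul_smul]
  exact (hasFDerivAt_chr μ x).const_mul _

theorem gradAt_of_symm {w : Eucl n ≃ₗᵢ[ℝ] Eucl n} {f : TrigPoly n}
    (hf : ∀ x, evalAt (w x) f = evalAt x f) (x v : Eucl n) :
    gradAt f (w x) (w v) = gradAt f x v := by
  have h1 := (hasFDerivAt_evalAt f (w x)).comp x
    (w.toContinuousLinearEquiv : Eucl n →L[ℝ] Eucl n).hasFDerivAt
  have h2 := hasFDerivAt_evalAt f x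
  have h3 : (fun y => evalAt y f) ∘ w = fun y => evalAt y f := funext hf
  exact DFunLike.congr_fun ((h3 ▸ h1).unique h2) v

/-- The directional derivative of a trigonometric polynomial. -/
def dirDeriv (v : Eucl n) (f : TrigPoly n) : TrigPoly n :=
  ∑ μ ∈ f.coeff.support,
    AddMonoidAlgebra.single μ (f.coeff μ * (2 * Real.pi * Complex.I * (inner ℝ μ v : ℝ)))

theorem evalAt_dirDeriv (f : TrigPoly n) (v x : Eucl n) :
    evalAt x (dirDeriv v f) = gradAt f x v := by
  rw [dirDeriv, gradAt, map_sum, sum_apply]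
  refine Finset.sum_congr rfl fun μ _ => ?_
  rw [evalAt_single, smul_apply, ContinuousLinearMap.comp_apply,
    Complex.ofRealCLM_apply, innerSL_apply_apply, smul_eq_mul]
  ring

theorem coeff_dirDeriv (f : TrigPoly n) (v μ : Eucl n) : (dirDeriv v f).coeff μ =
    f.coeff μ * (2 * Real.pi * Complex.I * (inner ℝ μ v : ℝ)) := by
  classical
  rw [dirDeriv, AddMonoidAlgebra.coeff_sum, Finset.sum_apply']
  simp only [AddMonoidAlgebra.coeff_single, Finsupp.single_apply, Finset.sum_ite_eq',
    Finsupp.mem_support_iff]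
  split_ifs with h
  · rfl
  · rw [not_not.1 h, zero_mul]

theorem HasTop.dirDeriv {f : TrigPoly n} {u : Eucl n} {c : ℂ} (hf : HasTop α f u c) (v : Eucl n) :
    HasTop α (dirDeriv v f) u (c * (2 * Real.pi * Complex.I * (inner ℝ u v : ℝ))) := by
  refine ⟨by rw [coeff_dirDeriv, hf.1], fun μ hμ => hf.2 μ fun h0 => hμ ?_⟩
  rw [coeff_dirDeriv, h0, zero_mul]

/-! ### The Jacobian -/

/-- The determinant of the matrix of the fundamental weights. -/
def weightDet (α : Basis (Fin n) ℝ (Eucl n)) : ℝ :=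
  Matrix.det (Matrix.of fun j k => inner ℝ (fundWeight α j) (EuclideanSpace.basisFun (Fin n) ℝ k))

/-- The Jacobian matrix of `Z`. -/
def IsRootBasis.jacobiZ (h : IsRootBasis α) : Matrix (Fin n) (Fin n) (TrigPoly n) :=
  Matrix.of fun j k => dirDeriv (EuclideanSpace.basisFun (Fin n) ℝ k) (h.polyZ j)

theorem IsRootBasis.hasTop_det_jacobiZ (h : IsRootBasis α) :
    HasTop α h.jacobiZ.det (rho α) ((2 * Real.pi * Complex.I) ^ n * weightDet α) := by
  have h1 : ((2 * Real.pi * Complex.I) ^ n * weightDet α : ℂ) =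
      ∑ σ : Equiv.Perm (Fin n), ((Equiv.Perm.sign σ : ℤ) : ℂ) * ∏ j, (1 * (2 * Real.pi * Complex.I *
        ((inner ℝ (fundWeight α (σ j)) (EuclideanSpace.basisFun (Fin n) ℝ j) : ℝ) : ℂ))) := by
    rw [weightDet, Matrix.det_apply']
    push_cast
    rw [Finset.mul_sum]
    refine Finset.sum_congr rfl fun σ _ => ?_
    simp only [one_mul]
    rw [Finset.prod_mul_distrib, Finset.prod_const, Finset.card_univ, Fintype.card_fin]
    simp only [Matrix.of_apply]
    ring
  rw [h1, Matrix.det_apply']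
  refine HasTop.sum _ fun σ _ => ?_
  have h2 : rho α = ∑ j, fundWeight α (σ j) := (Equiv.sum_comp σ _).symm
  rw [h2, ← zsmul_eq_mul, ← Int.cast_smul_eq_zsmul ℂ]
  refine HasTop.smul _ (HasTop.prod _ fun j _ => ?_)
  refine HasTop.dirDeriv ?_ _
  rw [← weight_single]
  exact h.isTop_polyC _

theorem toMatrix_apply_mul {w : Eucl n ≃ₗᵢ[ℝ] Eucl n} (L : Eucl n →L[ℝ] ℂ) (k : Fin n) :
    L (w (EuclideanSpace.basisFun (Fin n) ℝ k)) =
      ∑ i, L (EuclideanSpace.basisFun (Fin n) ℝ i) *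
        ((w (EuclideanSpace.basisFun (Fin n) ℝ k) i : ℝ) : ℂ) := by
  conv_lhs => rw [← (EuclideanSpace.basisFun (Fin n) ℝ).sum_repr (w _)]
  rw [map_sum]
  refine Finset.sum_congr rfl fun i _ => ?_
  rw [map_smul, EuclideanSpace.basisFun_repr, Complex.real_smul, mul_comm]

theorem IsRootBasis.jacobiZ_antisymm (h : IsRootBasis α) (i : Fin n) (x : Eucl n) :
    evalAt (simpleRefl α i x) h.jacobiZ.det = -evalAt x h.jacobiZ.det := by
  let b := EuclideanSpace.basisFun (Fin n) ℝ
  let S : Matrix (Fin n) (Fin n) ℝ := LinearMap.toMatrix b.toBasis b.toBasis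
    ((simpleRefl α i).toLinearEquiv : Eucl n →ₗ[ℝ] Eucl n)
  have hS : S.det = -1 := by
    rw [LinearMap.det_toMatrix]; exact isoDet_simpleRefl i
  have h1 : ∀ y, evalAt y h.jacobiZ.det =
      Matrix.det (Matrix.of fun j k => gradAt (h.polyZ j) y (b k)) := fun y => by
    rw [AlgHom.map_det]
    congr 1
    ext j k
    exact evalAt_dirDeriv _ _ _
  have h2 : (Matrix.of fun j k => gradAt (h.polyZ j) x (b k)) =
      (Matrix.of fun j k => gradAt (h.polyZ j) (simpleRefl α i x) (b k)) *
        S.map (algebraMap ℝ ℂ) := by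
    ext j k
    have h3 := gradAt_of_symm (w := simpleRefl α i) (f := h.polyZ j) (h.polyC_symm _ i) x (b k)
    rw [Matrix.mul_apply]
    refine h3.symm.trans ((toMatrix_apply_mul _ k).trans (Finset.sum_congr rfl fun l _ => ?_))
    rw [Matrix.of_apply, Matrix.map_apply]
    congr 1
    simp [S, LinearMap.toMatrix_apply, b]
  rw [h1, h1, h2, Matrix.det_mul, ← RingHom.mapMatrix_apply, ← RingHom.map_det, hS]
  simp

theorem IsRootBasis.polyS_hasTop_smul (h : IsRootBasis α) (c : ℂ) :
    HasTop α (c • h.polyS) (rho α) c := by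
  have := h.isTop_polyS.smul c
  rwa [mul_one] at this

theorem IsRootBasis.det_jacobiZ (h : IsRootBasis α) :
    h.jacobiZ.det = ((2 * Real.pi * Complex.I) ^ n * weightDet α : ℂ) • h.polyS :=
  h.antisymm_ext h.jacobiZ_antisymm
    (fun i x => by rw [map_smul, map_smul, h.polyS_antisymm, smul_neg])
    h.hasTop_det_jacobiZ (h.polyS_hasTop_smul _)

/-- The matrix of the passage from the `Z_j` to the `X_j`. -/
def SimpleType.matXZ (T : SimpleType n) : Matrix (Fin n) (Fin n) ℂ := Matrix.of fun j i =>
  if T.partner j = j then (if i = j then 1 else 0)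
  else if j < T.partner j then 1 / 2 * ((if i = j then 1 else 0) + if i = T.partner j then 1 else 0)
  else 1 / (2 * Complex.I) * ((if i = T.partner j then 1 else 0) - if i = j then 1 else 0)

theorem SimpleType.coordX_eq (T : SimpleType n) (j : Fin n) (x : Eucl n) :
    coordX T α j x = ∑ i, T.matXZ j i * orbitZ α i x := by
  unfold coordX
  simp only [SimpleType.matXZ, Matrix.of_apply]
  split_ifs with h1 h2
  · simp
  · simp only [mul_assoc, ← Finset.mul_sum, add_mul, Finset.sum_add_distrib, ite_mul, one_mul,
      zero_mul, Finset.sum_ite_eq', Finset.mem_univ, if_true]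
    ring
  · simp only [mul_assoc, ← Finset.mul_sum, sub_mul, Finset.sum_sub_distrib, ite_mul, one_mul,
      zero_mul, Finset.sum_ite_eq', Finset.mem_univ, if_true]
    ring

theorem SimpleType.matXZ_mul_conj (T : SimpleType n) : T.matXZ * T.matXZ.conjTranspose =
    Matrix.diagonal fun j => if T.partner j = j then (1 : ℂ) else 1 / 2 := by
  have hL : ∀ j i, T.matXZ j i = (if i = j then T.matXZ j j else 0) +
      if T.partner j = j then 0 else if i = T.partner j then T.matXZ j (T.partner j) else 0 := by
    intro j i
    simp only [SimpleType.matXZ, Matrix.of_apply]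
    by_cases h1 : T.partner j = j
    · simp [h1]
    · by_cases h2 : i = j
      · simp [h1, h2, Ne.symm h1]
      · by_cases h3 : i = T.partner j <;> simp [h1, h2, h3]
  have hne : ∀ j k, k ≠ j → k ≠ T.partner j → T.matXZ j k = 0 := fun j k h1 h2 => by
    rw [hL, if_neg h1, if_neg h2, ite_self, add_zero]
  ext j k
  rw [Matrix.mul_apply]
  have hsum : ∑ i, T.matXZ j i * T.matXZ.conjTranspose i k = T.matXZ j j * conj (T.matXZ k j) +
      if T.partner j = j then 0 else T.matXZ j (T.partner j) * conj (T.matXZ k (T.partner j)) := by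
    simp only [Matrix.conjTranspose_apply]
    rw [Finset.sum_congr rfl fun i _ => by rw [hL j i]]
    by_cases h1 : T.partner j = j
    · simp [h1]
    · simp [h1, add_mul, Finset.sum_add_distrib]
  rw [hsum, Matrix.diagonal_apply]
  by_cases h1 : T.partner j = j
  · rw [if_pos h1, if_pos h1, add_zero]
    split_ifs with h2
    · subst h2
      simp [SimpleType.matXZ, h1]
    · rw [hne k j h2 fun h3 => h2 (by rw [← T.partner_partner k, ← h3, h1]), map_zero, mul_zero]
  · rw [if_neg h1, if_neg h1]
    have h1' : T.partner (T.partner j) ≠ T.partner j := by rw [T.partner_partner]; exact Ne.symm h1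
    split_ifs with h2
    · subst h2
      simp only [SimpleType.matXZ, Matrix.of_apply, if_neg h1, if_neg (Ne.symm h1)]
      split_ifs <;> simp [Complex.conj_ofNat] <;> ring_nf <;> simp <;> norm_num
    · by_cases h3 : k = T.partner j
      · subst h3
        simp only [SimpleType.matXZ, Matrix.of_apply, if_neg h1, if_neg (Ne.symm h1),
          T.partner_partner]
        rcases lt_or_gt_of_ne (Ne.symm h1) with h4 | h4
        · simp [h4, h4.not_gt, Complex.conj_ofNat]
        · simp [h4, h4.not_gt, Complex.conj_ofNat]
      · rw [hne k j h2 fun h4 => h3 (by rw [h4, T.partner_partner]),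
          hne k (T.partner j) (Ne.symm h3) fun h4 => h2 (by
            rw [← T.partner_partner j, h4, T.partner_partner])]
        simp

theorem SimpleType.norm_det_matXZ (T : SimpleType n) : ‖T.matXZ.det‖ = T.kappa := by
  have h1 := congrArg Matrix.det T.matXZ_mul_conj
  rw [Matrix.det_mul, Matrix.det_conjTranspose, Matrix.det_diagonal] at h1
  have h2 : ((‖T.matXZ.det‖ ^ 2 : ℝ) : ℂ) = ((T.kappa ^ 2 : ℝ) : ℂ) := by
    rw [T.kappa_sq]
    push_cast
    rw [← Complex.mul_conj', starRingEnd_apply, h1]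
    refine Finset.prod_congr rfl fun j _ => ?_
    split_ifs <;> simp
  rw [Complex.ofReal_inj] at h2
  exact (sq_eq_sq₀ (norm_nonneg _) T.kappa_pos.le).1 h2

theorem IsRootBasis.hasFDerivAt_coordX (h : IsRootBasis α) (T : SimpleType n) (j : Fin n)
    (x : Eucl n) :
    HasFDerivAt (coordX T α j) (∑ i, T.matXZ j i • gradAt (h.polyZ i) x) x := by
  have h1 : coordX T α j = fun y => ∑ i, T.matXZ j i * evalAt y (h.polyZ i) :=
    funext fun y => by
      rw [T.coordX_eq]
      exact Finset.sum_congr rfl fun i _ => by rw [h.evalAt_polyZ]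
  rw [h1]
  exact HasFDerivAt.fun_sum fun i _ => (hasFDerivAt_evalAt (h.polyZ i) x).const_mul _

theorem IsRootBasis.differentiable_transformX (h : IsRootBasis α) (T : SimpleType n) :
    Differentiable ℝ (transformX T α) :=
  differentiable_euclidean.2 fun j x =>
    (Complex.reCLM.hasFDerivAt.comp x (h.hasFDerivAt_coordX T j x)).differentiableAt

theorem IsSimpleRoots.fderiv_transformX {T : SimpleType n} (hα : IsSimpleRoots T α) (x v : Eucl n)
    (j : Fin n) : ((fderiv ℝ (transformX T α) x v j : ℝ) : ℂ) =
      ∑ i, T.matXZ j i * gradAt (hα.isRootBasis.polyZ i) x v := by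
  have h1 := ((Complex.ofRealCLM ∘L (EuclideanSpace.proj (𝕜 := ℝ) j :
    Eucl n →L[ℝ] ℝ)).hasFDerivAt).comp x
      (hα.isRootBasis.differentiable_transformX T x).hasFDerivAt
  have h2 : ⇑(Complex.ofRealCLM ∘L (EuclideanSpace.proj (𝕜 := ℝ) j : Eucl n →L[ℝ] ℝ)) ∘
      transformX T α = coordX T α j := funext fun y => hα.transformX_eq y j
  rw [h2] at h1
  have h3 := DFunLike.congr_fun (h1.unique (hα.isRootBasis.hasFDerivAt_coordX T j x)) v
  rw [sum_apply] at h3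
  exact h3

theorem IsSimpleRoots.abs_det_fderiv {T : SimpleType n} (hα : IsSimpleRoots T α) (x : Eucl n) :
    |(fderiv ℝ (transformX T α) x).det| =
      T.kappa * (2 * Real.pi) ^ n * |weightDet α| * ‖orbitSRho α x‖ := by
  have h := hα.isRootBasis
  let b := EuclideanSpace.basisFun (Fin n) ℝ
  let J := LinearMap.toMatrix b.toBasis b.toBasis (fderiv ℝ (transformX T α) x : Eucl n →ₗ[ℝ] Eucl n)
  have hJ : J.det = (fderiv ℝ (transformX T α) x).det := LinearMap.det_toMatrix _ _
  have h1 : J.map (algebraMap ℝ ℂ) = T.matXZ * (evalAt x).mapMatrix h.jacobiZ := by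
    ext j k
    rw [Matrix.map_apply, Matrix.mul_apply]
    have : J j k = fderiv ℝ (transformX T α) x (b k) j := by
      simp [J, LinearMap.toMatrix_apply, b]
    rw [this]
    refine (hα.fderiv_transformX x _ j).trans (Finset.sum_congr rfl fun i _ => ?_)
    rw [← evalAt_dirDeriv]
    rfl
  have h2 := congrArg Matrix.det h1
  rw [← RingHom.mapMatrix_apply, ← RingHom.map_det, hJ, Matrix.det_mul, ← AlgHom.map_det,
    h.det_jacobiZ, map_smul, h.evalAt_polyS] at h2
  have h3 := congrArg norm h2
  rw [norm_mul, T.norm_det_matXZ, smul_eq_mul, norm_mul, norm_mul, norm_pow] at h3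
  simp only [Complex.coe_algebraMap, Complex.norm_real, norm_mul, Complex.norm_I, mul_one,
    Real.norm_eq_abs, abs_of_pos Real.pi_pos, Complex.norm_ofNat] at h3
  rw [h3]
  ring

/-! ### The alcove -/

theorem mem_span_int_iff {v : Eucl n} :
    v ∈ Submodule.span ℤ (Set.range α) ↔ v ∈ rootLattice α := by
  rw [Basis.mem_span_iff_repr_mem]
  refine forall_congr' fun i => ?_
  simp only [Set.mem_range, algebraMap_int_eq, eq_intCast, eq_comm]

theorem finite_rootLattice_inter (R : ℝ) :
    {v : Eucl n | v ∈ rootLattice α ∧ ‖v‖ ≤ R}.Finite := by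
  refine (ZSpan.setFinite_inter α (s := Metric.closedBall 0 R) Metric.isBounded_closedBall).subset ?_
  exact fun v hv => ⟨by simpa using hv.2, mem_span_int_iff.2 hv.1⟩

theorem IsRootBasis.coroot_mem (h : IsRootBasis α) {β : Eucl n} (hβ : β ∈ roots α) :
    (2 / inner ℝ β β) • β ∈ rootLattice (coroot α) := by
  obtain ⟨i, w, hw, rfl⟩ := mem_roots.1 hβ
  rw [LinearIsometryEquiv.inner_map_map, ← map_smul, ← coroot_apply]
  exact h.dual.weyl_mem_rootLattice (by rwa [weylGroup_coroot]) (simple_mem_rootLattice _ i)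

/-- The interior of the fundamental domain. -/
def alcove (α : Basis (Fin n) ℝ (Eucl n)) : Set (Eucl n) :=
  {x | (∀ i, 0 < inner ℝ x (α i)) ∧ inner ℝ x (highestRoot α) < 1}

theorem inner_fundCoweight (i j : Fin n) :
    inner ℝ (fundCoweight α i) (α j) = if i = j then 1 else 0 := inner_dualVec _ _ _

theorem inner_highestRoot (x : Eucl n) :
    inner ℝ x (highestRoot α) = ∑ i, inner ℝ x (α i) * marks α i := by
  rw [highestRoot, inner_sum]
  exact Finset.sum_congr rfl fun i _ => by rw [real_inner_smul_right, mul_comm]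

theorem inner_sum_fundCoweight (y : Fin n → ℝ) (j : Fin n) :
    inner ℝ (∑ i, y i • fundCoweight α i) (α j) = y j := by
  simp [sum_inner, real_inner_smul_left, inner_fundCoweight]

theorem ext_inner {u v : Eucl n} (h : ∀ i, inner ℝ u (α i) = inner ℝ v (α i)) : u = v :=
  ext_inner_coroot (α := coroot α) fun i => by rw [coroot_coroot, h]

theorem mem_fundDomain {x : Eucl n} : x ∈ fundDomain α ↔
    (∀ i, 0 ≤ inner ℝ x (α i)) ∧ inner ℝ x (highestRoot α) ≤ 1 := by
  rw [inner_highestRoot]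
  constructor
  · rintro ⟨y₀, y, h0, hy, hsum, rfl⟩
    simp only [inner_sum_fundCoweight]
    exact ⟨hy, by linarith⟩
  · rintro ⟨h1, h2⟩
    refine ⟨1 - ∑ i, inner ℝ x (α i) * marks α i, fun i => inner ℝ x (α i), by linarith, h1,
      by ring, ext_inner (α := α) fun j => ?_⟩
    rw [inner_sum_fundCoweight]

theorem alcove_nonempty : (alcove α).Nonempty := by
  have hpos : (0 : ℝ) < 1 + ∑ i, (marks α i : ℝ) := by positivity
  refine ⟨∑ i, (1 / (1 + ∑ i, (marks α i : ℝ))) • fundCoweight α i, fun i => ?_, ?_⟩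
  · rw [inner_sum_fundCoweight]; positivity
  · rw [inner_highestRoot]
    simp only [inner_sum_fundCoweight]
    rw [← Finset.mul_sum, one_div_mul_eq_div, div_lt_one hpos]
    linarith

theorem alcove_subset_fundDomain : alcove α ⊆ fundDomain α := fun _ hx =>
  mem_fundDomain.2 ⟨fun i => (hx.1 i).le, hx.2.le⟩

theorem IsRootBasis.inner_posRoot (h : IsRootBasis α) (hn : 0 < n) {β : Eucl n}
    (hβ : β ∈ h.posRoots) {x : Eucl n} (hx : x ∈ alcove α) :
    0 < inner ℝ x β ∧ inner ℝ x β < 1 := by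
  obtain ⟨hr, hp⟩ := h.mem_posRoots.1 hβ
  have hc := (mem_posCone_iff.1 hp).2
  have hnn : ∀ {v : Eucl n}, v ∈ posCone α → 0 ≤ inner ℝ x v := fun hv =>
    inner_nonneg_of_dominant (fun i => (hx.1 i).le) hv
  constructor
  · rw [real_inner_comm, inner_eq_sum_repr (α := α)]
    refine Finset.sum_pos' (fun i _ => mul_nonneg (hc i)
      (by rw [real_inner_comm]; exact (hx.1 i).le)) ?_
    by_contra hcon
    push Not at hcon
    refine root_ne_zero hr (α.ext_elem fun i => ?_)
    rw [map_zero, Finsupp.zero_apply]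
    refine le_antisymm (nonpos_of_mul_nonpos_left (hcon i (Finset.mem_univ i)) ?_) (hc i)
    rw [real_inner_comm]; exact hx.1 i
  · have := hnn (h.highestRoot_sub_mem hn hr)
    rw [inner_sub_right] at this
    linarith [hx.2]

theorem IsRootBasis.orbitSRho_ne_zero (h : IsRootBasis α) (hn : 0 < n) {x : Eucl n}
    (hx : x ∈ alcove α) : orbitSRho α x ≠ 0 := by
  rw [← h.evalAt_polyS, ← h.denominator_eq]
  refine h.denominator_ne_zero fun β hβ k hk => ?_
  have h1 := h.inner_posRoot hn hβ hx
  rw [real_inner_comm, hk] at h1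
  have h2 : 0 < k := by exact_mod_cast h1.1
  have h3 : k < 1 := by exact_mod_cast h1.2
  omega

/-! ### The affine Weyl group -/

/-- Every point is equivalent, under the affine Weyl group, to a point of the fundamental domain. -/
theorem IsRootBasis.exists_mem_fundDomain (h : IsRootBasis α) (hn : 0 < n) (x : Eucl n) :
    ∃ w ∈ weylGroup α, ∃ q ∈ rootLattice (coroot α), w x + q ∈ fundDomain α := by
  obtain ⟨c, hc⟩ := alcove_nonempty (α := α)
  let D : Set ((Eucl n ≃ₗᵢ[ℝ] Eucl n) × Eucl n) :=
    {g | (g.1 ∈ weylGroup α ∧ g.2 ∈ rootLattice (coroot α)) ∧ ‖g.1 x + g.2 - c‖ ≤ ‖x - c‖}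
  have hD : D.Finite := by
    refine (h.finite_weylGroup.prod (finite_rootLattice_inter (α := coroot α)
      (‖x - c‖ + ‖x‖ + ‖c‖))).subset fun g hg => ⟨hg.1.1, hg.1.2, ?_⟩
    have h1 : g.2 = (g.1 x + g.2 - c) - g.1 x + c := by abel
    calc ‖g.2‖ = ‖(g.1 x + g.2 - c) - g.1 x + c‖ := by rw [← h1]
      _ ≤ ‖g.1 x + g.2 - c‖ + ‖g.1 x‖ + ‖c‖ :=
        (norm_add_le _ _).trans (add_le_add_left (norm_sub_le _ _) _)
      _ ≤ _ := by rw [LinearIsometryEquiv.norm_map]; linarith [hg.2]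
  obtain ⟨⟨w, q⟩, ⟨⟨hw, hq⟩, hle⟩, hmin⟩ := Set.exists_min_image D
    (fun g => ‖g.1 x + g.2 - c‖) hD ⟨(1, 0), ⟨one_mem _, zero_mem _⟩, by
      change ‖x + 0 - c‖ ≤ _
      rw [add_zero]⟩
  dsimp only at hle hmin
  set y := w x + q with hy
  have key : ∀ β ∈ roots α, ∀ k : ℤ,
      0 ≤ (inner ℝ y β - k) * (inner ℝ c β - k) := by
    intro β hβ k
    have hβ0 : 0 < inner ℝ β β := real_inner_self_pos.2 (root_ne_zero hβ)
    obtain ⟨v, hv, hvy⟩ := exists_root_reflection hβ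
    have hkq : (k : ℝ) • (2 / inner ℝ β β) • β ∈ rootLattice (coroot α) :=
      int_smul_mem_rootLattice (h.coroot_mem hβ) k
    by_contra hneg
    push Not at hneg
    have hy' : (v * w) x + (v q + (k : ℝ) • (2 / inner ℝ β β) • β) =
        y - ((inner ℝ y β - k) * (2 / inner ℝ β β)) • β := by
      change v (w x) + _ = _
      rw [← add_assoc, ← map_add, ← hy, hvy]
      module
    have hlt : ‖(v * w) x + (v q + (k : ℝ) • (2 / inner ℝ β β) • β) - c‖ < ‖y - c‖ := by
      rw [hy']
      refine lt_of_pow_lt_pow_left₀ 2 (norm_nonneg _) ?_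
      rw [← real_inner_self_eq_norm_sq, ← real_inner_self_eq_norm_sq, sub_right_comm]
      have hexp : ∀ (z : Eucl n) (t : ℝ), inner ℝ (z - t • β) (z - t • β) =
          inner ℝ z z - 2 * t * inner ℝ z β + t * (t * inner ℝ β β) := fun z t => by
        rw [inner_sub_left, inner_sub_right, inner_sub_right, real_inner_smul_left,
          real_inner_smul_right, real_inner_smul_left, real_inner_smul_right, real_inner_comm z β]
        ring
      have hzβ : inner ℝ (y - c) β = inner ℝ y β - inner ℝ c β := inner_sub_left _ _ _
      rw [hexp, hzβ]
      have : (inner ℝ y β - k) * (2 / inner ℝ β β) * ((inner ℝ y β - k) * (2 / inner ℝ β β) *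
          inner ℝ β β) = (inner ℝ y β - k) * (2 / inner ℝ β β) * (2 * (inner ℝ y β - k)) := by
        field_simp
      rw [this]
      have h2 := mul_pos_of_neg_of_neg hneg (show -(4 / inner ℝ β β) < 0 by
        rw [neg_lt_zero]; positivity)
      have h3 : 4 / inner ℝ β β = 2 * (2 / inner ℝ β β) := by ring
      rw [h3] at h2
      linarith
    refine absurd (hmin ⟨v * w, v q + (k : ℝ) • (2 / inner ℝ β β) • β⟩
      ⟨⟨mul_mem hv hw, add_mem (h.dual.weyl_mem_rootLattice (by rwa [weylGroup_coroot]) hq) hkq⟩,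
        hlt.le.trans hle⟩) (not_le.2 hlt)
  refine ⟨w, hw, q, hq, mem_fundDomain.2 ⟨fun i => ?_, ?_⟩⟩
  · have h1 := key _ (simple_mem_roots α i) 0
    rw [Int.cast_zero, sub_zero, sub_zero] at h1
    exact nonneg_of_mul_nonneg_left h1 (hc.1 i)
  · have h1 := key _ (h.highestRoot_mem hn) 1
    rw [Int.cast_one] at h1
    by_contra hcon
    push Not at hcon
    have := mul_neg_of_pos_of_neg (sub_pos.2 hcon) (sub_neg.2 hc.2)
    linarith

theorem evalAt_add_of_mem {f : TrigPoly n} (hf : ∀ μ, f.coeff μ ≠ 0 → IsWeight α μ) {q : Eucl n}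
    (hq : q ∈ rootLattice (coroot α)) (x : Eucl n) : evalAt (x + q) f = evalAt x f := by
  rw [evalAt_apply, evalAt_apply]
  refine Finsupp.sum_congr fun μ hμ => ?_
  obtain ⟨k, hk⟩ := (hf μ (Finsupp.mem_support_iff.1 hμ)).int_pairing hq
  rw [chr_add_right, chr_eq_one_of_int hk, mul_one]

theorem evalAt_weyl {f : TrigPoly n} (hf : ∀ i x, evalAt (simpleRefl α i x) f = evalAt x f)
    {w : Eucl n ≃ₗᵢ[ℝ] Eucl n} (hw : w ∈ weylGroup α) (x : Eucl n) :
    evalAt (w x) f = evalAt x f :=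
  simpleRefl_mem_orbit_induction (S := {y | evalAt y f = evalAt x f})
    (fun y hy i => (hf i y).trans hy) hw rfl

theorem evalAt_affine {M : ℕ} {f : TrigPoly n} (hf : f ∈ symmBelow α M)
    {w : Eucl n ≃ₗᵢ[ℝ] Eucl n} (hw : w ∈ weylGroup α) {q : Eucl n}
    (hq : q ∈ rootLattice (coroot α)) (x : Eucl n) : evalAt (w x + q) f = evalAt x f := by
  rw [evalAt_add_of_mem (fun μ hμ => (hf.2 μ hμ).1) hq, evalAt_weyl hf.1 hw]

theorem IsSimpleRoots.transformX_affine {T : SimpleType n} (hα : IsSimpleRoots T α)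
    {w : Eucl n ≃ₗᵢ[ℝ] Eucl n} (hw : w ∈ weylGroup α) {q : Eucl n}
    (hq : q ∈ rootLattice (coroot α)) (x : Eucl n) :
    transformX T α (w x + q) = transformX T α x := by
  have hZ : ∀ j, orbitZ α j (w x + q) = orbitZ α j x := fun j => by
    rw [← hα.isRootBasis.evalAt_polyZ, ← hα.isRootBasis.evalAt_polyZ]
    exact evalAt_affine (hα.isRootBasis.polyC_mem T.rank_pos le_rfl) hw hq x
  unfold transformX coordX
  simp only [hZ]

theorem weightDet_mul_det (α : Basis (Fin n) ℝ (Eucl n)) : weightDet α *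
    Matrix.det (Matrix.of fun j k => inner ℝ (coroot α j) (EuclideanSpace.basisFun (Fin n) ℝ k)) =
      1 := by
  rw [weightDet, ← Matrix.det_transpose (Matrix.of fun j k => inner ℝ (coroot α j) _),
    ← Matrix.det_mul]
  refine (congrArg Matrix.det (?_ : _ = (1 : Matrix (Fin n) (Fin n) ℝ))).trans Matrix.det_one
  ext i j
  rw [Matrix.mul_apply, Matrix.one_apply, ← inner_fundWeight_coroot (α := α),
    ← OrthonormalBasis.sum_inner_mul_inner (EuclideanSpace.basisFun (Fin n) ℝ)]
  refine Finset.sum_congr rfl fun k _ => ?_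
  rw [Matrix.of_apply, Matrix.transpose_apply, Matrix.of_apply, real_inner_comm (coroot α j)]

theorem weightDet_ne_zero (α : Basis (Fin n) ℝ (Eucl n)) : weightDet α ≠ 0 :=
  left_ne_zero_of_mul_eq_one (weightDet_mul_det α)

theorem IsSimpleRoots.eq_one_of_fixed {T : SimpleType n} (hα : IsSimpleRoots T α)
    {w : Eucl n ≃ₗᵢ[ℝ] Eucl n} (hw : w ∈ weylGroup α) {q : Eucl n}
    (hq : q ∈ rootLattice (coroot α)) {c : Eucl n} (hc : c ∈ alcove α) (hfix : w c + q = c) :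
    w = 1 := by
  have hd := (hα.isRootBasis.differentiable_transformX T c).hasFDerivAt
  have h1 : HasFDerivAt (fun y => w y + q) (w.toContinuousLinearEquiv : Eucl n →L[ℝ] Eucl n) c :=
    (w.toContinuousLinearEquiv : Eucl n →L[ℝ] Eucl n).hasFDerivAt.add_const q
  have h2 : HasFDerivAt (transformX T α) (fderiv ℝ (transformX T α) c) (w c + q) := by rwa [hfix]
  have h3 := h2.comp c h1
  have h4 : transformX T α ∘ (fun y => w y + q) = transformX T α :=
    funext fun y => hα.transformX_affine hw hq y
  rw [h4] at h3
  have h5 := h3.unique hd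
  have hdet : (fderiv ℝ (transformX T α) c).det ≠ 0 := by
    rw [← abs_ne_zero, hα.abs_det_fderiv]
    have := T.kappa_pos
    have := abs_pos.2 (weightDet_ne_zero α)
    have := norm_pos_iff.2 (hα.isRootBasis.orbitSRho_ne_zero T.rank_pos hc)
    have := Real.pi_pos
    positivity
  have hinj : Function.Injective (fderiv ℝ (transformX T α) c) :=
    (LinearMap.equivOfDetNeZero _ hdet).injective
  ext1 v
  exact hinj (DFunLike.congr_fun h5 v)

theorem IsRootBasis.maps_alcove (h : IsRootBasis α) (hn : 0 < n) {w : Eucl n ≃ₗᵢ[ℝ] Eucl n}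
    (hw : w ∈ weylGroup α) {q : Eucl n} (hq : q ∈ rootLattice (coroot α)) {x : Eucl n}
    (hx : x ∈ alcove α) (hx' : w x + q ∈ alcove α) {z : Eucl n} (hz : z ∈ alcove α) :
    w z + q ∈ alcove α := by
  have key : ∀ β ∈ h.posRoots, 0 < inner ℝ (w z + q) β ∧ inner ℝ (w z + q) β < 1 := by
    intro β hβ
    obtain ⟨hr, hp⟩ := h.mem_posRoots.1 hβ
    obtain ⟨k, hk⟩ := (h.isWeight_of_mem (posCone_le hp)).int_pairing hq
    have h1 := h.inner_posRoot hn hβ hx'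
    rw [inner_add_left, inner_weyl_left, real_inner_comm β q, hk] at h1 ⊢
    have hr' := weyl_mem_roots (inv_mem hw) hr
    rcases h.root_pos_or_neg hr' with hp' | hp'
    · have hm := h.mem_posRoots.2 ⟨hr', hp'⟩
      have hx1 := h.inner_posRoot hn hm hx
      have hz1 := h.inner_posRoot hn hm hz
      have hk0 : k = 0 := by
        have h2 : (-1 : ℝ) < k := by linarith
        have h3 : (k : ℝ) < 1 := by linarith
        have h2' : -1 < k := by exact_mod_cast h2
        have h3' : k < 1 := by exact_mod_cast h3
        omega
      rw [hk0, Int.cast_zero, add_zero]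
      exact hz1
    · have hm := h.mem_posRoots.2 ⟨neg_mem_roots hr', hp'⟩
      have hx1 := h.inner_posRoot hn hm hx
      have hz1 := h.inner_posRoot hn hm hz
      rw [inner_neg_right] at hx1 hz1
      have hk0 : k = 1 := by
        have h2 : (0 : ℝ) < k := by linarith
        have h3 : (k : ℝ) < 2 := by linarith
        have h2' : 0 < k := by exact_mod_cast h2
        have h3' : k < 2 := by exact_mod_cast h3
        omega
      rw [hk0, Int.cast_one]
      constructor <;> linarith
  refine ⟨fun i => (key _ (h.simple_mem_posRoots i)).1, ?_⟩
  refine (key _ (h.mem_posRoots.2 ⟨h.highestRoot_mem hn, fun i => ?_⟩)).2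
  exact ⟨marks α i, repr_highestRoot i⟩

theorem IsRootBasis.exists_fixed (h : IsRootBasis α) (hn : 0 < n) {w : Eucl n ≃ₗᵢ[ℝ] Eucl n}
    (hw : w ∈ weylGroup α) {q : Eucl n} (hq : q ∈ rootLattice (coroot α)) {x : Eucl n}
    (hx : x ∈ alcove α) (hx' : w x + q ∈ alcove α) : ∃ c ∈ alcove α, w c + q = c := by
  let g : Eucl n → Eucl n := fun z => w z + q
  have hg : ∀ z ∈ alcove α, g z ∈ alcove α := fun z hz => h.maps_alcove hn hw hq hx hx' hz
  have hgk : ∀ k, g^[k] x ∈ alcove α := fun k => by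
    induction k with
    | zero => exact hx
    | succ k ih => rw [Function.iterate_succ_apply']; exact hg _ ih
  have : Finite (weylGroup α) := h.finite_weylGroup
  obtain ⟨N, hN, hwN⟩ := isOfFinOrder_iff_pow_eq_one.1 (isOfFinOrder_of_finite
    (⟨w, hw⟩ : weylGroup α))
  have hwN' : w ^ N = 1 := congrArg Subtype.val hwN
  have hpow : ∀ k, ∃ r, ∀ z, g^[k] z = (w ^ k) z + r := fun k => by
    induction k with
    | zero => exact ⟨0, fun z => (add_zero z).symm⟩
    | succ k ih =>
      obtain ⟨r, hr⟩ := ih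
      refine ⟨w r + q, fun z => ?_⟩
      rw [Function.iterate_succ_apply', hr, pow_succ']
      change w ((w ^ k) z + r) + q = w ((w ^ k) z) + _
      rw [map_add, add_assoc]
  obtain ⟨r, hr⟩ := hpow N
  have hr' : ∀ z, g^[N] z = z + r := fun z => by rw [hr, hwN']; rfl
  have hiter : ∀ m : ℕ, g^[N * m] x = x + (m : ℝ) • r := fun m => by
    induction m with
    | zero => simp
    | succ m ih =>
      rw [Nat.mul_succ, add_comm, Function.iterate_add_apply, hr', ih]
      push_cast
      module
  have hr0 : r = 0 := by
    refine ext_inner (α := α) fun i => ?_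
    rw [inner_zero_left]
    have hb : ∀ m : ℕ, 0 < inner ℝ x (α i) + m * inner ℝ r (α i) ∧
        inner ℝ x (α i) + m * inner ℝ r (α i) < 1 := fun m => by
      have := h.inner_posRoot hn (h.simple_mem_posRoots i) (hgk (N * m))
      rwa [hiter, inner_add_left, real_inner_smul_left] at this
    have hx1 := h.inner_posRoot hn (h.simple_mem_posRoots i) hx
    by_contra hne
    obtain ⟨m, hm⟩ := exists_nat_gt (1 / |inner ℝ r (α i)|)
    rw [div_lt_iff₀ (abs_pos.2 hne)] at hm
    have := hb m
    rcases abs_cases (inner ℝ r (α i)) with ⟨h1, -⟩ | ⟨h1, -⟩ <;> rw [h1] at hm <;> linarith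
  have hNR : (0 : ℝ) < N := by exact_mod_cast hN
  refine ⟨(1 / (N : ℝ)) • ∑ k ∈ Finset.range N, g^[k] x, ⟨fun i => ?_, ?_⟩, ?_⟩
  · rw [real_inner_smul_left, sum_inner]
    exact mul_pos (by positivity) (Finset.sum_pos (fun k _ => (hgk k).1 i)
      (Finset.nonempty_range_iff.2 hN.ne'))
  · rw [real_inner_smul_left, sum_inner, one_div_mul_eq_div, div_lt_one hNR]
    calc _ < ∑ k ∈ Finset.range N, (1 : ℝ) := Finset.sum_lt_sum_of_nonempty
          (Finset.nonempty_range_iff.2 hN.ne') fun k _ => (hgk k).2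
      _ = N := by simp
  · have h1 : ∑ k ∈ Finset.range N, g^[k + 1] x = ∑ k ∈ Finset.range N, g^[k] x := by
      have h2 := Finset.sum_range_succ (fun k => g^[k] x) N
      rw [Finset.sum_range_succ' (fun k => g^[k] x) N, hr', hr0, add_zero] at h2
      exact add_right_cancel h2
    have h3 : ∑ k ∈ Finset.range N, g^[k + 1] x =
        w (∑ k ∈ Finset.range N, g^[k] x) + (N : ℝ) • q := by
      simp only [Function.iterate_succ_apply', g]
      rw [Finset.sum_add_distrib, map_sum, Finset.sum_const, Finset.card_range,
        Nat.cast_smul_eq_nsmul]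
    have h4 : q = (1 / (N : ℝ)) • (N : ℝ) • q := by
      rw [smul_smul, one_div_mul_cancel hNR.ne', one_smul]
    calc w ((1 / (N : ℝ)) • ∑ k ∈ Finset.range N, g^[k] x) + q
        = (1 / (N : ℝ)) • (w (∑ k ∈ Finset.range N, g^[k] x) + (N : ℝ) • q) := by
          rw [smul_add, ← h4, map_smul]
      _ = _ := by rw [← h3, h1]

/-- The affine Weyl group acts freely on the alcove. -/
theorem IsSimpleRoots.eq_one_of_alcove {T : SimpleType n} (hα : IsSimpleRoots T α)
    {w : Eucl n ≃ₗᵢ[ℝ] Eucl n} (hw : w ∈ weylGroup α) {q : Eucl n}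
    (hq : q ∈ rootLattice (coroot α)) {x : Eucl n} (hx : x ∈ alcove α) (hx' : w x + q ∈ alcove α) :
    w = 1 ∧ q = 0 := by
  obtain ⟨c, hc, hfix⟩ := hα.isRootBasis.exists_fixed T.rank_pos hw hq hx hx'
  have h1 := hα.eq_one_of_fixed hw hq hc hfix
  subst h1
  exact ⟨rfl, add_eq_left.1 hfix⟩

/-! ### Separation of orbits -/

/-- The trigonometric polynomials whose exponents are weights. -/
def weightAlg (α : Basis (Fin n) ℝ (Eucl n)) : Subalgebra ℂ (TrigPoly n) where
  carrier := {f | ∀ μ, f.coeff μ ≠ 0 → IsWeight α μ}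
  add_mem' {f g} hf hg μ hμ := by
    rw [AddMonoidAlgebra.coeff_add, Finsupp.add_apply] at hμ
    by_cases h0 : f.coeff μ = 0
    · exact hg μ fun h1 => hμ (by rw [h0, h1, add_zero])
    · exact hf μ h0
  mul_mem' {f g} hf hg μ hμ := by
    classical
    have := AddMonoidAlgebra.support_coeff_mul_subset f g (Finsupp.mem_support_iff.2 hμ)
    obtain ⟨a, ha, b, hb, rfl⟩ := Finset.mem_add.1 this
    exact (hf a (Finsupp.mem_support_iff.1 ha)).add (hg b (Finsupp.mem_support_iff.1 hb))
  algebraMap_mem' c μ hμ := by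
    classical
    have : algebraMap ℂ (TrigPoly n) c = AddMonoidAlgebra.single 0 c := rfl
    rw [this, AddMonoidAlgebra.coeff_single, Finsupp.single_apply] at hμ
    have h0 : 0 = μ := by
      by_contra hne
      exact hμ (if_neg hne)
    exact h0 ▸ isWeight_zero

theorem single_mem_weightAlg {μ : Eucl n} (hμ : IsWeight α μ) (c : ℂ) :
    AddMonoidAlgebra.single μ c ∈ weightAlg α := fun ν hν => by
  classical
  rw [AddMonoidAlgebra.coeff_single, Finsupp.single_apply] at hν
  have h0 : μ = ν := by
    by_contra hne
    exact hν (if_neg hne)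
  exact h0 ▸ hμ

theorem inner_fundWeight (k : Fin n) (v : Eucl n) :
    inner ℝ (fundWeight α k) v = (coroot α).repr v k := by
  conv_lhs => rw [← (coroot α).sum_repr v, inner_sum]
  simp [real_inner_smul_right, inner_fundWeight_coroot]

/-- A nonnegative trigonometric polynomial that vanishes at `x` if and only if `w x` and `y` agree
modulo the coroot lattice. -/
def distPoly (α : Basis (Fin n) ℝ (Eucl n)) (y : Eucl n) (w : Eucl n ≃ₗᵢ[ℝ] Eucl n) : TrigPoly n :=
  ∑ k, (AddMonoidAlgebra.single (w⁻¹ (fundWeight α k)) 1 -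
      algebraMap ℂ (TrigPoly n) (chr (fundWeight α k) y)) *
    (AddMonoidAlgebra.single (-w⁻¹ (fundWeight α k)) 1 -
      algebraMap ℂ (TrigPoly n) (conj (chr (fundWeight α k) y)))

theorem evalAt_distPoly (y : Eucl n) (w : Eucl n ≃ₗᵢ[ℝ] Eucl n) (z : Eucl n) :
    evalAt z (distPoly α y w) =
      ((∑ k, ‖chr (fundWeight α k) (w z) - chr (fundWeight α k) y‖ ^ 2 : ℝ) : ℂ) := by
  rw [distPoly, map_sum, Complex.ofReal_sum]
  refine Finset.sum_congr rfl fun k _ => ?_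
  rw [map_mul, map_sub, map_sub, AlgHom.commutes, AlgHom.commutes, evalAt_single, evalAt_single,
    one_mul, one_mul, chr_weyl_right, Complex.ofReal_pow, ← Complex.mul_conj', map_sub, conj_chr,
    conj_chr]
  rfl

theorem IsRootBasis.distPoly_mem (h : IsRootBasis α) (y : Eucl n) {w : Eucl n ≃ₗᵢ[ℝ] Eucl n}
    (hw : w ∈ weylGroup α) : distPoly α y w ∈ weightAlg α := by
  have h1 : ∀ k, IsWeight α (w⁻¹ (fundWeight α k)) := fun k =>
    h.isWeight_weyl (inv_mem hw) (isWeight_fundWeight k)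
  exact sum_mem fun k _ => mul_mem
    (sub_mem (single_mem_weightAlg (h1 k) 1) (Subalgebra.algebraMap_mem _ _))
    (sub_mem (single_mem_weightAlg (h1 k).neg 1) (Subalgebra.algebraMap_mem _ _))

theorem IsRootBasis.exists_affine_of_symm (h : IsRootBasis α) {x y : Eucl n}
    (hxy : ∀ M, ∀ f ∈ symmBelow α M, evalAt x f = evalAt y f) :
    ∃ w ∈ weylGroup α, ∃ q ∈ rootLattice (coroot α), w x + q = y := by
  let Φ : TrigPoly n := ∏ w ∈ h.weylFinset, distPoly α y w
  have hmul : ∀ {w : Eucl n ≃ₗᵢ[ℝ] Eucl n} (i : Fin n), w ∈ h.weylFinset →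
      w * simpleRefl α i ∈ h.weylFinset := fun i hw =>
    h.mem_weylFinset.2 (mul_mem (h.mem_weylFinset.1 hw) (simpleRefl_mem α i))
  have hcancel : ∀ (w : Eucl n ≃ₗᵢ[ℝ] Eucl n) (i : Fin n),
      w * simpleRefl α i * simpleRefl α i = w := fun w i => by
    rw [mul_assoc, simpleRefl_mul_self, mul_one]
  obtain ⟨M, hM⟩ : ∃ M, Φ ∈ symmBelow α M := by
    refine exists_mem_symmBelow (fun i z => ?_)
      (prod_mem fun w hw => h.distPoly_mem y (h.mem_weylFinset.1 hw) : Φ ∈ weightAlg α)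
    rw [map_prod, map_prod]
    refine Finset.prod_nbij' (· * simpleRefl α i) (· * simpleRefl α i)
      (fun w hw => hmul i hw) (fun w hw => hmul i hw) (fun w _ => hcancel w i)
      (fun w _ => hcancel w i) fun w _ => ?_
    rw [evalAt_distPoly, evalAt_distPoly]
    rfl
  have h1 := hxy M Φ hM
  have h2 : evalAt y Φ = 0 := by
    rw [map_prod]
    refine Finset.prod_eq_zero (h.mem_weylFinset.2 (one_mem _)) ?_
    rw [evalAt_distPoly, Complex.ofReal_eq_zero]
    exact Finset.sum_eq_zero fun k _ => by
      change ‖chr (fundWeight α k) y - chr (fundWeight α k) y‖ ^ 2 = 0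
      rw [sub_self, norm_zero, zero_pow two_ne_zero]
  rw [h2, map_prod, Finset.prod_eq_zero_iff] at h1
  obtain ⟨w, hw, h3⟩ := h1
  rw [evalAt_distPoly, Complex.ofReal_eq_zero,
    Finset.sum_eq_zero_iff_of_nonneg fun _ _ => by positivity] at h3
  refine ⟨w, h.mem_weylFinset.1 hw, y - w x, fun k => ?_, by abel⟩
  have h4 := h3 k (Finset.mem_univ k)
  rw [pow_eq_zero_iff two_ne_zero, norm_eq_zero, sub_eq_zero] at h4
  rw [← inner_fundWeight]
  refine chr_eq_one_iff.1 ?_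
  rw [chr_comm, chr_sub_left, chr_comm y, chr_comm (w x), h4, mul_inv_cancel₀ (chr_ne_zero _ _)]

theorem IsSimpleRoots.injOn_transformX {T : SimpleType n} (hα : IsSimpleRoots T α) :
    Set.InjOn (transformX T α) (alcove α) := by
  intro x hx y hy hxy
  obtain ⟨w, hw, q, hq, hwq⟩ := hα.isRootBasis.exists_affine_of_symm (x := x) (y := y)
    fun M f hf => by
      obtain ⟨p, -, rfl⟩ := hα.exists_evalX hf
      rw [← hα.polyFun_transformX, ← hα.polyFun_transformX, hxy]
  obtain ⟨rfl, rfl⟩ := hα.eq_one_of_alcove hw hq hx (hwq ▸ hy)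
  rw [← hwq, add_zero]
  rfl

/-! ### Integration over the alcove -/

theorem isOpen_alcove : IsOpen (alcove α) := by
  have h1 : alcove α = (⋂ i, {x | 0 < inner ℝ x (α i)}) ∩ {x | inner ℝ x (highestRoot α) < 1} := by
    ext x; simp [alcove]
  rw [h1]
  refine (isOpen_iInter_of_finite fun i => isOpen_lt continuous_const ?_).inter
    (isOpen_lt ?_ continuous_const)
  · fun_prop
  · fun_prop

theorem measurableSet_alcove : MeasurableSet (alcove α) := isOpen_alcove.measurableSet

theorem volume_hyperplane {v : Eucl n} (hv : v ≠ 0) (c : ℝ) :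
    volume {x : Eucl n | inner ℝ x v = c} = 0 := by
  have hvv : inner ℝ v v ≠ 0 := inner_self_ne_zero.2 hv
  have h1 : {x : Eucl n | inner ℝ x v = c} =
      (fun x => x + -((c / inner ℝ v v) • v)) ⁻¹' ((ℝ ∙ v)ᗮ : Submodule ℝ (Eucl n)) := by
    ext x
    simp only [Set.mem_preimage, SetLike.mem_coe, Set.mem_ofPred_eq,
      Submodule.mem_orthogonal_singleton_iff_inner_left]
    rw [← sub_eq_add_neg, inner_sub_left, real_inner_smul_left, div_mul_cancel₀ _ hvv, sub_eq_zero]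
  rw [h1, measure_preimage_add_right]
  refine Measure.addHaar_submodule _ _ fun htop => hv ?_
  have : v ∈ (ℝ ∙ v)ᗮ := htop ▸ Submodule.mem_top
  rwa [Submodule.mem_orthogonal_singleton_iff_inner_left, inner_self_eq_zero] at this

theorem IsRootBasis.volume_diff_alcove (h : IsRootBasis α) (hn : 0 < n) :
    volume (fundDomain α \ alcove α) = 0 := by
  refine measure_mono_null (t := (⋃ i, {x | inner ℝ x (α i) = 0}) ∪
    {x | inner ℝ x (highestRoot α) = 1}) ?_ (measure_union_null (measure_iUnion_null fun i =>
      volume_hyperplane (α.ne_zero i) 0)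
      (volume_hyperplane (root_ne_zero (h.highestRoot_mem hn)) 1))
  rintro x ⟨hx, hx'⟩
  obtain ⟨h1, h2⟩ := mem_fundDomain.1 hx
  by_contra hcon
  simp only [Set.mem_union, Set.mem_iUnion, Set.mem_ofPred_eq, not_or, not_exists] at hcon
  exact hx' ⟨fun i => lt_of_le_of_ne (h1 i) (Ne.symm (hcon.1 i)), lt_of_le_of_ne h2 hcon.2⟩

theorem IsRootBasis.isCompact_fundDomain (h : IsRootBasis α) (hn : 0 < n) :
    IsCompact (fundDomain α) := by
  have h1 : IsCompact ((fun y : Fin n → ℝ => ∑ i, y i • fundCoweight α i) '' Set.Icc 0 1) :=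
    isCompact_Icc.image (by fun_prop)
  refine h1.of_isClosed_subset ?_ ?_
  · have h2 : fundDomain α =
        (⋂ i, {x | 0 ≤ inner ℝ x (α i)}) ∩ {x | inner ℝ x (highestRoot α) ≤ 1} := by
      ext x
      rw [mem_fundDomain]
      simp
    rw [h2]
    refine (isClosed_iInter fun i => isClosed_le continuous_const ?_).inter
      (isClosed_le ?_ continuous_const)
    · fun_prop
    · fun_prop
  · rintro x ⟨y₀, y, h0, hy, hsum, rfl⟩
    refine ⟨y, ⟨hy, fun i => ?_⟩, rfl⟩
    have h2 : y i * (marks α i : ℝ) ≤ ∑ j, y j * (marks α j : ℝ) :=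
      Finset.single_le_sum (f := fun j => y j * (marks α j : ℝ))
        (fun j _ => mul_nonneg (hy j) (Nat.cast_nonneg _)) (Finset.mem_univ i)
    have h3 : (1 : ℝ) ≤ marks α i := by exact_mod_cast h.marks_pos hn i
    have h4 : y i ≤ y i * marks α i := le_mul_of_one_le_right (hy i) h3
    change y i ≤ 1
    linarith

/-- The union of the Weyl group translates of the alcove. -/
def star (α : Basis (Fin n) ℝ (Eucl n)) : Set (Eucl n) :=
  {x | ∃ w ∈ weylGroup α, w x ∈ alcove α}

theorem IsRootBasis.star_eq (h : IsRootBasis α) :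
    star α = ⋃ w ∈ h.weylFinset, (w : Eucl n → Eucl n) ⁻¹' alcove α := by
  ext x; simp [star, h.mem_weylFinset]

theorem IsSimpleRoots.isAddFundamentalDomain_star {T : SimpleType n} (hα : IsSimpleRoots T α) :
    IsAddFundamentalDomain (Submodule.span ℤ (Set.range (coroot α))) (star α) volume where
  nullMeasurableSet := by
    rw [hα.isRootBasis.star_eq]
    exact (Finset.measurableSet_biUnion _ fun w _ =>
      w.continuous.measurable measurableSet_alcove).nullMeasurableSet
  ae_covers := by
    have h := hα.isRootBasis
    have h1 : ∀ᵐ x : Eucl n ∂volume, ∀ q : Submodule.span ℤ (Set.range (coroot α)),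
        ∀ w ∈ (weylGroup α : Set (Eucl n ≃ₗᵢ[ℝ] Eucl n)),
          w x + q ∉ fundDomain α \ alcove α := by
      refine ae_all_iff.2 fun q => (ae_ball_iff h.finite_weylGroup.countable).2 fun w _ => ?_
      refine measure_mono_null (t := (fun x => w x + q) ⁻¹' (fundDomain α \ alcove α)) ?_ ?_
      · intro x hx
        exact not_not.1 hx
      · have hmp : MeasurePreserving (fun x => w x + (q : Eucl n)) volume volume :=
          (measurePreserving_add_right volume (q : Eucl n)).comp w.measurePreserving
        exact hmp.quasiMeasurePreserving.preimage_null (h.volume_diff_alcove T.rank_pos)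
    filter_upwards [h1] with x hx
    obtain ⟨w, hw, q, hq, hF⟩ := h.exists_mem_fundDomain T.rank_pos x
    have hC : w x + q ∈ alcove α := by
      by_contra hcon
      exact hx ⟨q, mem_span_int_iff.2 hq⟩ w hw ⟨hF, hcon⟩
    have hq' : w⁻¹ q ∈ rootLattice (coroot α) :=
      h.dual.weyl_mem_rootLattice (by rw [weylGroup_coroot]; exact inv_mem hw) hq
    refine ⟨⟨w⁻¹ q, mem_span_int_iff.2 hq'⟩, w, hw, ?_⟩
    change w (w⁻¹ q + x) ∈ _
    rw [map_add, add_comm, show w (w⁻¹ q) = q from w.apply_symm_apply q]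
    exact hC
  aedisjoint := by
    have h := hα.isRootBasis
    refine fun g g' hne => Disjoint.aedisjoint (Set.disjoint_left.2 ?_)
    rintro _ ⟨u, ⟨w, hw, hu⟩, rfl⟩ ⟨u', ⟨w', hw', hu'⟩, he⟩
    replace he : (g' : Eucl n) + u' = g + u := he
    refine hne (Subtype.ext ?_)
    have hd : (g : Eucl n) - g' ∈ rootLattice (coroot α) :=
      sub_mem (mem_span_int_iff.1 g.2) (mem_span_int_iff.1 g'.2)
    have h1 : (w' * w⁻¹) (w u) + w' ((g : Eucl n) - g') = w' u' := by
      change w' (w⁻¹ (w u)) + _ = _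
      rw [show w⁻¹ (w u) = u from w.symm_apply_apply u, ← map_add]
      congr 1
      rw [← add_sub_cancel_left (g' : Eucl n) u', he]
      abel
    have h2 := (hα.eq_one_of_alcove (mul_mem hw' (inv_mem hw))
      (h.dual.weyl_mem_rootLattice (by rwa [weylGroup_coroot]) hd) hu (h1 ▸ hu')).2
    exact sub_eq_zero.1 ((map_eq_zero_iff w' w'.injective).1 h2)

/-- The cell of the coroot lattice. -/
def cell (α : Basis (Fin n) ℝ (Eucl n)) : Set (Eucl n) := ZSpan.fundamentalDomain (coroot α)

theorem continuous_evalAt (f : TrigPoly n) : Continuous fun x => evalAt x f :=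
  continuous_iff_continuousAt.2 fun x => (hasFDerivAt_evalAt f x).continuousAt

theorem norm_evalAt_le (f : TrigPoly n) (x : Eucl n) :
    ‖evalAt x f‖ ≤ ∑ μ ∈ f.coeff.support, ‖f.coeff μ‖ := by
  rw [evalAt_apply]
  refine (norm_sum_le _ _).trans (Finset.sum_le_sum fun μ _ => ?_)
  rw [norm_mul, norm_chr, mul_one]

theorem integrableOn_evalAt (f : TrigPoly n) {s : Set (Eucl n)} (hs : volume s ≠ ⊤) :
    IntegrableOn (fun x => evalAt x f) s := by
  have : IsFiniteMeasure (volume.restrict s) := isFiniteMeasure_restrict.2 hs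
  exact Integrable.of_bound (continuous_evalAt f).aestronglyMeasurable _
    (Filter.Eventually.of_forall (norm_evalAt_le f))

theorem volume_cell_ne_top : volume (cell α) ≠ ⊤ :=
  (ZSpan.fundamentalDomain_isBounded (coroot α)).measure_lt_top.ne

theorem volume_cell : volume.real (cell α) * |weightDet α| = 1 := by
  let b := EuclideanSpace.basisFun (Fin n) ℝ
  have h1 : volume (ZSpan.fundamentalDomain b.toBasis) = 1 := by
    rw [measure_congr (ZSpan.fundamentalDomain_ae_parallelepiped b.toBasis volume)]
    simpa using b.volume_parallelepiped
  have h2 := ZSpan.measure_fundamentalDomain (coroot α) volume b.toBasis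
  rw [h1, mul_one] at h2
  have h3 : b.toBasis.det (coroot α) =
      Matrix.det (Matrix.of fun j k => inner ℝ (coroot α j) (b k)) := by
    rw [Basis.det_apply, ← Matrix.det_transpose]
    congr 1
    ext j k
    rw [Matrix.transpose_apply, Basis.toMatrix_apply, Matrix.of_apply, real_inner_comm]
    exact b.repr_apply_apply _ _
  rw [cell, Measure.real, h2, ENNReal.toReal_ofReal (abs_nonneg _), h3, mul_comm, ← abs_mul,
    weightDet_mul_det, abs_one]

instance : VAddInvariantMeasure (Submodule.span ℤ (Set.range (coroot α))) (Eucl n) volume :=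
  ⟨fun c s _ => measure_preimage_add volume (c : Eucl n) s⟩

open scoped Pointwise in
theorem integral_cell_chr {μ : Eucl n} (hμ : IsWeight α μ) (h0 : μ ≠ 0) :
    ∫ x in cell α, chr μ x = 0 := by
  have hfd := ZSpan.isAddFundamentalDomain (coroot α) (volume : Measure (Eucl n))
  let a : Eucl n := (1 / (2 * inner ℝ μ μ)) • μ
  have ha : chr μ a ≠ 1 := by
    intro h1
    obtain ⟨k, hk⟩ := chr_eq_one_iff.1 h1
    have := (real_inner_self_pos.2 h0).ne'
    rw [real_inner_smul_right] at hk
    field_simp at hk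
    have : (1 : ℤ) = 2 * k := by exact_mod_cast hk
    omega
  have h1 := (hfd.vadd_of_comm a).setIntegral_eq hfd (f := chr μ) fun g x => by
    obtain ⟨k, hk⟩ := hμ.int_pairing (mem_span_int_iff.1 g.2)
    change chr μ ((g : Eucl n) + x) = _
    rw [chr_add_right, chr_eq_one_of_int hk, one_mul]
  have h2 : ∫ x in a +ᵥ ZSpan.fundamentalDomain (coroot α), chr μ x =
      chr μ a * ∫ x in ZSpan.fundamentalDomain (coroot α), chr μ x := by
    have h3 := (measurePreserving_vadd a (volume : Measure (Eucl n))).setIntegral_image_emb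
      (measurableEmbedding_const_vadd a) (chr μ) (ZSpan.fundamentalDomain (coroot α))
    refine h3.trans ?_
    rw [← integral_const_mul]
    congr 1
    ext x
    exact chr_add_right μ a x
  rw [h2] at h1
  have h4 : (chr μ a - 1) * ∫ x in ZSpan.fundamentalDomain (coroot α), chr μ x = 0 := by
    rw [sub_mul, h1, one_mul, sub_self]
  exact (mul_eq_zero.1 h4).resolve_left (sub_ne_zero.2 ha)

theorem integral_cell_evalAt {f : TrigPoly n} (hf : f ∈ weightAlg α) :
    ∫ x in cell α, evalAt x f = f.coeff 0 * volume.real (cell α) := by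
  classical
  have hchr : ∀ μ, IntegrableOn (chr μ) (cell α) := fun μ => by
    have := integrableOn_evalAt (AddMonoidAlgebra.single μ (1 : ℂ)) (volume_cell_ne_top (α := α))
    simpa only [evalAt_single, one_mul] using this
  simp only [evalAt_apply, Finsupp.sum]
  rw [integral_finsetSum _ fun μ _ => (hchr μ).const_mul _]
  have h1 : ∀ μ ∈ f.coeff.support, ∫ x in cell α, f.coeff μ * chr μ x =
      if μ = 0 then f.coeff 0 * volume.real (cell α) else 0 := fun μ hμ => by
    rw [integral_const_mul]
    split_ifs with h0
    · subst h0
      simp [Measure.real]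
    · rw [integral_cell_chr (hf μ (Finsupp.mem_support_iff.1 hμ)) h0, mul_zero]
  rw [Finset.sum_congr rfl h1, Finset.sum_ite_eq']
  split_ifs with h2
  · rfl
  · rw [Finsupp.notMem_support_iff.1 h2, zero_mul]

theorem IsRootBasis.volume_alcove_ne_top (h : IsRootBasis α) (hn : 0 < n) :
    volume (alcove α) ≠ ⊤ :=
  ((measure_mono alcove_subset_fundDomain).trans_lt (h.isCompact_fundDomain hn).measure_lt_top).ne

/-- The integral of a symmetric trigonometric polynomial over the alcove. -/
theorem IsSimpleRoots.integral_alcove {T : SimpleType n} (hα : IsSimpleRoots T α) {f : TrigPoly n}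
    (hf : ∀ i x, evalAt (simpleRefl α i x) f = evalAt x f) (hf' : f ∈ weightAlg α) :
    ∫ x in alcove α, evalAt x f =
      f.coeff 0 * volume.real (cell α) / (hα.isRootBasis.weylFinset.card : ℂ) := by
  have h := hα.isRootBasis
  have hfd := ZSpan.isAddFundamentalDomain (coroot α) (volume : Measure (Eucl n))
  have h1 := hα.isAddFundamentalDomain_star.setIntegral_eq hfd (f := fun x => evalAt x f)
    fun g x => by
      change evalAt ((g : Eucl n) + x) f = _
      rw [add_comm, evalAt_add_of_mem hf' (mem_span_int_iff.1 g.2)]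
  have hW : ∀ w ∈ h.weylFinset, ∫ x in (w : Eucl n → Eucl n) ⁻¹' alcove α, evalAt x f =
      ∫ x in alcove α, evalAt x f := fun w hw => by
    have h2 := w.measurePreserving.setIntegral_preimage_emb
      w.toHomeomorph.measurableEmbedding (fun x => evalAt x f) (alcove α)
    rw [← h2]
    congr 1
    ext x
    exact (evalAt_weyl hf (h.mem_weylFinset.1 hw) x).symm
  rw [h.star_eq, integral_biUnion_finset _ (fun w _ => w.continuous.measurable measurableSet_alcove),
    Finset.sum_congr rfl hW, Finset.sum_const, nsmul_eq_mul] at h1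
  · have hcard : (h.weylFinset.card : ℂ) ≠ 0 := by
      rw [Nat.cast_ne_zero, Finset.card_ne_zero]
      exact ⟨1, h.mem_weylFinset.2 (one_mem _)⟩
    rw [eq_div_iff hcard, mul_comm, h1]
    exact integral_cell_evalAt hf'
  · intro w hw w' hw' hne
    refine Set.disjoint_left.2 fun x hx hx' => hne ?_
    have h3 : (w' * w⁻¹) (w x) + 0 = w' x := by
      rw [add_zero]
      change w' (w⁻¹ (w x)) = _
      rw [show w⁻¹ (w x) = x from w.symm_apply_apply x]
    have h4 := (hα.eq_one_of_alcove (mul_mem (h.mem_weylFinset.1 hw')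
      (inv_mem (h.mem_weylFinset.1 hw))) (zero_mem _) hx (h3 ▸ hx')).1
    exact (mul_inv_eq_one.1 h4).symm
  · intro w _
    refine integrableOn_evalAt f ?_
    rw [w.measurePreserving.measure_preimage measurableSet_alcove.nullMeasurableSet]
    exact h.volume_alcove_ne_top T.rank_pos

/-! ### The measure -/

theorem continuous_polyFun (q : MvPolynomial (Fin n) ℂ) : Continuous (polyFun q) :=
  (MvPolynomial.continuous_eval q).comp (by fun_prop)

theorem IsSimpleRoots.isCompact_domainOmega {T : SimpleType n} (hα : IsSimpleRoots T α) :
    IsCompact (domainOmega T α) :=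
  (hα.isRootBasis.isCompact_fundDomain T.rank_pos).image
    (hα.isRootBasis.differentiable_transformX T).continuous

theorem IsSimpleRoots.image_alcove_ae_eq {T : SimpleType n} (hα : IsSimpleRoots T α) :
    transformX T α '' alcove α =ᵐ[volume] domainOmega T α := by
  refine (Set.image_mono alcove_subset_fundDomain :
    transformX T α '' alcove α ≤ domainOmega T α).eventuallyLE.antisymm (ae_le_set.2 ?_)
  refine measure_mono_null (t := transformX T α '' (fundDomain α \ alcove α)) ?_ ?_
  · rintro _ ⟨⟨x, hx, rfl⟩, h2⟩
    exact ⟨x, ⟨hx, fun h3 => h2 ⟨x, h3, rfl⟩⟩, rfl⟩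
  · exact addHaar_image_eq_zero_of_differentiableOn_of_addHaar_eq_zero _
      (hα.isRootBasis.differentiable_transformX T).differentiableOn
      (hα.isRootBasis.volume_diff_alcove T.rank_pos)

theorem IsWeightPoly.re_eq {T : SimpleType n} {K : MvPolynomial (Fin n) ℂ}
    (hK : IsWeightPoly T α K) (x : Eucl n) :
    (polyFun K (transformX T α x)).re = ‖orbitSRho α x‖ ^ 2 := by
  rw [← hK x, Complex.ofReal_re]

theorem IsWeightPoly.weightFun_eq {T : SimpleType n} {K : MvPolynomial (Fin n) ℂ}
    (hK : IsWeightPoly T α K) (x : Eucl n) :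
    weightFun K (transformX T α x) = ‖orbitSRho α x‖⁻¹ := by
  rw [weightFun, hK.re_eq, ← Real.rpow_natCast, ← Real.rpow_mul (norm_nonneg _)]
  norm_num
  exact Real.rpow_neg_one _

theorem measurable_weightFun (K : MvPolynomial (Fin n) ℂ) : Measurable (weightFun K) :=
  (Complex.measurable_re.comp (continuous_polyFun K).measurable).pow_const _

/-- The weighted measure on `Ω` is a multiple of the image of the Lebesgue measure on the alcove. -/
theorem IsSimpleRoots.measureK_eq {T : SimpleType n} (hα : IsSimpleRoots T α)
    {K : MvPolynomial (Fin n) ℂ} (hK : IsWeightPoly T α K) : measureK T α K =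
      ENNReal.ofReal |weightDet α| • (volume.restrict (alcove α)).map (transformX T α) := by
  have hX := (hα.isRootBasis.differentiable_transformX T).continuous.measurable
  ext s hs
  rw [measureK, withDensity_apply _ hs, ← Measure.restrict_congr_set hα.image_alcove_ae_eq,
    ← lintegral_indicator hs, lintegral_image_eq_lintegral_abs_det_fderiv_mul volume
      measurableSet_alcove (fun x _ => ((hα.isRootBasis.differentiable_transformX T
        x).hasFDerivAt).hasFDerivWithinAt) hα.injOn_transformX, Measure.smul_apply,
    Measure.map_apply hX hs, smul_eq_mul, ← setLIntegral_const, Measure.restrict_restrict (hX hs),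
    ← Measure.restrict_restrict (hX hs), ← lintegral_indicator (hX hs)]
  refine setLIntegral_congr_fun measurableSet_alcove fun x hx => ?_
  by_cases hxs : transformX T α x ∈ s
  · have hS := norm_pos_iff.2 (hα.isRootBasis.orbitSRho_ne_zero T.rank_pos hx)
    have hx' : x ∈ transformX T α ⁻¹' s := hxs
    have hk := T.kappa_pos
    have hpi := Real.pi_pos
    simp only [Set.indicator_of_mem hxs, Set.indicator_of_mem hx']
    rw [← ENNReal.ofReal_mul (abs_nonneg _), hα.abs_det_fderiv, hK.weightFun_eq]
    congr 1
    field_simp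
  · have hx' : x ∉ transformX T α ⁻¹' s := hxs
    simp only [Set.indicator_of_notMem hxs, Set.indicator_of_notMem hx', mul_zero]

theorem IsSimpleRoots.isFiniteMeasure_measureK {T : SimpleType n} (hα : IsSimpleRoots T α)
    {K : MvPolynomial (Fin n) ℂ} (hK : IsWeightPoly T α K) : IsFiniteMeasure (measureK T α K) := by
  rw [hα.measureK_eq hK]
  have : IsFiniteMeasure (volume.restrict (alcove α)) :=
    isFiniteMeasure_restrict.2 (hα.isRootBasis.volume_alcove_ne_top T.rank_pos)
  exact Measure.smul_finite _ ENNReal.ofReal_ne_top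

theorem IsSimpleRoots.ae_mem_domainOmega {T : SimpleType n} (hα : IsSimpleRoots T α)
    (K : MvPolynomial (Fin n) ℂ) : ∀ᵐ y ∂measureK T α K, y ∈ domainOmega T α :=
  (withDensity_absolutelyContinuous _ _).ae_le
    (ae_restrict_mem hα.isCompact_domainOmega.measurableSet)

theorem IsSimpleRoots.memLp_polyFun {T : SimpleType n} (hα : IsSimpleRoots T α)
    {K : MvPolynomial (Fin n) ℂ} (hK : IsWeightPoly T α K) (q : MvPolynomial (Fin n) ℂ) :
    MemLp (polyFun q) 2 (measureK T α K) := by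
  have := hα.isFiniteMeasure_measureK hK
  obtain ⟨C, hC⟩ := hα.isCompact_domainOmega.exists_bound_of_continuousOn
    (continuous_polyFun q).continuousOn
  refine MemLp.of_bound (continuous_polyFun q).aestronglyMeasurable C ?_
  filter_upwards [hα.ae_mem_domainOmega K] with y hy using hC y hy

theorem IsSimpleRoots.scalarK_eq_integral {T : SimpleType n} (hα : IsSimpleRoots T α)
    {K : MvPolynomial (Fin n) ℂ} (hK : IsWeightPoly T α K) (f g : Eucl n → ℂ) :
    scalarK T α K f g = ∫ y, f y * conj (g y) ∂measureK T α K := by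
  have hk := T.kappa_pos
  have hpi := Real.pi_pos
  rw [measureK, integral_withDensity_eq_integral_toReal_smul
    ((measurable_weightFun K).const_mul _).ennreal_ofReal
    (Filter.Eventually.of_forall fun _ => ENNReal.ofReal_lt_top), scalarK, ← integral_const_mul]
  refine setIntegral_congr_fun hα.isCompact_domainOmega.measurableSet ?_
  rintro _ ⟨x, -, rfl⟩
  dsimp only
  rw [ENNReal.toReal_ofReal (by rw [hK.weightFun_eq]; positivity), Complex.real_smul]
  push_cast
  ring

theorem IsSimpleRoots.inner_eq_scalarK {T : SimpleType n} (hα : IsSimpleRoots T α)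
    {K : MvPolynomial (Fin n) ℂ} (hK : IsWeightPoly T α K) (f g : L2K T α K) :
    inner ℂ g f = scalarK T α K f g := by
  rw [hα.scalarK_eq_integral hK, L2.inner_def]
  rfl

theorem IsSimpleRoots.scalarK_congr {T : SimpleType n} (hα : IsSimpleRoots T α)
    {K : MvPolynomial (Fin n) ℂ} (hK : IsWeightPoly T α K) {f f' g g' : Eucl n → ℂ}
    (hf : f =ᵐ[measureK T α K] f') (hg : g =ᵐ[measureK T α K] g') :
    scalarK T α K f g = scalarK T α K f' g' := by
  rw [hα.scalarK_eq_integral hK, hα.scalarK_eq_integral hK]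
  refine integral_congr_ae ?_
  filter_upwards [hf, hg] with y h1 h2
  rw [h1, h2]

theorem IsSimpleRoots.scalarK_polyFun {T : SimpleType n} (hα : IsSimpleRoots T α)
    {K : MvPolynomial (Fin n) ℂ} (hK : IsWeightPoly T α K) (p q : MvPolynomial (Fin n) ℂ) :
    scalarK T α K (polyFun p) (polyFun q) = |weightDet α| * ∫ x in alcove α,
      evalAt x (hα.isRootBasis.evalX T p) * conj (evalAt x (hα.isRootBasis.evalX T q)) := by
  have hX := (hα.isRootBasis.differentiable_transformX T).continuous.measurable
  rw [hα.scalarK_eq_integral hK, hα.measureK_eq hK, integral_smul_measure,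
    ENNReal.toReal_ofReal (abs_nonneg _), Complex.real_smul, integral_map hX.aemeasurable]
  · simp only [hα.polyFun_transformX]
  · exact ((continuous_polyFun p).mul
      (Complex.continuous_conj.comp (continuous_polyFun q))).aestronglyMeasurable

/-! ### Orthogonality -/

/-- The complex conjugate of `C_λ`. -/
def IsRootBasis.polyCConj (h : IsRootBasis α) (l : Fin n →₀ ℕ) : TrigPoly n :=
  ∑ ν ∈ h.orbitFinset (weight α l), AddMonoidAlgebra.single (-ν) 1

theorem IsRootBasis.evalAt_polyCConj (h : IsRootBasis α) (l : Fin n →₀ ℕ) (x : Eucl n) :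
    evalAt x (h.polyCConj l) = conj (evalAt x (h.polyC l)) := by
  rw [h.evalAt_polyC', IsRootBasis.polyCConj, map_sum, map_sum]
  exact Finset.sum_congr rfl fun ν _ => by rw [evalAt_single, one_mul, conj_chr]

theorem IsRootBasis.isWeight_orbit (h : IsRootBasis α) {l : Fin n →₀ ℕ} {ν : Eucl n}
    (hν : ν ∈ h.orbitFinset (weight α l)) : IsWeight α ν := by
  obtain ⟨w, hw, rfl⟩ := h.mem_orbitFinset.1 hν
  exact h.isWeight_weyl hw (isWeight_weight l)

theorem IsRootBasis.card_orbit_mul (h : IsRootBasis α) (l : Fin n →₀ ℕ) :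
    (h.orbitFinset (weight α l)).card * stabOrder α l = h.weylFinset.card := by
  classical
  have hs : stabOrder α l = (h.weylFinset.filter fun w => w (weight α l) = weight α l).card :=
    Nat.subtype_card _ fun w => by rw [Finset.mem_filter, h.mem_weylFinset]
  rw [Finset.card_eq_sum_card_image (fun w => w (weight α l)) h.weylFinset]
  have : ∀ ν ∈ h.weylFinset.image fun w => w (weight α l),
      (h.weylFinset.filter fun w => w (weight α l) = ν).card = stabOrder α l := by
    intro ν hν
    obtain ⟨v, hv, rfl⟩ := Finset.mem_image.1 hν
    rw [h.mem_weylFinset] at hv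
    rw [hs]
    refine Finset.card_nbij' (v⁻¹ * ·) (v * ·) ?_ ?_ (fun w _ => mul_inv_cancel_left v w)
      (fun w _ => inv_mul_cancel_left v w)
    · intro w hw
      obtain ⟨h1, h2⟩ := Finset.mem_filter.1 hw
      refine Finset.mem_filter.2 ⟨h.mem_weylFinset.2 (mul_mem (inv_mem hv)
        (h.mem_weylFinset.1 h1)), ?_⟩
      change v⁻¹ (w _) = _
      rw [h2]
      exact v.symm_apply_apply _
    · intro w hw
      obtain ⟨h1, h2⟩ := Finset.mem_filter.1 hw
      refine Finset.mem_filter.2 ⟨h.mem_weylFinset.2 (mul_mem hv (h.mem_weylFinset.1 h1)), ?_⟩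
      change v (w _) = _
      rw [h2]
  rw [Finset.sum_congr rfl this, Finset.sum_const, smul_eq_mul]
  rfl

theorem IsRootBasis.weylFinset_card_pos (h : IsRootBasis α) : 0 < h.weylFinset.card :=
  Finset.card_pos.2 ⟨1, h.mem_weylFinset.2 (one_mem _)⟩

theorem IsRootBasis.stabOrder_pos (h : IsRootBasis α) (l : Fin n →₀ ℕ) : 0 < stabOrder α l :=
  Nat.pos_of_ne_zero fun h0 => by
    have := h.card_orbit_mul l
    rw [h0, mul_zero] at this
    exact h.weylFinset_card_pos.ne this

theorem IsRootBasis.coeff_polyC_mul (h : IsRootBasis α) (l l' : Fin n →₀ ℕ) :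
    (h.polyC l * h.polyCConj l').coeff 0 =
      if l = l' then ((h.orbitFinset (weight α l)).card : ℂ) else 0 := by
  classical
  rw [IsRootBasis.polyC, IsRootBasis.polyCConj, Finset.sum_mul_sum, AddMonoidAlgebra.coeff_sum,
    Finset.sum_apply']
  have h1 : ∀ ν ∈ h.orbitFinset (weight α l), (∑ ν' ∈ h.orbitFinset (weight α l'),
      (AddMonoidAlgebra.single ν 1 * AddMonoidAlgebra.single (-ν') 1 : TrigPoly n)).coeff 0 =
        if l = l' then 1 else 0 := by
    intro ν hν
    rw [AddMonoidAlgebra.coeff_sum, Finset.sum_apply']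
    simp only [AddMonoidAlgebra.single_mul_single, AddMonoidAlgebra.coeff_single,
      Finsupp.single_apply, mul_one, ← sub_eq_add_neg, sub_eq_zero, Finset.sum_ite_eq]
    refine if_congr ⟨fun hν' => ?_, fun he => he ▸ hν⟩ rfl rfl
    obtain ⟨w, hw, rfl⟩ := h.mem_orbitFinset.1 hν
    obtain ⟨w', hw', he⟩ := h.mem_orbitFinset.1 hν'
    refine h.weight_mem_orbit_iff.1 ⟨w⁻¹ * w', mul_mem (inv_mem hw) hw', ?_⟩
    change w⁻¹ (w' _) = _
    rw [he]
    exact w.symm_apply_apply _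
  rw [Finset.sum_congr rfl h1, Finset.sum_const, nsmul_eq_mul, mul_ite, mul_one, mul_zero]

theorem IsSimpleRoots.scalarK_isCPolys {T : SimpleType n} (hα : IsSimpleRoots T α)
    {K : MvPolynomial (Fin n) ℂ} (hK : IsWeightPoly T α K)
    {p : (Fin n →₀ ℕ) → MvPolynomial (Fin n) ℂ} (hp : IsCPolys T α p) (l l' : Fin n →₀ ℕ) :
    scalarK T α K (polyFun (p l)) (polyFun (p l')) =
      if l = l' then ((stabOrder α l : ℂ))⁻¹ else 0 := by
  have h := hα.isRootBasis
  rw [hα.scalarK_polyFun hK, hα.evalX_of_isCPolys hp, hα.evalX_of_isCPolys hp]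
  simp only [← h.evalAt_polyCConj, ← map_mul]
  rw [hα.integral_alcove, h.coeff_polyC_mul]
  · split_ifs with hl
    · have hv : (volume.real (cell α) : ℂ) * (|weightDet α| : ℝ) = 1 := by
        exact_mod_cast volume_cell (α := α)
      have hc : ((h.orbitFinset (weight α l)).card : ℂ) * stabOrder α l = h.weylFinset.card := by
        exact_mod_cast h.card_orbit_mul l
      have h0 : (h.weylFinset.card : ℂ) ≠ 0 := by exact_mod_cast h.weylFinset_card_pos.ne'
      have h1 : (stabOrder α l : ℂ) ≠ 0 := by exact_mod_cast (h.stabOrder_pos l).ne'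
      calc _ = ((h.orbitFinset (weight α l)).card : ℂ) *
            (volume.real (cell α) * (|weightDet α| : ℝ)) / h.weylFinset.card := by ring
        _ = _ := by
          rw [hv, mul_one, div_eq_iff h0, ← hc]
          field_simp
    · simp
  · intro i x
    rw [map_mul, map_mul, h.evalAt_polyCConj, h.evalAt_polyCConj, h.polyC_symm, h.polyC_symm]
  · exact mul_mem (sum_mem fun ν hν => single_mem_weightAlg (h.isWeight_orbit hν) 1)
      (sum_mem fun ν hν => single_mem_weightAlg (h.isWeight_orbit hν).neg 1)

/-! ### Density of the polynomials -/

/-- The polynomials as continuous functions on a set. -/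
def polyContinuous (s : Set (Eucl n)) : MvPolynomial (Fin n) ℂ →ₐ[ℂ] C(s, ℂ) :=
  MvPolynomial.aeval fun j => ⟨fun y => ((y.1 j : ℝ) : ℂ), by fun_prop⟩

theorem polyContinuous_apply (s : Set (Eucl n)) (q : MvPolynomial (Fin n) ℂ) (y : s) :
    polyContinuous s q y = polyFun q y := by
  have h1 : (ContinuousMap.evalAlgHom ℂ ℂ y).comp (polyContinuous s) =
      MvPolynomial.aeval fun j => ((y.1 j : ℝ) : ℂ) :=
    MvPolynomial.algHom_ext fun j => by
      rw [AlgHom.comp_apply, polyContinuous, MvPolynomial.aeval_X, MvPolynomial.aeval_X]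
      rfl
  rw [polyFun, ← MvPolynomial.aeval_eq_eval, ← h1]
  rfl

theorem polyFun_conj (q : MvPolynomial (Fin n) ℂ) (y : Eucl n) :
    polyFun (MvPolynomial.map (starRingEnd ℂ) q) y = conj (polyFun q y) := by
  induction q using MvPolynomial.induction_on with
  | C a => simp [polyFun]
  | add p q hp hq =>
    simp only [polyFun, map_add] at hp hq ⊢
    rw [hp, hq]
  | mul_X p i hp =>
    simp only [polyFun, map_mul, MvPolynomial.map_X, MvPolynomial.eval_X, Complex.conj_ofReal]
      at hp ⊢
    rw [hp]

/-- The polynomials as a star subalgebra of the continuous functions. -/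
def polyStar (s : Set (Eucl n)) : StarSubalgebra ℂ C(s, ℂ) where
  __ := (polyContinuous s).range
  star_mem' := by
    rintro _ ⟨q, rfl⟩
    refine ⟨MvPolynomial.map (starRingEnd ℂ) q, ?_⟩
    ext y
    change polyContinuous s _ y = conj (polyContinuous s q y)
    rw [polyContinuous_apply, polyContinuous_apply, polyFun_conj]

theorem polyStar_separatesPoints (s : Set (Eucl n)) : (polyStar s).SeparatesPoints := by
  intro y y' hne
  obtain ⟨j, hj⟩ : ∃ j, y.1 j ≠ y'.1 j := by
    by_contra hcon
    push Not at hcon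
    exact hne (Subtype.ext (PiLp.ext hcon))
  refine ⟨_, ⟨polyContinuous s (MvPolynomial.X j), ⟨_, rfl⟩, rfl⟩, ?_⟩
  change polyContinuous s (MvPolynomial.X j) y ≠ polyContinuous s (MvPolynomial.X j) y'
  rw [polyContinuous_apply, polyContinuous_apply, polyFun, polyFun, MvPolynomial.eval_X,
    MvPolynomial.eval_X, Ne, Complex.ofReal_inj]
  exact hj

/-- Weierstrass approximation on a compact set. -/
theorem exists_polyFun_near {s : Set (Eucl n)} (hs : IsCompact s) {g : Eucl n → ℂ}
    (hg : Continuous g) {ε : ℝ} (hε : 0 < ε) :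
    ∃ q : MvPolynomial (Fin n) ℂ, ∀ y ∈ s, ‖g y - polyFun q y‖ ≤ ε := by
  have : CompactSpace s := isCompact_iff_compactSpace.1 hs
  let G : C(s, ℂ) := ⟨fun y => g y, by fun_prop⟩
  have hG : G ∈ (polyStar s).topologicalClosure := by
    rw [ContinuousMap.starSubalgebra_topologicalClosure_eq_top_of_separatesPoints _
      (polyStar_separatesPoints s)]
    trivial
  obtain ⟨_, ⟨q, rfl⟩, hq⟩ := Metric.mem_closure_iff.1 hG ε hε
  refine ⟨q, fun y hy => ?_⟩
  have h1 := ContinuousMap.dist_apply_le_dist (f := G) (g := polyContinuous s q) ⟨y, hy⟩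
  rw [polyContinuous_apply, dist_eq_norm] at h1
  exact h1.trans hq.le

/-- The class of a polynomial in `L²_K(Ω)`. -/
def IsSimpleRoots.toL2 {T : SimpleType n} (hα : IsSimpleRoots T α) {K : MvPolynomial (Fin n) ℂ}
    (hK : IsWeightPoly T α K) : MvPolynomial (Fin n) ℂ →ₗ[ℂ] L2K T α K where
  toFun q := (hα.memLp_polyFun hK q).toLp
  map_add' p q := by
    rw [← MemLp.toLp_add]
    exact MemLp.toLp_congr _ _ (Filter.Eventually.of_forall fun y => map_add _ p q)
  map_smul' c q := by
    rw [RingHom.id_apply, ← MemLp.toLp_const_smul]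
    refine MemLp.toLp_congr _ _ (Filter.Eventually.of_forall fun y => ?_)
    exact MvPolynomial.smul_eval _ _ _

theorem IsSimpleRoots.dense_toL2 {T : SimpleType n} (hα : IsSimpleRoots T α)
    {K : MvPolynomial (Fin n) ℂ} (hK : IsWeightPoly T α K) :
    Dense (Set.range (hα.toL2 hK)) := by
  have := hα.isFiniteMeasure_measureK hK
  intro f
  rw [Metric.mem_closure_iff]
  intro ε hε
  obtain ⟨g, hg, hg'⟩ := (Lp.memLp f).exists_boundedContinuous_eLpNorm_sub_le ENNReal.ofNat_ne_top
    (ε := ENNReal.ofReal (ε / 3)) (ENNReal.ofReal_pos.2 (by positivity)).ne'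
  set m := (measureK T α K).real Set.univ with hm
  have hm0 : 0 ≤ m := measureReal_nonneg
  obtain ⟨q, hq⟩ := exists_polyFun_near hα.isCompact_domainOmega g.continuous
    (ε := ε / (3 * (m ^ (2 : ℝ)⁻¹ + 1))) (by positivity)
  refine ⟨_, ⟨q, rfl⟩, ?_⟩
  have h1 : eLpNorm (⇑g - polyFun q) 2 (measureK T α K) ≤ ENNReal.ofReal (ε / 3) := by
    refine (eLpNorm_le_of_ae_bound (C := ε / (3 * (m ^ (2 : ℝ)⁻¹ + 1))) ?_).trans ?_
    · filter_upwards [hα.ae_mem_domainOmega K] with y hy using hq y hy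
    · rw [ENNReal.toReal_ofNat, ← ENNReal.ofReal_toReal (measure_ne_top (measureK T α K) Set.univ),
        ENNReal.ofReal_rpow_of_nonneg ENNReal.toReal_nonneg (by positivity), ← ENNReal.ofReal_mul (by positivity)]
      refine ENNReal.ofReal_le_ofReal ?_
      change m ^ (2 : ℝ)⁻¹ * _ ≤ _
      have h2 : 0 ≤ m ^ (2 : ℝ)⁻¹ := by positivity
      rw [mul_div_assoc', div_le_div_iff₀ (by positivity) (by positivity)]
      nlinarith
  have h2 : eLpNorm (⇑f - polyFun q) 2 (measureK T α K) ≤ ENNReal.ofReal (ε / 3 + ε / 3) := by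
    rw [← sub_add_sub_cancel _ (g : Eucl n → ℂ), ENNReal.ofReal_add (by positivity) (by positivity)]
    exact (eLpNorm_add_le ((Lp.memLp f).sub hg').1 (hg'.sub (hα.memLp_polyFun hK q)).1
      one_le_two).trans (add_le_add hg h1)
  have h3 : f - hα.toL2 hK q = ((Lp.memLp f).sub (hα.memLp_polyFun hK q)).toLp := by
    rw [MemLp.toLp_sub (Lp.memLp f) (hα.memLp_polyFun hK q), Lp.toLp_coeFn]
    rfl
  rw [dist_eq_norm, h3, Lp.norm_toLp]
  refine (ENNReal.toReal_le_of_le_ofReal (by positivity) h2).trans_lt (by linarith)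

/-! ### The orthonormal basis -/

theorem mem_polysUpTo_self (q : MvPolynomial (Fin n) ℂ) :
    q ∈ polysUpTo α (MvPolynomial.weightedTotalDegree (dualMarks α) q) :=
  le_refl (MvPolynomial.weightedTotalDegree (dualMarks α) q)

section Basis

variable {T : SimpleType n} (hα : IsSimpleRoots T α) {K : MvPolynomial (Fin n) ℂ}
  (hK : IsWeightPoly T α K) {p : (Fin n →₀ ℕ) → MvPolynomial (Fin n) ℂ}

theorem IsSimpleRoots.inner_toL2 (f : L2K T α K) (q : MvPolynomial (Fin n) ℂ) :
    inner ℂ (hα.toL2 hK q) f = scalarK T α K f (polyFun q) := by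
  rw [hα.inner_eq_scalarK hK]
  exact hα.scalarK_congr hK Filter.EventuallyEq.rfl (MemLp.coeFn_toLp (hα.memLp_polyFun hK q))

theorem IsSimpleRoots.inner_toL2_toL2 (hp : IsCPolys T α p) (l l' : Fin n →₀ ℕ) :
    inner ℂ (hα.toL2 hK (p l)) (hα.toL2 hK (p l')) =
      if l = l' then ((stabOrder α l : ℂ))⁻¹ else 0 := by
  rw [hα.inner_toL2]
  refine (hα.scalarK_congr hK (MemLp.coeFn_toLp (hα.memLp_polyFun hK (p l')))
    Filter.EventuallyEq.rfl).trans ?_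
  rw [hα.scalarK_isCPolys hK hp]
  split_ifs with h1 h2 h2
  · rw [h1]
  · exact absurd h1.symm h2
  · exact absurd h2.symm h1
  · rfl

theorem IsRootBasis.sqrt_stabOrder_ne_zero (h : IsRootBasis α) (l : Fin n →₀ ℕ) :
    ((√(stabOrder α l : ℝ) : ℝ) : ℂ) ≠ 0 :=
  Complex.ofReal_ne_zero.2 (Real.sqrt_ne_zero'.2 (by exact_mod_cast h.stabOrder_pos l))

theorem sqrt_stabOrder_mul_self (l : Fin n →₀ ℕ) :
    ((√(stabOrder α l : ℝ) : ℝ) : ℂ) * ((√(stabOrder α l : ℝ) : ℝ) : ℂ) = stabOrder α l := by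
  rw [← Complex.ofReal_mul, Real.mul_self_sqrt (Nat.cast_nonneg _), Complex.ofReal_natCast]

theorem IsSimpleRoots.orthonormal (hp : IsCPolys T α p) : Orthonormal ℂ fun l =>
    ((√(stabOrder α l : ℝ) : ℝ) : ℂ) • hα.toL2 hK (p l) := by
  classical
  rw [orthonormal_iff_ite]
  intro l l'
  rw [inner_smul_left, inner_smul_right, hα.inner_toL2_toL2 hK hp, Complex.conj_ofReal]
  split_ifs with h
  · subst h
    rw [← mul_assoc, sqrt_stabOrder_mul_self]
    exact mul_inv_cancel₀ (Nat.cast_ne_zero.2 (hα.isRootBasis.stabOrder_pos l).ne')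
  · rw [mul_zero, mul_zero]

theorem IsSimpleRoots.span_eq_top (hp : IsCPolys T α p) :
    ⊤ ≤ (Submodule.span ℂ (Set.range fun l =>
      ((√(stabOrder α l : ℝ) : ℝ) : ℂ) • hα.toL2 hK (p l))).topologicalClosure := by
  set S := Submodule.span ℂ (Set.range fun l =>
      ((√(stabOrder α l : ℝ) : ℝ) : ℂ) • hα.toL2 hK (p l))
  have h1 : ∀ l, hα.toL2 hK (p l) ∈ S := fun l =>
    (S.smul_mem_iff (hα.isRootBasis.sqrt_stabOrder_ne_zero l)).1 (Submodule.subset_span ⟨l, rfl⟩)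
  have h2 : Set.range (hα.toL2 hK) ⊆ S := by
    rintro _ ⟨q, rfl⟩
    obtain ⟨c, hc⟩ := hα.eq_sum_isCPolys hp
      (M := MvPolynomial.weightedTotalDegree (dualMarks α) q) (mem_polysUpTo_self q)
    rw [hc, map_sum]
    exact sum_mem fun l _ => by rw [map_smul]; exact S.smul_mem _ (h1 l)
  intro f _
  exact closure_mono h2 (hα.dense_toL2 hK f)

/-- The Hilbert basis `√h_λ p_λ`. -/
def IsSimpleRoots.hilbertBasis (hp : IsCPolys T α p) :
    HilbertBasis (Fin n →₀ ℕ) ℂ (L2K T α K) :=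
  HilbertBasis.mk (hα.orthonormal hK hp) (hα.span_eq_top hK hp)

theorem IsSimpleRoots.hilbertBasis_apply (hp : IsCPolys T α p) (l : Fin n →₀ ℕ) :
    hα.hilbertBasis hK hp l = ((√(stabOrder α l : ℝ) : ℝ) : ℂ) • hα.toL2 hK (p l) := by
  rw [IsSimpleRoots.hilbertBasis, HilbertBasis.coe_mk]

theorem IsSimpleRoots.coeffK_smul (hp : IsCPolys T α p) (f : L2K T α K) (l : Fin n →₀ ℕ) :
    (hα.hilbertBasis hK hp).repr f l • hα.hilbertBasis hK hp l =
      coeffK T α K p f l • hα.toL2 hK (p l) := by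
  rw [HilbertBasis.repr_apply_apply, hα.hilbertBasis_apply hK hp, inner_smul_left, hα.inner_toL2,
    Complex.conj_ofReal, smul_smul, coeffK, ← sqrt_stabOrder_mul_self]
  congr 1
  ring

theorem IsSimpleRoots.hasSum_coeffK (hp : IsCPolys T α p) (f : L2K T α K) :
    HasSum (fun l => coeffK T α K p f l • hα.toL2 hK (p l)) f := by
  have := (hα.hilbertBasis hK hp).hasSum_repr f
  simpa only [hα.coeffK_smul hK hp] using this

/-! ### Best approximation -/

theorem IsSimpleRoots.truncation_eq {T : SimpleType n} (hα : IsSimpleRoots T α) {K : MvPolynomial (Fin n) ℂ}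
    {p : (Fin n →₀ ℕ) → MvPolynomial (Fin n) ℂ} (f : L2K T α K) (M : ℕ) : truncation T α K p M f =
    ∑ l ∈ (hα.isRootBasis.finite_weightsUpTo T.rank_pos M).toFinset,
      coeffK T α K p f l • p l :=
  finsum_mem_eq_finite_toFinset_sum _ _

theorem IsSimpleRoots.truncation_mem {T : SimpleType n} (hα : IsSimpleRoots T α) {K : MvPolynomial (Fin n) ℂ}
    {p : (Fin n →₀ ℕ) → MvPolynomial (Fin n) ℂ} (hp : IsCPolys T α p) (f : L2K T α K) (M : ℕ) :
    truncation T α K p M f ∈ polysUpTo α M := by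
  rw [hα.truncation_eq]
  refine (polysBelow α M).sum_mem fun l hl => Submodule.smul_mem _ _ (hα.isCPolys_mem hp ?_)
  exact (hα.isRootBasis.finite_weightsUpTo T.rank_pos M).mem_toFinset.1 hl

theorem IsSimpleRoots.inner_sub_truncation (hp : IsCPolys T α p) (f : L2K T α K) {M : ℕ}
    {q : MvPolynomial (Fin n) ℂ} (hq : q ∈ polysUpTo α M) :
    inner ℂ (hα.toL2 hK q) (f - hα.toL2 hK (truncation T α K p M f)) = 0 := by
  have h1 : ∀ l ∈ (hα.isRootBasis.finite_weightsUpTo T.rank_pos M).toFinset,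
      inner ℂ (hα.toL2 hK (p l)) (f - hα.toL2 hK (truncation T α K p M f)) = 0 := fun l hl => by
    rw [inner_sub_right, hα.truncation_eq, map_sum, inner_sum, Finset.sum_eq_single l]
    · rw [map_smul, inner_smul_right, hα.inner_toL2_toL2 hK hp, if_pos rfl, hα.inner_toL2, coeffK,
        mul_right_comm, mul_inv_cancel₀ (Nat.cast_ne_zero.2 (hα.isRootBasis.stabOrder_pos l).ne'),
        one_mul, sub_self]
    · intro l' _ hne
      rw [map_smul, inner_smul_right, hα.inner_toL2_toL2 hK hp, if_neg hne.symm, mul_zero]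
    · exact fun h => absurd hl h
  obtain ⟨c, hc⟩ := hα.eq_sum_isCPolys hp hq
  rw [hc, map_sum, sum_inner]
  exact Finset.sum_eq_zero fun l hl => by rw [map_smul, inner_smul_left, h1 l hl, mul_zero]

theorem IsSimpleRoots.toL2_injective (hp : IsCPolys T α p) : Function.Injective (hα.toL2 hK) := by
  rw [injective_iff_map_eq_zero]
  intro q hq
  obtain ⟨c, hc⟩ := hα.eq_sum_isCPolys hp
    (M := MvPolynomial.weightedTotalDegree (dualMarks α) q) (mem_polysUpTo_self q)
  rw [hc]
  refine Finset.sum_eq_zero fun l hl => ?_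
  have h1 : inner ℂ (hα.toL2 hK (p l)) (hα.toL2 hK q) = 0 := by rw [hq, inner_zero_right]
  rw [hc, map_sum, inner_sum, Finset.sum_eq_single l] at h1
  · rw [map_smul, inner_smul_right, hα.inner_toL2_toL2 hK hp, if_pos rfl] at h1
    rw [(mul_eq_zero.1 h1).resolve_right (inv_ne_zero
      (Nat.cast_ne_zero.2 (hα.isRootBasis.stabOrder_pos l).ne')), zero_smul]
  · intro l' _ hne
    rw [map_smul, inner_smul_right, hα.inner_toL2_toL2 hK hp, if_neg hne.symm, mul_zero]
  · exact fun h => absurd hl h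

theorem IsSimpleRoots.norm_sub_toL2_sq (hp : IsCPolys T α p) (f : L2K T α K) {M : ℕ}
    {q : MvPolynomial (Fin n) ℂ} (hq : q ∈ polysUpTo α M) :
    ‖f - hα.toL2 hK q‖ ^ 2 = ‖f - hα.toL2 hK (truncation T α K p M f)‖ ^ 2 +
      ‖hα.toL2 hK (q - truncation T α K p M f)‖ ^ 2 := by
  set u := truncation T α K p M f
  have h1 : f - hα.toL2 hK q = (f - hα.toL2 hK u) - hα.toL2 hK (q - u) := by
    rw [map_sub]; abel
  have h2 : inner ℂ (hα.toL2 hK (q - u)) (f - hα.toL2 hK u) = 0 :=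
    hα.inner_sub_truncation hK hp f ((polysBelow α M).sub_mem hq (hα.truncation_mem hp f M))
  rw [h1, norm_sub_sq (𝕜 := ℂ), ← inner_conj_symm, h2]
  simp

theorem IsSimpleRoots.best_approximation (hp : IsCPolys T α p) (f : L2K T α K) {M : ℕ}
    {q : MvPolynomial (Fin n) ℂ} (hq : q ∈ polysUpTo α M) :
    ‖f - hα.toL2 hK (truncation T α K p M f)‖ ≤ ‖f - hα.toL2 hK q‖ ∧
      (‖f - hα.toL2 hK q‖ = ‖f - hα.toL2 hK (truncation T α K p M f)‖ →
        q = truncation T α K p M f) := by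
  have h1 := hα.norm_sub_toL2_sq hK hp f hq
  refine ⟨?_, fun he => ?_⟩
  · refine le_of_sq_le_sq ?_ (norm_nonneg _)
    rw [h1]
    exact le_add_of_nonneg_right (sq_nonneg _)
  · rw [he, left_eq_add, pow_eq_zero_iff two_ne_zero, norm_eq_zero] at h1
    exact sub_eq_zero.1 (hα.toL2_injective hK hp (h1.trans (map_zero _).symm))

end Basis

end WeylOrbit

end

theorem mainTheorem5 {n : ℕ} (T : WeylOrbit.SimpleType n)
    (α : Module.Basis (Fin n) ℝ (EuclideanSpace ℝ (Fin n))) (hα : WeylOrbit.IsSimpleRoots T α) :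
    -- the functions `X_j` are real-valued, and the polynomials `K` and `p_λ` exist and are unique
    (∀ x j, ((WeylOrbit.transformX T α x j : ℝ) : ℂ) = WeylOrbit.coordX T α j x) ∧
    (∃! K, WeylOrbit.IsWeightPoly T α K) ∧
    (∃! p, WeylOrbit.IsCPolys T α p) ∧
    ∀ K p, WeylOrbit.IsWeightPoly T α K → WeylOrbit.IsCPolys T α p →
      -- the norm of `L²_K(Ω)` comes from `(·,·)_K`
      (∀ f g : WeylOrbit.L2K T α K, inner ℂ g f = WeylOrbit.scalarK T α K f g) ∧
      ∃ hL : ∀ q, MeasureTheory.MemLp (WeylOrbit.polyFun q) 2 (WeylOrbit.measureK T α K),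
        -- orthogonality
        (∀ l l', WeylOrbit.scalarK T α K (WeylOrbit.polyFun (p l)) (WeylOrbit.polyFun (p l')) =
          if l = l' then ((WeylOrbit.stabOrder α l : ℂ))⁻¹ else 0) ∧
        -- Hilbert basis
        (∃ b : HilbertBasis (Fin n →₀ ℕ) ℂ (WeylOrbit.L2K T α K),
          ∀ l, b l = ((√(WeylOrbit.stabOrder α l : ℝ) : ℝ) : ℂ) • (hL (p l)).toLp) ∧
        (∀ f : WeylOrbit.L2K T α K,
          HasSum (fun l => WeylOrbit.coeffK T α K p f l • (hL (p l)).toLp) f) ∧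
        -- best approximation
        ∀ (f : WeylOrbit.L2K T α K) (M : ℕ),
          (WeylOrbit.weightsUpTo α M).Finite ∧
          WeylOrbit.truncation T α K p M f ∈ WeylOrbit.polysUpTo α M ∧
          ∀ q ∈ WeylOrbit.polysUpTo α M,
            ‖f - (hL (WeylOrbit.truncation T α K p M f)).toLp‖ ≤ ‖f - (hL q).toLp‖ ∧
            (‖f - (hL q).toLp‖ = ‖f - (hL (WeylOrbit.truncation T α K p M f)).toLp‖ →
              q = WeylOrbit.truncation T α K p M f) := by
  refine ⟨hα.transformX_eq, hα.existsUnique_isWeightPoly, hα.existsUnique_isCPolys,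
    fun K p hK hp => ⟨hα.inner_eq_scalarK hK, hα.memLp_polyFun hK, hα.scalarK_isCPolys hK hp,
      ⟨hα.hilbertBasis hK hp, hα.hilbertBasis_apply hK hp⟩, hα.hasSum_coeffK hK hp,
      fun f M => ⟨hα.isRootBasis.finite_weightsUpTo T.rank_pos M, hα.truncation_mem hp f M,
        fun q hq => hα.best_approximation hK hp f hq⟩⟩⟩
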